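/- **Conventions.** A *totally traced category* is a symmetric monoidal category $\mathcal C$ with functions $\mathrm{Tr}^U_{A,B}:\mathcal C(A\otimes U,B\otimes U)\to\mathcal C(A,B)$ that satisfy (writing as if $\mathcal C$ were strict) naturality $h\circ\mathrm{Tr}^U(f)\circ g=\mathrm{Tr}^U((h\otimes 1_U)\circ f\circ(g\otimes 1_U))$, dinaturality $\mathrm{Tr}^{U}((1_B\otimes g)\circ f)=\mathrm{Tr}^{U'}(f\circ(1_A\otimes g))$ for $f:A\otimes U\to B\otimes U'$ and $g:U'\to U$, strength $g\otimes\mathrm{Tr}^U(f)=\mathrm{Tr}^U(g\otimes f)$, vanishing I $f=\mathrm{Tr}^I(f)$, vanishing II $\mathrm{Tr}^U(\mathrm{Tr}^V(f))=\mathrm{Tr}^{U\otimes V}(f)$, and yanking $\mathrm{Tr}^A(\sigma_{A,A})=1_A$. A *partially traced category* is a symmetric monoidal category with partial functions $\mathrm{Tr}^U_{A,B}$ for which dinaturality, vanishing I and yanking hold as Kleene equalities (both sides undefined, or both defined and equal), naturality and strength hold as directed Kleene equalities (if the left-hand side is defined, then so is the right-hand side, and they are equal), and vanishing II holds as a Kleene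 equality whenever $\mathrm{Tr}^V(f)$ is defined. Fix a set of object variables and a set of morphism variables, each morphism variable having a domain and a codomain that are object terms built from the object variables, $I$ and $\otimes$. *Morphism terms* $A\to B$ are built from the morphism variables by identities, composition, $\otimes$, the associativity and unit isomorphisms and their inverses, symmetries, and $\mathrm{Tr}$. Given an assignment of objects and morphisms of a totally traced category to the variables, every term has a value; in a partially traced category the value of a term is defined if and only if the values of all its subterms are. The *expanded diagram* of a term is its string diagram, in which wires are labelled by object variables (an object term is drawn as one wire for each occurrence of a variable in it), boxes are labelled by morphism variables, composition joins output wires to input wires, $\otimes$ is juxtaposition, and the trace joins the output wires of $U$ to the input wires of $U$ (which may create closed loops). **Statement.** Let $s,t:A\to B$ be morphism terms. 1. If the equation $s=t$ holds in every totally traced category under every assignment of the variables, then in every partially traced category, under every assignment for which the values of $s$ and $t$ are both defined, these values are equal. 2. If there is a chain of morphism terms $s=t_0,t_1,\dots,t_n=t$ from $A$ to $B$ such that for each $i<n$ the expanded diagrams of $t_i$ and $t_{i+1}$ are isomorphic (by bijections of wires and of boxes that respect the labels and the attachment of wires to the ports of the boxes and of the diagram), then in every partially traced category, under every assignment for which the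 values of $s$ and $t$ are both defined, these values are equal. The values of $t_1,\dots,t_{n-1}$ need not be defined. -/

import Mathlib

open CategoryTheory MonoidalCategory

universe w u v u' v'

/-! ### Totally and partially traced symmetric monoidal categories -/

/-- A (total) trace on a symmetric monoidal category. The associators and unitors that are
suppressed when one writes as if the category were strict are written out. -/
class TracedCategory (C : Type u) [Category.{v} C] [MonoidalCategory C] [SymmetricCategory C] where
  /-- The trace `Tr^U_{A,B}`. -/
  tr : ∀ {A B U : C}, (A ⊗ U ⟶ B ⊗ U) → (A ⟶ B)
  naturality : ∀ {A B U A' B' : C} (f : A ⊗ U ⟶ B ⊗ U) (g : A' ⟶ A) (h : B ⟶ B'),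
    g ≫ tr f ≫ h = tr ((g ▷ U) ≫ f ≫ (h ▷ U))
  dinaturality : ∀ {A B U U' : C} (f : A ⊗ U ⟶ B ⊗ U') (g : U' ⟶ U),
    tr (f ≫ (B ◁ g)) = tr ((A ◁ g) ≫ f)
  strength : ∀ {A B U X Y : C} (f : A ⊗ U ⟶ B ⊗ U) (g : X ⟶ Y),
    g ⊗ₘ tr f = tr ((α_ X A U).hom ≫ (g ⊗ₘ f) ≫ (α_ Y B U).inv)
  vanishing_I : ∀ {A B : C} (f : A ⊗ 𝟙_ C ⟶ B ⊗ 𝟙_ C),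
    (ρ_ A).inv ≫ f ≫ (ρ_ B).hom = tr f
  vanishing_II : ∀ {A B U V : C} (f : (A ⊗ U) ⊗ V ⟶ (B ⊗ U) ⊗ V),
    tr (tr f) = tr ((α_ A U V).inv ≫ f ≫ (α_ B U V).hom)
  yanking : ∀ A : C, tr (β_ A A).hom = 𝟙 A

/-- A partial trace on a symmetric monoidal category. On `Part`, equality is Kleene equality
(both sides undefined, or both defined and equal), and `p ≤ q` is directed Kleene equality
(if `p` is defined, then so is `q`, with the same value). -/
class PartiallyTracedCategory (C : Type u) [Category.{v} C] [MonoidalCategory C]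
    [SymmetricCategory C] where
  /-- The partial trace `Tr^U_{A,B}`. -/
  tr : ∀ {A B U : C}, (A ⊗ U ⟶ B ⊗ U) → Part (A ⟶ B)
  naturality : ∀ {A B U A' B' : C} (f : A ⊗ U ⟶ B ⊗ U) (g : A' ⟶ A) (h : B ⟶ B'),
    (tr f).map (fun k => g ≫ k ≫ h) ≤ tr ((g ▷ U) ≫ f ≫ (h ▷ U))
  dinaturality : ∀ {A B U U' : C} (f : A ⊗ U ⟶ B ⊗ U') (g : U' ⟶ U),
    tr (f ≫ (B ◁ g)) = tr ((A ◁ g) ≫ f)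
  strength : ∀ {A B U X Y : C} (f : A ⊗ U ⟶ B ⊗ U) (g : X ⟶ Y),
    (tr f).map (fun k => g ⊗ₘ k) ≤ tr ((α_ X A U).hom ≫ (g ⊗ₘ f) ≫ (α_ Y B U).inv)
  vanishing_I : ∀ {A B : C} (f : A ⊗ 𝟙_ C ⟶ B ⊗ 𝟙_ C),
    Part.some ((ρ_ A).inv ≫ f ≫ (ρ_ B).hom) = tr f
  vanishing_II : ∀ {A B U V : C} (f : (A ⊗ U) ⊗ V ⟶ (B ⊗ U) ⊗ V), (tr f).Dom →
    (tr f).bind (fun k => tr k) = tr ((α_ A U V).inv ≫ f ≫ (α_ B U V).hom)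
  yanking : ∀ A : C, tr (β_ A A).hom = Part.some (𝟙 A)

/-! ### The language of traced symmetric monoidal categories -/

/-- Object terms over a type `O` of object variables. -/
inductive ObjTerm (O : Type w) : Type w
  | var (X : O) : ObjTerm O
  | unit : ObjTerm O
  | tensor (A B : ObjTerm O) : ObjTerm O

/-- A signature: object variables, and morphism variables, each with a domain and a codomain
that are object terms. -/
structure TraceSignature : Type (w + 1) where
  Obj : Type w
  Mor : Type w
  dom : Mor → ObjTerm Obj
  cod : Mor → ObjTerm Obj

/-- Well-formed morphism terms `A ⟶ B` of the language of traced symmetric monoidal categories.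
Composition is written in diagrammatic order. -/
inductive TraceTerm (S : TraceSignature.{w}) : ObjTerm S.Obj → ObjTerm S.Obj → Type w
  | var (m : S.Mor) : TraceTerm S (S.dom m) (S.cod m)
  | id (A : ObjTerm S.Obj) : TraceTerm S A A
  | comp {A B C : ObjTerm S.Obj} (f : TraceTerm S A B) (g : TraceTerm S B C) : TraceTerm S A C
  | tensor {A B C D : ObjTerm S.Obj} (f : TraceTerm S A B) (g : TraceTerm S C D) :
      TraceTerm S (.tensor A C) (.tensor B D)
  | assoc (A B C : ObjTerm S.Obj) :
      TraceTerm S (.tensor (.tensor A B) C) (.tensor A (.tensor B C))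
  | assocInv (A B C : ObjTerm S.Obj) :
      TraceTerm S (.tensor A (.tensor B C)) (.tensor (.tensor A B) C)
  | leftUnitor (A : ObjTerm S.Obj) : TraceTerm S (.tensor .unit A) A
  | leftUnitorInv (A : ObjTerm S.Obj) : TraceTerm S A (.tensor .unit A)
  | rightUnitor (A : ObjTerm S.Obj) : TraceTerm S (.tensor A .unit) A
  | rightUnitorInv (A : ObjTerm S.Obj) : TraceTerm S A (.tensor A .unit)
  | symm (A B : ObjTerm S.Obj) : TraceTerm S (.tensor A B) (.tensor B A)
  | trace {A B U : ObjTerm S.Obj} (f : TraceTerm S (.tensor A U) (.tensor B U)) : TraceTerm S A B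

/-! ### Interpretation in totally and in partially traced categories -/

section Interpretation

variable {C : Type u} [Category.{v} C] [MonoidalCategory C]

/-- The value of an object term. -/
def ObjTerm.eval {O : Type w} (o : O → C) : ObjTerm O → C
  | .var X => o X
  | .unit => 𝟙_ C
  | .tensor A B => A.eval o ⊗ B.eval o

variable (C) in
/-- An assignment of objects and morphisms of `C` to the variables of a signature. -/
structure TraceValuation (S : TraceSignature.{w}) where
  obj : S.Obj → C
  mor : ∀ m : S.Mor, (S.dom m).eval obj ⟶ (S.cod m).eval obj

variable [SymmetricCategory C] {S : TraceSignature.{w}}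

/-- The value of a morphism term in a totally traced category. -/
def TraceTerm.eval [TracedCategory C] (x : TraceValuation C S) :
    ∀ {A B : ObjTerm S.Obj}, TraceTerm S A B → (A.eval x.obj ⟶ B.eval x.obj)
  | _, _, .var m => x.mor m
  | _, _, .id A => 𝟙 (A.eval x.obj)
  | _, _, .comp f g => f.eval x ≫ g.eval x
  | _, _, .tensor f g => f.eval x ⊗ₘ g.eval x
  | _, _, .assoc A B C => (α_ (A.eval x.obj) (B.eval x.obj) (C.eval x.obj)).hom
  | _, _, .assocInv A B C => (α_ (A.eval x.obj) (B.eval x.obj) (C.eval x.obj)).inv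
  | _, _, .leftUnitor A => (λ_ (A.eval x.obj)).hom
  | _, _, .leftUnitorInv A => (λ_ (A.eval x.obj)).inv
  | _, _, .rightUnitor A => (ρ_ (A.eval x.obj)).hom
  | _, _, .rightUnitorInv A => (ρ_ (A.eval x.obj)).inv
  | _, _, .symm A B => (β_ (A.eval x.obj) (B.eval x.obj)).hom
  | _, _, .trace f => TracedCategory.tr (f.eval x)

/-- The partially defined value of a morphism term in a partially traced category: it is defined
iff the values of all subterms are defined. -/
def TraceTerm.peval [PartiallyTracedCategory C] (x : TraceValuation C S) :
    ∀ {A B : ObjTerm S.Obj}, TraceTerm S A B → Part (A.eval x.obj ⟶ B.eval x.obj)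
  | _, _, .var m => Part.some (x.mor m)
  | _, _, .id A => Part.some (𝟙 (A.eval x.obj))
  | _, _, .comp f g => (f.peval x).bind fun a => (g.peval x).map fun b => a ≫ b
  | _, _, .tensor f g => (f.peval x).bind fun a => (g.peval x).map fun b => a ⊗ₘ b
  | _, _, .assoc A B C => Part.some (α_ (A.eval x.obj) (B.eval x.obj) (C.eval x.obj)).hom
  | _, _, .assocInv A B C => Part.some (α_ (A.eval x.obj) (B.eval x.obj) (C.eval x.obj)).inv
  | _, _, .leftUnitor A => Part.some (λ_ (A.eval x.obj)).hom
  | _, _, .leftUnitorInv A => Part.some (λ_ (A.eval x.obj)).inv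
  | _, _, .rightUnitor A => Part.some (ρ_ (A.eval x.obj)).hom
  | _, _, .rightUnitorInv A => Part.some (ρ_ (A.eval x.obj)).inv
  | _, _, .symm A B => Part.some (β_ (A.eval x.obj) (B.eval x.obj)).hom
  | _, _, .trace f => (f.peval x).bind fun a => PartiallyTracedCategory.tr a

end Interpretation

/-- The equation `s = t` is a law of totally traced categories: it holds in every totally traced
category under every assignment of its variables. -/
def IsTracedLaw {S : TraceSignature.{w}} {A B : ObjTerm S.Obj} (s t : TraceTerm S A B) : Prop :=
  ∀ (D : Type u) [Category.{v} D] [MonoidalCategory D] [SymmetricCategory D] [TracedCategory D]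
    (x : TraceValuation D S), s.eval x = t.eval x

/-- The equation `s = t` holds in every partially traced category, under every assignment of its
variables for which both sides are defined. -/
def HoldsWhenDefined {S : TraceSignature.{w}} {A B : ObjTerm S.Obj} (s t : TraceTerm S A B) :
    Prop :=
  ∀ (C : Type u) [Category.{v} C] [MonoidalCategory C] [SymmetricCategory C]
    [PartiallyTracedCategory C] (x : TraceValuation C S),
    ∀ f ∈ s.peval x, ∀ g ∈ t.peval x, f = g

/-! ### The graphical language

Diagrams are expanded: their wires are labelled by object variables and their boxes by morphism
variables. An object term `A` is drawn as one wire for each occurrence of a variable in `A`. -/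

/-- The occurrences of variables in an object term, i.e. the wires by which it is drawn. -/
def ObjTerm.Pos {O : Type w} : ObjTerm O → Type
  | .var _ => Unit
  | .unit => Empty
  | .tensor A B => A.Pos ⊕ B.Pos

/-- The variable that occurs at a given position. -/
def ObjTerm.label {O : Type w} : (A : ObjTerm O) → A.Pos → O
  | .var X, _ => X
  | .tensor A B, p => Sum.elim A.label B.label p

theorem ObjTerm.finite_pos {O : Type w} : (A : ObjTerm O) → Finite A.Pos
  | .var _ => inferInstanceAs (Finite Unit)
  | .unit => inferInstanceAs (Finite Empty)
  | .tensor A B =>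
    have := A.finite_pos
    have := B.finite_pos
    inferInstanceAs (Finite (A.Pos ⊕ B.Pos))

/-- An expanded diagram from `A` to `B`: finitely many wires, each labelled by an object variable;
finitely many boxes, each labelled by a morphism variable; and, for every input port and every
output port of the diagram and of its boxes, the wire that is attached there, which has the label
that the port requires. A wire that is attached to no port is a closed loop. -/
structure TraceDiagram (S : TraceSignature.{w}) (A B : ObjTerm S.Obj) where
  Wire : Type
  /-- `Box m` is the type of the boxes labelled `m`. -/
  Box : S.Mor → Type
  label : Wire → S.Obj
  inp : A.Pos → Wire
  out : B.Pos → Wire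
  boxIn : ∀ {m : S.Mor}, Box m → (S.dom m).Pos → Wire
  boxOut : ∀ {m : S.Mor}, Box m → (S.cod m).Pos → Wire
  finite_wire : Finite Wire
  finite_box : Finite (Σ m, Box m)
  label_inp : ∀ p, label (inp p) = A.label p
  label_out : ∀ p, label (out p) = B.label p
  label_boxIn : ∀ {m : S.Mor} (b : Box m) p, label (boxIn b p) = (S.dom m).label p
  label_boxOut : ∀ {m : S.Mor} (b : Box m) p, label (boxOut b p) = (S.cod m).label p

namespace TraceDiagram

variable {S : TraceSignature.{w}}

/-- An isomorphism of diagrams: bijections of the wires and of the boxes that respect the labels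
and the attachment of wires to ports. -/
structure Iso {A B : ObjTerm S.Obj} (D E : TraceDiagram S A B) where
  wire : D.Wire ≃ E.Wire
  box : ∀ m : S.Mor, D.Box m ≃ E.Box m
  label_wire : ∀ a, E.label (wire a) = D.label a
  wire_inp : ∀ p, wire (D.inp p) = E.inp p
  wire_out : ∀ p, wire (D.out p) = E.out p
  wire_boxIn : ∀ {m : S.Mor} (b : D.Box m) p, wire (D.boxIn b p) = E.boxIn (box m b) p
  wire_boxOut : ∀ {m : S.Mor} (b : D.Box m) p, wire (D.boxOut b p) = E.boxOut (box m b) p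

/-- The diagram that consists of a single box. -/
def single (m : S.Mor) : TraceDiagram S (S.dom m) (S.cod m) where
  Wire := (S.dom m).Pos ⊕ (S.cod m).Pos
  Box m' := PLift (m' = m)
  label := Sum.elim (S.dom m).label (S.cod m).label
  inp := Sum.inl
  out := Sum.inr
  boxIn := fun | ⟨rfl⟩, p => Sum.inl p
  boxOut := fun | ⟨rfl⟩, p => Sum.inr p
  finite_wire :=
    have := (S.dom m).finite_pos
    have := (S.cod m).finite_pos
    inferInstance
  finite_box :=
    have : Subsingleton (Σ m', PLift (m' = m)) :=
      ⟨by rintro ⟨_, ⟨rfl⟩⟩ ⟨_, ⟨rfl⟩⟩; rfl⟩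
    inferInstance
  label_inp _ := rfl
  label_out _ := rfl
  label_boxIn := by rintro _ ⟨rfl⟩ p; rfl
  label_boxOut := by rintro _ ⟨rfl⟩ p; rfl

/-- The diagram without boxes and loops in which the output wire at `p` is the input wire at
`e p`. -/
def wiring {A B : ObjTerm S.Obj} (e : B.Pos ≃ A.Pos) (he : ∀ p, A.label (e p) = B.label p) :
    TraceDiagram S A B where
  Wire := A.Pos
  Box _ := Empty
  label := A.label
  inp p := p
  out := e
  boxIn b := b.elim
  boxOut b := b.elim
  finite_wire := A.finite_pos
  finite_box :=
    have : IsEmpty (Σ _ : S.Mor, Empty) := ⟨fun b => b.2.elim⟩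
    inferInstance
  label_inp _ := rfl
  label_out := he
  label_boxIn b := b.elim
  label_boxOut b := b.elim

/-- Juxtaposition of diagrams. -/
def tensor {A B A' B' : ObjTerm S.Obj} (D : TraceDiagram S A B) (E : TraceDiagram S A' B') :
    TraceDiagram S (.tensor A A') (.tensor B B') where
  Wire := D.Wire ⊕ E.Wire
  Box m := D.Box m ⊕ E.Box m
  label := Sum.elim D.label E.label
  inp := Sum.map D.inp E.inp
  out := Sum.map D.out E.out
  boxIn b p := b.elim (fun b => Sum.inl (D.boxIn b p)) (fun b => Sum.inr (E.boxIn b p))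
  boxOut b p := b.elim (fun b => Sum.inl (D.boxOut b p)) (fun b => Sum.inr (E.boxOut b p))
  finite_wire :=
    have := D.finite_wire
    have := E.finite_wire
    inferInstance
  finite_box :=
    have := D.finite_box
    have := E.finite_box
    Finite.of_equiv _ (Equiv.sigmaSumDistrib D.Box E.Box).symm
  label_inp := Sum.rec D.label_inp E.label_inp
  label_out := Sum.rec D.label_out E.label_out
  label_boxIn := Sum.rec D.label_boxIn E.label_boxIn
  label_boxOut := Sum.rec D.label_boxOut E.label_boxOut

/-- In the composite of two diagrams, the output wires of the first are joined to the
corresponding input wires of the second. -/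
inductive CompRel {A B C : ObjTerm S.Obj} (D : TraceDiagram S A B) (E : TraceDiagram S B C) :
    D.Wire ⊕ E.Wire → D.Wire ⊕ E.Wire → Prop
  | join (p : B.Pos) : CompRel D E (Sum.inl (D.out p)) (Sum.inr (E.inp p))

/-- Composition of diagrams. -/
def comp {A B C : ObjTerm S.Obj} (D : TraceDiagram S A B) (E : TraceDiagram S B C) :
    TraceDiagram S A C where
  Wire := Quot (CompRel D E)
  Box m := D.Box m ⊕ E.Box m
  label := Quot.lift (Sum.elim D.label E.label) (by
    rintro _ _ ⟨p⟩
    exact (D.label_out p).trans (E.label_inp p).symm)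
  inp p := Quot.mk _ (Sum.inl (D.inp p))
  out p := Quot.mk _ (Sum.inr (E.out p))
  boxIn b p := Quot.mk _
    (b.elim (fun b => Sum.inl (D.boxIn b p)) (fun b => Sum.inr (E.boxIn b p)))
  boxOut b p := Quot.mk _
    (b.elim (fun b => Sum.inl (D.boxOut b p)) (fun b => Sum.inr (E.boxOut b p)))
  finite_wire :=
    have := D.finite_wire
    have := E.finite_wire
    Finite.of_surjective _ Quot.mk_surjective
  finite_box :=
    have := D.finite_box
    have := E.finite_box
    Finite.of_equiv _ (Equiv.sigmaSumDistrib D.Box E.Box).symm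
  label_inp := D.label_inp
  label_out := E.label_out
  label_boxIn := Sum.rec D.label_boxIn E.label_boxIn
  label_boxOut := Sum.rec D.label_boxOut E.label_boxOut

/-- In the trace of a diagram, the output wires that belong to `U` are joined to the corresponding
input wires. -/
inductive TraceRel {A B U : ObjTerm S.Obj} (D : TraceDiagram S (.tensor A U) (.tensor B U)) :
    D.Wire → D.Wire → Prop
  | join (p : U.Pos) : TraceRel D (D.out (Sum.inr p)) (D.inp (Sum.inr p))

/-- The trace of a diagram. -/
def trace {A B U : ObjTerm S.Obj} (D : TraceDiagram S (.tensor A U) (.tensor B U)) :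
    TraceDiagram S A B where
  Wire := Quot (TraceRel D)
  Box := D.Box
  label := Quot.lift D.label (by
    rintro _ _ ⟨p⟩
    exact (D.label_out (Sum.inr p)).trans (D.label_inp (Sum.inr p)).symm)
  inp p := Quot.mk _ (D.inp (Sum.inl p))
  out p := Quot.mk _ (D.out (Sum.inl p))
  boxIn b p := Quot.mk _ (D.boxIn b p)
  boxOut b p := Quot.mk _ (D.boxOut b p)
  finite_wire :=
    have := D.finite_wire
    Finite.of_surjective _ Quot.mk_surjective
  finite_box := D.finite_box
  label_inp p := D.label_inp (Sum.inl p)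
  label_out p := D.label_out (Sum.inl p)
  label_boxIn := D.label_boxIn
  label_boxOut := D.label_boxOut

end TraceDiagram

/-- The expanded diagram of a morphism term. -/
def TraceTerm.diagram {S : TraceSignature.{w}} :
    ∀ {A B : ObjTerm S.Obj}, TraceTerm S A B → TraceDiagram S A B
  | _, _, .var m => TraceDiagram.single m
  | _, _, .id A => TraceDiagram.wiring (Equiv.refl A.Pos) fun _ => rfl
  | _, _, .comp f g => f.diagram.comp g.diagram
  | _, _, .tensor f g => f.diagram.tensor g.diagram
  | _, _, .assoc A B C =>
      TraceDiagram.wiring (Equiv.sumAssoc A.Pos B.Pos C.Pos).symm (by rintro (_ | _ | _) <;> rfl)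
  | _, _, .assocInv A B C =>
      TraceDiagram.wiring (Equiv.sumAssoc A.Pos B.Pos C.Pos) (by rintro ((_ | _) | _) <;> rfl)
  | _, _, .leftUnitor A =>
      TraceDiagram.wiring (Equiv.emptySum Empty A.Pos).symm fun _ => rfl
  | _, _, .leftUnitorInv A =>
      TraceDiagram.wiring (Equiv.emptySum Empty A.Pos) (by rintro (h | _); exacts [h.elim, rfl])
  | _, _, .rightUnitor A =>
      TraceDiagram.wiring (Equiv.sumEmpty A.Pos Empty).symm fun _ => rfl
  | _, _, .rightUnitorInv A =>
      TraceDiagram.wiring (Equiv.sumEmpty A.Pos Empty) (by rintro (_ | h); exacts [rfl, h.elim])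
  | _, _, .symm A B =>
      TraceDiagram.wiring (Equiv.sumComm B.Pos A.Pos) (by rintro (_ | _) <;> rfl)
  | _, _, .trace f => f.diagram.trace

/-- A graphical proof of `s = t`: a chain of morphism terms from `s` to `t` in which any two
successive terms have the same expanded diagram up to isomorphism. -/
def GraphicallyProvable {S : TraceSignature.{w}} {A B : ObjTerm S.Obj} (s t : TraceTerm S A B) :
    Prop :=
  Relation.ReflTransGen (fun p q : TraceTerm S A B => Nonempty (p.diagram.Iso q.diagram)) s t

/-! By coherence, a label-preserving bijection between the wires of two object terms has a canonical
value in every symmetric monoidal category.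

*Graphical provability implies validity in totally traced categories.* A term has the same value
as one big trace over all of its boxes, juxtaposed in some order and closed up by a bijection. The
value of the latter depends only on the diagram: the order of the boxes is immaterial by
dinaturality, and hidden wires that are not loops are pulled straight by yanking.

*Validity in totally traced categories implies validity in partially traced ones.* For a partially
traced category `C`, the formal traces of morphisms `A ⊗ U ⟶ B ⊗ U`, modulo dinaturality and
vanishing II for inner traces that are defined, satisfy all laws of a total trace. The
identifications do not change the trace in `C`, defined or not, so that `C` embeds faithfully, and
the value of a term in `C`, if defined, is determined by its value as a formal trace. Identifying
terms that agree as formal traces thus gives a totally traced category, in which the given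
equation holds. -/

/-! ### Label-preserving bijections between object terms -/

instance ObjTerm.instFinitePos {O : Type w} (A : ObjTerm O) : Finite A.Pos := A.finite_pos

/-- A rewiring from `A` to `B`: a label-preserving bijection from the wires of `A` to those
of `B`. -/
structure Rewiring {O : Type w} (A B : ObjTerm O) where
  toEquiv : A.Pos ≃ B.Pos
  label_eq : ∀ p, B.label (toEquiv p) = A.label p

namespace Rewiring

variable {O : Type w} {A B C A' B' : ObjTerm O}

instance : CoeFun (Rewiring A B) (fun _ => A.Pos → B.Pos) := ⟨fun e => e.toEquiv⟩

theorem ext {e f : Rewiring A B} (h : ∀ p, e p = f p) : e = f := by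
  obtain ⟨e, _⟩ := e
  obtain ⟨f, _⟩ := f
  obtain rfl : e = f := Equiv.ext h
  rfl

/-- The identity rewiring. -/
def refl (A : ObjTerm O) : Rewiring A A := ⟨Equiv.refl _, fun _ => rfl⟩

/-- The inverse of a rewiring. -/
def symm (e : Rewiring A B) : Rewiring B A :=
  ⟨e.toEquiv.symm, fun p => by rw [← e.label_eq, Equiv.apply_symm_apply]⟩

/-- The composite of two rewirings, in diagrammatic order. -/
def trans (e : Rewiring A B) (f : Rewiring B C) : Rewiring A C :=
  ⟨e.toEquiv.trans f.toEquiv, fun p => (f.label_eq _).trans (e.label_eq p)⟩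

/-- Juxtaposition of rewirings. -/
def sum (e : Rewiring A B) (f : Rewiring A' B') : Rewiring (A.tensor A') (B.tensor B') :=
  ⟨Equiv.sumCongr e.toEquiv f.toEquiv, Sum.rec e.label_eq f.label_eq⟩

/-- Reassociation. -/
def assoc (A B C : ObjTerm O) : Rewiring ((A.tensor B).tensor C) (A.tensor (B.tensor C)) :=
  ⟨Equiv.sumAssoc A.Pos B.Pos C.Pos, by rintro ((_ | _) | _) <;> rfl⟩

/-- Removal of a unit on the left. -/
def leftUnitor (A : ObjTerm O) : Rewiring (ObjTerm.unit.tensor A) A :=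
  ⟨Equiv.emptySum Empty A.Pos, by rintro (h | _); exacts [h.elim, rfl]⟩

/-- Removal of a unit on the right. -/
def rightUnitor (A : ObjTerm O) : Rewiring (A.tensor ObjTerm.unit) A :=
  ⟨Equiv.sumEmpty A.Pos Empty, by rintro (_ | h); exacts [rfl, h.elim]⟩

/-- The crossing of two bundles of wires. -/
def braid (A B : ObjTerm O) : Rewiring (A.tensor B) (B.tensor A) :=
  ⟨Equiv.sumComm A.Pos B.Pos, by rintro (_ | _) <;> rfl⟩

@[simp] theorem refl_apply (p : A.Pos) : refl A p = p := rfl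

@[simp] theorem trans_apply (e : Rewiring A B) (f : Rewiring B C) (p : A.Pos) :
    e.trans f p = f (e p) := rfl

@[simp] theorem symm_apply_apply (e : Rewiring A B) (p : A.Pos) : e.symm (e p) = p :=
  e.toEquiv.symm_apply_apply p

@[simp] theorem apply_symm_apply (e : Rewiring A B) (p : B.Pos) : e (e.symm p) = p :=
  e.toEquiv.apply_symm_apply p

theorem injective (e : Rewiring A B) {p q : A.Pos} (h : e p = e q) : p = q :=
  e.toEquiv.injective h

theorem symm_apply_eq (e : Rewiring A B) {p : A.Pos} {q : B.Pos} : e.symm q = p ↔ q = e p :=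
  e.toEquiv.symm_apply_eq

@[simp] theorem trans_symm_self (e : Rewiring A B) : e.trans e.symm = refl A :=
  ext fun p => by simp

@[simp] theorem symm_trans_self (e : Rewiring A B) : e.symm.trans e = refl B :=
  ext fun p => by simp

end Rewiring

/-! ### Structural terms -/

/-- Structural terms of symmetric monoidal categories. -/
inductive StructTerm {O : Type w} : ObjTerm O → ObjTerm O → Type w
  | id (A : ObjTerm O) : StructTerm A A
  | comp {A B C : ObjTerm O} (f : StructTerm A B) (g : StructTerm B C) : StructTerm A C
  | inv {A B : ObjTerm O} (f : StructTerm A B) : StructTerm B A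
  | tensor {A B C D : ObjTerm O} (f : StructTerm A B) (g : StructTerm C D) :
      StructTerm (.tensor A C) (.tensor B D)
  | assoc (A B C : ObjTerm O) :
      StructTerm (.tensor (.tensor A B) C) (.tensor A (.tensor B C))
  | leftUnitor (A : ObjTerm O) : StructTerm (.tensor .unit A) A
  | braid (A B : ObjTerm O) : StructTerm (.tensor A B) (.tensor B A)

namespace StructTerm

variable {O : Type w}

/-- The rewiring that underlies a structural term. -/
def perm : ∀ {A B : ObjTerm O}, StructTerm A B → Rewiring A B
  | _, _, .id A => .refl A
  | _, _, .comp f g => f.perm.trans g.perm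
  | _, _, .inv f => f.perm.symm
  | _, _, .tensor f g => f.perm.sum g.perm
  | _, _, .assoc A B C => .assoc A B C
  | _, _, .leftUnitor A => .leftUnitor A
  | _, _, .braid A B => .braid A B

section Eval

variable {C : Type u} [Category.{v} C] [MonoidalCategory C] [SymmetricCategory C]

/-- The value of a structural term in a symmetric monoidal category. -/
def eval (o : O → C) : ∀ {A B : ObjTerm O}, StructTerm A B → (A.eval o ≅ B.eval o)
  | _, _, .id A => Iso.refl _
  | _, _, .comp f g => f.eval o ≪≫ g.eval o
  | _, _, .inv f => (f.eval o).symm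
  | _, _, .tensor f g => f.eval o ⊗ᵢ g.eval o
  | _, _, .assoc A B C => α_ (A.eval o) (B.eval o) (C.eval o)
  | _, _, .leftUnitor A => λ_ (A.eval o)
  | _, _, .braid A B => β_ (A.eval o) (B.eval o)

end Eval

end StructTerm

namespace ObjTerm

variable {O : Type w}

/-- Replaces the variable at a position by the unit. -/
def erase : (A : ObjTerm O) → A.Pos → ObjTerm O
  | .var _, _ => .unit
  | .tensor A B, Sum.inl p => .tensor (A.erase p) B
  | .tensor A B, Sum.inr p => .tensor A (B.erase p)

/-- The remaining positions after one of them is erased. -/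
def incl : (A : ObjTerm O) → (p : A.Pos) → (A.erase p).Pos → A.Pos
  | .var _, _, x => Empty.elim x
  | .tensor A _, Sum.inl p, x => Sum.map (A.incl p) _root_.id x
  | .tensor _ B, Sum.inr p, x => Sum.map _root_.id (B.incl p) x

theorem incl_ne : ∀ (A : ObjTerm O) (p : A.Pos) (x : (A.erase p).Pos), A.incl p x ≠ p
  | .var _, _, x => Empty.elim x
  | .tensor A _, Sum.inl p, Sum.inl x => fun h => A.incl_ne p x (Sum.inl.inj h)
  | .tensor _ B, Sum.inl p, Sum.inr x => fun h => by cases h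
  | .tensor A _, Sum.inr p, Sum.inl x => fun h => by cases h
  | .tensor _ B, Sum.inr p, Sum.inr x => fun h => B.incl_ne p x (Sum.inr.inj h)

theorem incl_injective : ∀ (A : ObjTerm O) (p : A.Pos), Function.Injective (A.incl p)
  | .var _, _ => fun x => Empty.elim x
  | .tensor A _, Sum.inl p => (A.incl_injective p).sumMap Function.injective_id
  | .tensor _ B, Sum.inr p => Function.injective_id.sumMap (B.incl_injective p)

theorem exists_incl : ∀ (A : ObjTerm O) (p y : A.Pos), y ≠ p → ∃ x, A.incl p x = y
  | .var _, _, _ => fun h => (h rfl).elim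
  | .tensor A _, Sum.inl p, Sum.inl y => fun h =>
      (A.exists_incl p y fun h' => h (congrArg _ h')).elim fun x hx =>
        ⟨Sum.inl x, congrArg Sum.inl hx⟩
  | .tensor _ _, Sum.inl _, Sum.inr y => fun _ => ⟨Sum.inr y, rfl⟩
  | .tensor _ _, Sum.inr _, Sum.inl y => fun _ => ⟨Sum.inl y, rfl⟩
  | .tensor _ B, Sum.inr p, Sum.inr y => fun h =>
      (B.exists_incl p y fun h' => h (congrArg _ h')).elim fun x hx =>
        ⟨Sum.inr x, congrArg Sum.inr hx⟩

theorem label_incl : ∀ (A : ObjTerm O) (p : A.Pos) (x : (A.erase p).Pos),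
    A.label (A.incl p x) = (A.erase p).label x
  | .var _, _, x => Empty.elim x
  | .tensor A _, Sum.inl p, Sum.inl x => A.label_incl p x
  | .tensor _ _, Sum.inl _, Sum.inr _ => rfl
  | .tensor _ _, Sum.inr _, Sum.inl _ => rfl
  | .tensor _ B, Sum.inr p, Sum.inr x => B.label_incl p x

theorem card_erase (A : ObjTerm O) (p : A.Pos) : Nat.card (A.erase p).Pos < Nat.card A.Pos := by
  by_contra h
  have hs := (A.incl_injective p).bijective_of_nat_card_le (not_lt.1 h)
  obtain ⟨x, hx⟩ := hs.2 p
  exact A.incl_ne p x hx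

end ObjTerm

namespace StructTerm

variable {O : Type w}

/-- The structural term that moves the wire at `p` to the left. -/
def extract : ∀ (A : ObjTerm O) (p : A.Pos) (X : O), A.label p = X →
    StructTerm A (.tensor (.var X) (A.erase p))
  | .var _, _, _, rfl => .comp (.inv (.leftUnitor _)) (.braid _ _)
  | .tensor A B, Sum.inl p, X, h => .comp (.tensor (extract A p X h) (.id B)) (.assoc _ _ _)
  | .tensor A B, Sum.inr p, X, h =>
      .comp (.tensor (.id A) (extract B p X h)) (.comp (.inv (.assoc _ _ _))
        (.comp (.tensor (.braid _ _) (.id _)) (.assoc _ _ _)))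

theorem perm_extract_self : ∀ (A : ObjTerm O) (p : A.Pos) (X : O) (h : A.label p = X),
    (extract A p X h).perm p = Sum.inl ()
  | .var _, _, _, rfl => rfl
  | .tensor A B, Sum.inl p, X, h => by
      change Equiv.sumAssoc _ _ _ (Sum.inl ((extract A p X h).perm p)) = _
      rw [perm_extract_self A p X h]; rfl
  | .tensor A B, Sum.inr p, X, h => by
      have := perm_extract_self B p X h
      exact congrArg (fun y => Rewiring.assoc _ _ _ ((Rewiring.braid A (.var X)).sum (.refl _)
        ((Rewiring.assoc _ _ _).symm (Sum.inr y)))) this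

theorem perm_extract_incl : ∀ (A : ObjTerm O) (p : A.Pos) (X : O) (h : A.label p = X)
    (x : (A.erase p).Pos), (extract A p X h).perm (A.incl p x) = Sum.inr x
  | .var _, _, _, rfl, x => Empty.elim x
  | .tensor A B, Sum.inl p, X, h, Sum.inl x => by
      change Equiv.sumAssoc _ _ _ (Sum.inl ((extract A p X h).perm (A.incl p x))) = _
      rw [perm_extract_incl A p X h]; rfl
  | .tensor A B, Sum.inl p, X, h, Sum.inr x => rfl
  | .tensor A B, Sum.inr p, X, h, Sum.inl x => rfl
  | .tensor A B, Sum.inr p, X, h, Sum.inr x => by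
      have := perm_extract_incl B p X h x
      change (extract (.tensor A B) (Sum.inr p) X h).perm (Sum.inr (B.incl p x)) = _
      exact congrArg (fun y => Rewiring.assoc _ _ _ ((Rewiring.braid A (.var X)).sum (.refl _)
        ((Rewiring.assoc _ _ _).symm (Sum.inr y)))) this

/-- A structural term to the unit, from an object term without variables. -/
def toUnit : ∀ A : ObjTerm O, IsEmpty A.Pos → StructTerm A .unit
  | .var _, h => (h.false ()).elim
  | .unit, _ => .id _
  | .tensor A B, h => .comp (.tensor (toUnit A ⟨fun p => h.false (Sum.inl p)⟩)
      (toUnit B ⟨fun p => h.false (Sum.inr p)⟩)) (.leftUnitor _)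

section Coherence

variable {C : Type u} [Category.{v} C] [MonoidalCategory C]

theorem toUnit_assoc {A B D : C} (a : A ⟶ 𝟙_ C) (b : B ⟶ 𝟙_ C) (d : D ⟶ 𝟙_ C) :
    (α_ A B D).hom ≫ (a ⊗ₘ ((b ⊗ₘ d) ≫ (λ_ _).hom)) ≫ (λ_ _).hom =
      (((a ⊗ₘ b) ≫ (λ_ _).hom) ⊗ₘ d) ≫ (λ_ _).hom := by
  simp only [MonoidalCategory.tensorHom_def]
  monoidal

theorem toUnit_leftUnitor {A : C} (a : A ⟶ 𝟙_ C) :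
    (λ_ A).hom ≫ a = (𝟙 _ ⊗ₘ a) ≫ (λ_ _).hom := by
  simp

theorem extract_comp {A B D A' B' D' X : C} {f : A ⟶ B} {g : B ⟶ D} {f' : A' ⟶ B'} {g' : B' ⟶ D'}
    {eA : A ⟶ X ⊗ A'} {eB : B ⟶ X ⊗ B'} {eD : D ⟶ X ⊗ D'} (hf : f ≫ eB = eA ≫ X ◁ f')
    (hg : g ≫ eD = eB ≫ X ◁ g') : (f ≫ g) ≫ eD = eA ≫ X ◁ (f' ≫ g') := by
  rw [Category.assoc, hg, reassoc_of% hf, whiskerLeft_comp]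

theorem extract_inv {A B A' B' X : C} {f : A ≅ B} {f' : A' ≅ B'} {eA : A ⟶ X ⊗ A'}
    {eB : B ⟶ X ⊗ B'} (hf : f.hom ≫ eB = eA ≫ X ◁ f'.hom) : f.inv ≫ eA = eB ≫ X ◁ f'.inv := by
  rw [Iso.inv_comp_eq, reassoc_of% hf, ← whiskerLeft_comp, Iso.hom_inv_id, whiskerLeft_id,
    Category.comp_id]

theorem extract_assoc_left {A A' B D X : C} (e : A ⟶ X ⊗ A') :
    (α_ A B D).hom ≫ (e ⊗ₘ 𝟙 (B ⊗ D)) ≫ (α_ _ _ _).hom =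
      ((((e ⊗ₘ 𝟙 B) ≫ (α_ _ _ _).hom) ⊗ₘ 𝟙 D) ≫ (α_ _ _ _).hom) ≫ X ◁ (α_ A' B D).hom := by
  simp

theorem extract_tensor_inl {A A' B D F X : C} {E : C} (f : A ⟶ B) (g : D ⟶ F) (f' : A' ⟶ E)
    (eA : A ⟶ X ⊗ A') (eB : B ⟶ X ⊗ E) (h : f ≫ eB = eA ≫ X ◁ f') :
    (f ⊗ₘ g) ≫ (eB ⊗ₘ 𝟙 F) ≫ (α_ _ _ _).hom =
      ((eA ⊗ₘ 𝟙 D) ≫ (α_ _ _ _).hom) ≫ X ◁ (f' ⊗ₘ g) := by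
  rw [tensorHom_comp_tensorHom_assoc, h]
  simp [MonoidalCategory.tensorHom_def]

variable [SymmetricCategory C]

theorem toUnit_braid {A B : C} (a : A ⟶ 𝟙_ C) (b : B ⟶ 𝟙_ C) :
    (β_ A B).hom ≫ (b ⊗ₘ a) ≫ (λ_ _).hom = (a ⊗ₘ b) ≫ (λ_ _).hom := by
  rw [← BraidedCategory.braiding_naturality_assoc, braiding_leftUnitor, unitors_equal]

theorem extract_tensor_inr {A B D D' F F' X : C} (f : A ⟶ B) (g : D ⟶ F) (g' : D' ⟶ F')
    (eD : D ⟶ X ⊗ D') (eF : F ⟶ X ⊗ F') (h : g ≫ eF = eD ≫ X ◁ g') :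
    (f ⊗ₘ g) ≫ (𝟙 B ⊗ₘ eF) ≫ (α_ _ _ _).inv ≫ ((β_ _ _).hom ⊗ₘ 𝟙 _) ≫ (α_ _ _ _).hom =
      ((𝟙 A ⊗ₘ eD) ≫ (α_ _ _ _).inv ≫ ((β_ _ _).hom ⊗ₘ 𝟙 _) ≫ (α_ _ _ _).hom) ≫
        X ◁ (f ⊗ₘ g') := by
  rw [tensorHom_comp_tensorHom_assoc, h]
  simp only [MonoidalCategory.tensorHom_def, Category.comp_id, whiskerLeft_comp, Category.assoc,
    whiskerLeft_id, id_whiskerRight, Category.id_comp]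
  rw [associator_inv_naturality_right_assoc, whisker_exchange_assoc,
    associator_naturality_right, ← whisker_exchange_assoc, associator_inv_naturality_left_assoc,
    ← comp_whiskerRight_assoc, BraidedCategory.braiding_naturality_left, comp_whiskerRight_assoc,
    associator_naturality_middle_assoc]

theorem extract_assoc_middle {A B B' D X : C} (e : B ⟶ X ⊗ B') :
    (α_ A B D).hom ≫ (𝟙 A ⊗ₘ ((e ⊗ₘ 𝟙 D) ≫ (α_ _ _ _).hom)) ≫
        (α_ _ _ _).inv ≫ ((β_ _ _).hom ⊗ₘ 𝟙 _) ≫ (α_ _ _ _).hom =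
      ((((𝟙 A ⊗ₘ e) ≫ (α_ _ _ _).inv ≫ ((β_ _ _).hom ⊗ₘ 𝟙 _) ≫ (α_ _ _ _).hom) ⊗ₘ 𝟙 D) ≫
        (α_ _ _ _).hom) ≫ X ◁ (α_ A B' D).hom := by
  simp

theorem extract_assoc_right {A B D D' X : C} (e : D ⟶ X ⊗ D') :
    (α_ A B D).hom ≫ (𝟙 A ⊗ₘ ((𝟙 B ⊗ₘ e) ≫ (α_ _ _ _).inv ≫ ((β_ _ _).hom ⊗ₘ 𝟙 _) ≫
        (α_ _ _ _).hom)) ≫ (α_ _ _ _).inv ≫ ((β_ _ _).hom ⊗ₘ 𝟙 _) ≫ (α_ _ _ _).hom =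
      ((𝟙 (A ⊗ B) ⊗ₘ e) ≫ (α_ _ _ _).inv ≫ ((β_ _ _).hom ⊗ₘ 𝟙 _) ≫ (α_ _ _ _).hom) ≫
        X ◁ (α_ A B D').hom := by
  simp

theorem extract_leftUnitor {A A' X : C} (e : A ⟶ X ⊗ A') :
    (λ_ A).hom ≫ e =
      ((𝟙 (𝟙_ C) ⊗ₘ e) ≫ (α_ _ _ _).inv ≫ ((β_ _ _).hom ⊗ₘ 𝟙 _) ≫ (α_ _ _ _).hom) ≫
        X ◁ (λ_ A').hom := by
  simp

theorem extract_braid_inl {A A' B X : C} (e : A ⟶ X ⊗ A') :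
    (β_ A B).hom ≫ (𝟙 B ⊗ₘ e) ≫ (α_ _ _ _).inv ≫ ((β_ _ _).hom ⊗ₘ 𝟙 _) ≫ (α_ _ _ _).hom =
      ((e ⊗ₘ 𝟙 B) ≫ (α_ _ _ _).hom) ≫ X ◁ (β_ A' B).hom := by
  rw [id_tensorHom, ← BraidedCategory.braiding_naturality_left_assoc]
  simp [← comp_whiskerRight_assoc, -comp_whiskerRight]

theorem extract_braid_inr {A B B' X : C} (e : B ⟶ X ⊗ B') :
    (β_ A B).hom ≫ (e ⊗ₘ 𝟙 A) ≫ (α_ _ _ _).hom =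
      ((𝟙 A ⊗ₘ e) ≫ (α_ _ _ _).inv ≫ ((β_ _ _).hom ⊗ₘ 𝟙 _) ≫ (α_ _ _ _).hom) ≫
        X ◁ (β_ A B').hom := by
  rw [tensorHom_id, ← BraidedCategory.braiding_naturality_right_assoc]
  simp

variable {O : Type w} (o : O → C)

theorem eval_toUnit {A B : ObjTerm O} (t : StructTerm A B) (hA : IsEmpty A.Pos)
    (hB : IsEmpty B.Pos) :
    (t.eval o).hom ≫ ((toUnit B hB).eval o).hom = ((toUnit A hA).eval o).hom := by
  induction t with
  | id A => exact Category.id_comp _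
  | comp f g hf hg =>
    have := f.perm.toEquiv.symm.isEmpty
    exact (Category.assoc _ _ _).trans ((congrArg _ (hg this hB)).trans (hf hA this))
  | inv f hf => exact (Iso.inv_comp_eq _).2 (hf hB hA).symm
  | tensor f g hf hg =>
    refine (tensorHom_comp_tensorHom_assoc _ _ _ _ _).trans ?_
    rw [hf ⟨fun p => hA.false (Sum.inl p)⟩, hg ⟨fun p => hA.false (Sum.inr p)⟩]
    rfl
  | assoc A B D => exact toUnit_assoc _ _ _
  | leftUnitor A => exact toUnit_leftUnitor _
  | braid A B => exact toUnit_braid _ _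

/-- `t'` is what remains of the structural term `t` when the wire that it carries from `p` to `q`
is removed, both as a rewiring and, under the assignment `o`, as a morphism. -/
structure IsResidue {A B : ObjTerm O} (t : StructTerm A B) (p : A.Pos) (q : B.Pos)
    (t' : StructTerm (A.erase p) (B.erase q)) : Prop where
  incl_perm : ∀ x, B.incl q (t'.perm x) = t.perm (A.incl p x)
  eval_extract : ∀ (X : O) (hp : A.label p = X) (hq : B.label q = X),
    (t.eval o).hom ≫ ((extract B q X hq).eval o).hom =
      ((extract A p X hp).eval o).hom ≫ o X ◁ (t'.eval o).hom

namespace IsResidue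

variable {o} {A B D A' B' : ObjTerm O}

theorem id (p : A.Pos) : IsResidue o (.id A) p p (.id _) where
  incl_perm _ := rfl
  eval_extract X hp hq := by
    refine (Category.id_comp _).trans ?_
    erw [whiskerLeft_id, Category.comp_id]

theorem comp {f : StructTerm A B} {g : StructTerm B D} {p : A.Pos} {q : B.Pos} {r : D.Pos}
    {f' : StructTerm (A.erase p) (B.erase q)} {g' : StructTerm (B.erase q) (D.erase r)}
    (hf : IsResidue o f p q f') (hg : IsResidue o g q r g') (hq : f.perm p = q) :
    IsResidue o (f.comp g) p r (f'.comp g') where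
  incl_perm x := (hg.incl_perm _).trans (congrArg g.perm (hf.incl_perm x))
  eval_extract X hp hr :=
    have hm : B.label q = X := hq ▸ (f.perm.label_eq p).trans hp
    extract_comp (hf.eval_extract X hp hm) (hg.eval_extract X hm hr)

theorem inv {f : StructTerm A B} {p : A.Pos} {q : B.Pos}
    {f' : StructTerm (A.erase p) (B.erase q)} (hf : IsResidue o f p q f') :
    IsResidue o f.inv q p f'.inv where
  incl_perm x := f.perm.injective <| (hf.incl_perm _).symm.trans <|
    (congrArg _ (f'.perm.apply_symm_apply x)).trans (f.perm.apply_symm_apply _).symm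
  eval_extract X hq hp := extract_inv (hf.eval_extract X hp hq)

theorem tensor_inl {f : StructTerm A B} {p : A.Pos} {q : B.Pos}
    {f' : StructTerm (A.erase p) (B.erase q)} (hf : IsResidue o f p q f')
    (g : StructTerm A' B') :
    IsResidue o (.tensor f g) (Sum.inl p) (Sum.inl q) (.tensor f' g) where
  incl_perm := Sum.rec (fun x => congrArg Sum.inl (hf.incl_perm x)) fun _ => rfl
  eval_extract X hp hq := extract_tensor_inl _ _ _ _ _ (hf.eval_extract X hp hq)

theorem tensor_inr (f : StructTerm A B) {g : StructTerm A' B'} {p : A'.Pos} {q : B'.Pos}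
    {g' : StructTerm (A'.erase p) (B'.erase q)} (hg : IsResidue o g p q g') :
    IsResidue o (.tensor f g) (Sum.inr p) (Sum.inr q) (.tensor f g') where
  incl_perm := Sum.rec (fun _ => rfl) fun x => congrArg Sum.inr (hg.incl_perm x)
  eval_extract X hp hq := extract_tensor_inr _ _ _ _ _ (hg.eval_extract X hp hq)

end IsResidue

theorem exists_isResidue {A B : ObjTerm O} (t : StructTerm A B) :
    ∀ (p : A.Pos) (q : B.Pos), t.perm p = q → ∃ t', IsResidue o t p q t' := by
  induction t with
  | id A =>
    rintro p _ rfl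
    exact ⟨_, .id p⟩
  | comp f g hf hg =>
    rintro p _ rfl
    obtain ⟨f', hf'⟩ := hf p _ rfl
    obtain ⟨g', hg'⟩ := hg _ _ rfl
    exact ⟨_, hf'.comp hg' rfl⟩
  | inv f hf =>
    rintro p q hq
    obtain ⟨f', hf'⟩ := hf q p (by rw [← hq]; exact f.perm.apply_symm_apply p)
    exact ⟨_, hf'.inv⟩
  | tensor f g hf hg =>
    rintro (p | p) _ rfl
    · obtain ⟨f', hf'⟩ := hf p _ rfl
      exact ⟨_, hf'.tensor_inl g⟩
    · obtain ⟨g', hg'⟩ := hg p _ rfl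
      exact ⟨_, .tensor_inr f hg'⟩
  | assoc A B D =>
    rintro ((p | p) | p) _ rfl
    · exact ⟨.assoc _ _ _, by rintro ((_ | _) | _) <;> rfl, fun _ _ _ => extract_assoc_left _⟩
    · exact ⟨.assoc _ _ _, by rintro ((_ | _) | _) <;> rfl, fun _ _ _ => extract_assoc_middle _⟩
    · exact ⟨.assoc _ _ _, by rintro ((_ | _) | _) <;> rfl, fun _ _ _ => extract_assoc_right _⟩
  | leftUnitor A =>
    rintro (p | p) _ rfl
    · exact p.elim
    · exact ⟨.leftUnitor _, by rintro (x | x); exacts [x.elim, rfl],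
        fun _ _ _ => extract_leftUnitor _⟩
  | braid A B =>
    rintro (p | p) _ rfl
    · exact ⟨.braid _ _, by rintro (_ | _) <;> rfl, fun _ _ _ => extract_braid_inl _⟩
    · exact ⟨.braid _ _, by rintro (_ | _) <;> rfl, fun _ _ _ => extract_braid_inr _⟩

theorem eval_eq_of_perm_eq {A B : ObjTerm O} (s t : StructTerm A B)
    (h : ∀ p, s.perm p = t.perm p) : s.eval o = t.eval o := by
  induction hn : Nat.card A.Pos using Nat.strong_induction_on generalizing A B with
  | _ n ih =>
    apply Iso.ext
    rcases isEmpty_or_nonempty A.Pos with hA | ⟨⟨p⟩⟩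
    · have hB := s.perm.toEquiv.symm.isEmpty
      rw [← cancel_mono ((toUnit B hB).eval o).hom, eval_toUnit o s hA, eval_toUnit o t hA]
    · obtain ⟨s', hs⟩ := exists_isResidue o s p _ rfl
      obtain ⟨t', ht⟩ := exists_isResidue o t p _ (h p).symm
      have hst := ih _ (hn ▸ A.card_erase p) s' t' (fun x => B.incl_injective _
        ((hs.incl_perm x).trans ((h _).trans (ht.incl_perm x).symm))) rfl
      rw [← cancel_mono ((extract B (s.perm p) _ (s.perm.label_eq p)).eval o).hom,
        hs.eval_extract _ rfl, ht.eval_extract _ rfl, hst]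

end Coherence

theorem exists_erase {O : Type w} {A B : ObjTerm O} (e : Rewiring A B) (p : A.Pos) :
    ∃ f : Rewiring (A.erase p) (B.erase (e p)),
      ∀ x, B.incl _ (f x) = e (A.incl p x) := by
  have h : ∀ x, ∃ y, B.incl (e p) y = e (A.incl p x) := fun x =>
    B.exists_incl _ _ fun h => A.incl_ne p x (e.injective h)
  choose f hf using h
  refine ⟨⟨Equiv.ofBijective f ⟨fun x y hxy => ?_, fun y => ?_⟩, fun x => ?_⟩, hf⟩
  · exact A.incl_injective p (e.injective ((hf x).symm.trans ((congrArg _ hxy).trans (hf y))))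
  · obtain ⟨x, hx⟩ := A.exists_incl p (e.symm (B.incl _ y)) fun h =>
      B.incl_ne _ y ((e.symm_apply_eq).1 h)
    refine ⟨x, B.incl_injective _ ?_⟩
    rw [hf, hx, Rewiring.apply_symm_apply]
  · change (B.erase (e p)).label (f x) = _
    rw [← B.label_incl, hf, e.label_eq, A.label_incl]

theorem exists_perm_eq {O : Type w} {A B : ObjTerm O} (e : Rewiring A B) :
    ∃ t : StructTerm A B, t.perm = e := by
  induction hn : Nat.card A.Pos using Nat.strong_induction_on generalizing A B with
  | _ n ih =>
    rcases isEmpty_or_nonempty A.Pos with hA | ⟨⟨p⟩⟩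
    · have hB := e.toEquiv.symm.isEmpty
      exact ⟨(toUnit A hA).comp (toUnit B hB).inv, Rewiring.ext fun p => hA.elim p⟩
    · obtain ⟨f, hf⟩ := exists_erase e p
      obtain ⟨t, ht⟩ := ih _ (hn ▸ A.card_erase p) f rfl
      refine ⟨(extract A p _ rfl).comp ((StructTerm.tensor (.id _) t).comp
        (extract B (e p) _ (e.label_eq p)).inv), Rewiring.ext fun q => ?_⟩
      refine (extract B (e p) _ (e.label_eq p)).perm.toEquiv.symm_apply_eq.2 ?_
      change (Rewiring.refl _).sum t.perm ((extract A p _ rfl).perm q) = _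
      by_cases hq : q = p
      · rw [hq, perm_extract_self, perm_extract_self]
        rfl
      · obtain ⟨x, rfl⟩ := A.exists_incl p q hq
        rw [perm_extract_incl, ← hf, perm_extract_incl, ht]
        rfl

end StructTerm

/-! ### The value of a rewiring -/

namespace Rewiring

variable {O : Type w} {C : Type u} [Category.{v} C] [MonoidalCategory C] [SymmetricCategory C]
  (o : O → C)

/-- The canonical morphism that realizes a rewiring in a symmetric monoidal category. -/
noncomputable def hom {A B : ObjTerm O} (e : Rewiring A B) : A.eval o ⟶ B.eval o :=
  ((StructTerm.exists_perm_eq e).choose.eval o).hom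

theorem hom_perm {A B : ObjTerm O} (t : StructTerm A B) :
    t.perm.hom o = (t.eval o).hom :=
  congrArg Iso.hom (StructTerm.eval_eq_of_perm_eq o _ _ fun p =>
    congrArg (fun e : Rewiring A B => e p) (StructTerm.exists_perm_eq t.perm).choose_spec)

theorem hom_refl (A : ObjTerm O) : hom o (.refl A) = 𝟙 (A.eval o) :=
  hom_perm o (.id A)

theorem hom_trans {A B D : ObjTerm O} (e : Rewiring A B) (f : Rewiring B D) :
    (e.trans f).hom o = e.hom o ≫ f.hom o := by
  obtain ⟨s, rfl⟩ := StructTerm.exists_perm_eq e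
  obtain ⟨t, rfl⟩ := StructTerm.exists_perm_eq f
  rw [hom_perm, hom_perm]
  exact hom_perm o (s.comp t)

theorem hom_comp_symm {A B : ObjTerm O} (e : Rewiring A B) :
    e.hom o ≫ e.symm.hom o = 𝟙 _ := by
  rw [← hom_trans, trans_symm_self, hom_refl]

theorem hom_symm_comp {A B : ObjTerm O} (e : Rewiring A B) :
    e.symm.hom o ≫ e.hom o = 𝟙 _ := by
  rw [← hom_trans, symm_trans_self, hom_refl]

theorem hom_sum {A B A' B' : ObjTerm O} (e : Rewiring A B) (f : Rewiring A' B') :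
    (e.sum f).hom o = (e.hom o ⊗ₘ f.hom o : A.eval o ⊗ A'.eval o ⟶ _) := by
  obtain ⟨s, rfl⟩ := StructTerm.exists_perm_eq e
  obtain ⟨t, rfl⟩ := StructTerm.exists_perm_eq f
  rw [hom_perm, hom_perm]
  exact hom_perm o (s.tensor t)

theorem hom_assoc (A B D : ObjTerm O) :
    hom o (.assoc A B D) = (α_ (A.eval o) (B.eval o) (D.eval o)).hom :=
  hom_perm o (.assoc A B D)

theorem hom_assoc_symm (A B D : ObjTerm O) :
    hom o (assoc A B D).symm = (α_ (A.eval o) (B.eval o) (D.eval o)).inv :=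
  hom_perm o (.inv (.assoc A B D))

theorem hom_leftUnitor (A : ObjTerm O) :
    hom o (.leftUnitor A) = (λ_ (A.eval o)).hom :=
  hom_perm o (.leftUnitor A)

theorem hom_leftUnitor_symm (A : ObjTerm O) :
    hom o (leftUnitor A).symm = (λ_ (A.eval o)).inv :=
  hom_perm o (.inv (.leftUnitor A))

theorem rightUnitor_eq (A : ObjTerm O) :
    rightUnitor A = (StructTerm.comp (.braid A .unit) (.leftUnitor A)).perm :=
  ext (by rintro (p | p); exacts [rfl, p.elim])

theorem hom_rightUnitor (A : ObjTerm O) :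
    hom o (.rightUnitor A) = (ρ_ (A.eval o)).hom := by
  rw [rightUnitor_eq, hom_perm]
  exact braiding_leftUnitor _

theorem hom_rightUnitor_symm (A : ObjTerm O) :
    hom o (rightUnitor A).symm = (ρ_ (A.eval o)).inv := by
  rw [rightUnitor_eq]
  refine (hom_perm o (.inv (.comp (.braid A .unit) (.leftUnitor A)))).trans ?_
  exact (Iso.inv_eq_inv (β_ _ _ ≪≫ λ_ _) (ρ_ _)).2 (braiding_leftUnitor _)

theorem hom_braid (A B : ObjTerm O) :
    hom o (.braid A B) = (β_ (A.eval o) (B.eval o)).hom :=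
  hom_perm o (.braid A B)

end Rewiring

/-! ### Morphisms between values of object terms -/

section Tens

variable {O : Type w} {C : Type u} [Category.{v} C] [MonoidalCategory C] {o : O → C}
variable {A B D A' B' D' : ObjTerm O}

/-- The tensor product of morphisms between values of object terms, typed by object terms. -/
def tens (f : A.eval o ⟶ B.eval o) (g : A'.eval o ⟶ B'.eval o) :
    (A.tensor A').eval o ⟶ (B.tensor B').eval o :=
  MonoidalCategoryStruct.tensorHom f g

theorem tens_id : tens (𝟙 (A.eval o)) (𝟙 (B.eval o)) = 𝟙 ((A.tensor B).eval o) :=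
  id_tensorHom_id _ _

theorem tens_comp (f : A.eval o ⟶ B.eval o) (g : B.eval o ⟶ D.eval o)
    (f' : A'.eval o ⟶ B'.eval o) (g' : B'.eval o ⟶ D'.eval o) :
    tens f f' ≫ tens g g' = tens (f ≫ g) (f' ≫ g') :=
  tensorHom_comp_tensorHom _ _ _ _

theorem tens_comp_assoc (f : A.eval o ⟶ B.eval o) (g : B.eval o ⟶ D.eval o)
    (f' : A'.eval o ⟶ B'.eval o) (g' : B'.eval o ⟶ D'.eval o)
    {Z : C} (k : (D.tensor D').eval o ⟶ Z) :
    tens f f' ≫ tens g g' ≫ k = tens (f ≫ g) (f' ≫ g') ≫ k := by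
  rw [← Category.assoc, tens_comp]

theorem comp_tens_id (f : A.eval o ⟶ B.eval o) (g : B.eval o ⟶ D.eval o) :
    tens (f ≫ g) (𝟙 (D'.eval o)) = tens f (𝟙 (D'.eval o)) ≫ tens g (𝟙 (D'.eval o)) := by
  rw [tens_comp, Category.comp_id]

end Tens

namespace Rewiring

/-- The exchange of the two middle factors of a tensor product of four. -/
def interchange {O : Type w} (A B D E : ObjTerm O) :
    Rewiring ((A.tensor B).tensor (D.tensor E)) ((A.tensor D).tensor (B.tensor E)) :=
  ⟨Equiv.sumSumSumComm _ _ _ _, by rintro ((_ | _) | (_ | _)) <;> rfl⟩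

/-- The exchange of the last two factors of a tensor product of three. -/
def swapRight {O : Type w} (A B D : ObjTerm O) :
    Rewiring ((A.tensor B).tensor D) ((A.tensor D).tensor B) :=
  (assoc A B D).trans (((refl A).sum (braid B D)).trans (assoc A D B).symm)

variable {O : Type w} {C : Type u} [Category.{v} C] [MonoidalCategory C] [SymmetricCategory C]
  {o : O → C}
variable {A B D A' B' D' E E' : ObjTerm O}

theorem tens_hom (e : Rewiring A B) (e' : Rewiring A' B') :
    tens (e.hom o) (e'.hom o) = (e.sum e').hom o :=
  (hom_sum o e e').symm

theorem tens_id_hom (e : Rewiring A B) :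
    tens (𝟙 (D.eval o)) (e.hom o) = ((refl D).sum e).hom o := by
  rw [← tens_hom, hom_refl]

theorem tens_hom_id (e : Rewiring A B) :
    tens (e.hom o) (𝟙 (D.eval o)) = (e.sum (refl D)).hom o := by
  rw [← tens_hom, hom_refl]

theorem hom_trans_assoc (e : Rewiring A B) (f : Rewiring B D) {Z : C} (k : D.eval o ⟶ Z) :
    e.hom o ≫ f.hom o ≫ k = (e.trans f).hom o ≫ k := by
  rw [hom_trans, Category.assoc]

theorem tens_comp_assoc_hom (f : A.eval o ⟶ B.eval o) (g : A'.eval o ⟶ B'.eval o)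
    (h : D.eval o ⟶ D'.eval o) :
    tens (tens f g) h ≫ (assoc _ _ _).hom o = (assoc _ _ _).hom o ≫ tens f (tens g h) := by
  rw [hom_assoc, hom_assoc]
  exact associator_naturality f g h

theorem tens_comp_assoc_symm_hom (f : A.eval o ⟶ B.eval o) (g : A'.eval o ⟶ B'.eval o)
    (h : D.eval o ⟶ D'.eval o) :
    tens f (tens g h) ≫ (assoc _ _ _).symm.hom o =
      (assoc _ _ _).symm.hom o ≫ tens (tens f g) h := by
  rw [hom_assoc_symm, hom_assoc_symm]
  exact associator_inv_naturality f g h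

theorem tens_comp_braid_hom (f : A.eval o ⟶ B.eval o) (g : A'.eval o ⟶ B'.eval o) :
    tens f g ≫ (braid _ _).hom o = (braid _ _).hom o ≫ tens g f := by
  rw [hom_braid, hom_braid]
  exact BraidedCategory.braiding_naturality f g

theorem conj_congr {a a' : Rewiring A B} {b b' : Rewiring D E} (ha : ∀ p, a p = a' p)
    (hb : ∀ p, b p = b' p) (f : B.eval o ⟶ D.eval o) :
    a.hom o ≫ f ≫ b.hom o = a'.hom o ≫ f ≫ b'.hom o := by
  rw [ext ha, ext hb]

theorem tens_id_unit (f : A.eval o ⟶ B.eval o) :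
    tens f (𝟙 (ObjTerm.unit.eval o)) =
      (rightUnitor A).hom o ≫ f ≫ (rightUnitor B).symm.hom o := by
  rw [hom_rightUnitor, hom_rightUnitor_symm]
  exact (tensorHom_id f _).trans (MonoidalCategory.whiskerRight_id f)

theorem hom_comp_congr {a a' : Rewiring A B} (ha : ∀ p, a p = a' p) {Z : C} {f f' : B.eval o ⟶ Z}
    (hf : f = f') : a.hom o ≫ f = a'.hom o ≫ f' := by
  rw [ext ha, hf]

theorem hom_eq_id {a : Rewiring A A} (ha : ∀ p, a p = p) : a.hom o = 𝟙 (A.eval o) :=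
  (congrArg (hom o) (ext ha)).trans (hom_refl o A)

theorem hom_comp_eq {a : Rewiring A A} (ha : ∀ p, a p = p) {Z : C} {f f' : A.eval o ⟶ Z}
    (hf : f = f') : a.hom o ≫ f = f' := by
  rw [hom_eq_id ha, Category.id_comp, hf]

theorem tens_swap (f : A.eval o ⟶ B.eval o) (g : A'.eval o ⟶ B'.eval o) :
    tens f g = (braid _ _).hom o ≫ tens g f ≫ (braid _ _).hom o := by
  have braid_braid : (braid A A').trans (braid A' A) = refl _ :=
    ext (by rintro (_ | _) <;> rfl)
  rw [tens_comp_braid_hom, hom_trans_assoc, braid_braid, hom_refl, Category.id_comp]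

theorem tens_comp_swapRight_hom (f : A.eval o ⟶ A'.eval o) (g : B.eval o ⟶ B'.eval o)
    (h : D.eval o ⟶ D'.eval o) :
    tens (tens f g) h ≫ (swapRight _ _ _).hom o =
      (swapRight _ _ _).hom o ≫ tens (tens f h) g := by
  simp only [swapRight, hom_trans, Category.assoc, ← tens_id_hom]
  rw [← Category.assoc, tens_comp_assoc_hom, Category.assoc, tens_comp_assoc, tens_comp_braid_hom,
    ← tens_comp_assoc_symm_hom, tens_comp_assoc, Category.comp_id, Category.id_comp]

theorem tens_comp_interchange_hom (f : A.eval o ⟶ A'.eval o) (g : B.eval o ⟶ B'.eval o)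
    (h : D.eval o ⟶ D'.eval o) (k : E.eval o ⟶ E'.eval o) :
    tens (tens f g) (tens h k) ≫ (interchange _ _ _ _).hom o =
      (interchange _ _ _ _).hom o ≫ tens (tens f h) (tens g k) := by
  have interchange_eq : ∀ A B D E : ObjTerm O, interchange A B D E =
      (assoc (A.tensor B) D E).symm.trans
        (((swapRight A B D).sum (refl E)).trans (assoc (A.tensor D) B E)) := fun _ _ _ _ =>
    ext (by rintro ((_ | _) | (_ | _)) <;> rfl)
  simp only [interchange_eq, hom_trans, Category.assoc, ← tens_hom_id]
  rw [← Category.assoc, tens_comp_assoc_symm_hom, Category.assoc, tens_comp_assoc,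
    tens_comp_swapRight_hom, ← tens_comp_assoc_hom, tens_comp_assoc, Category.comp_id,
    Category.id_comp]

end Rewiring

/-! ### Total traces -/

section TotalTrace

variable {O : Type w} {C : Type u} [Category.{v} C] [MonoidalCategory C] [SymmetricCategory C]
  [TracedCategory C] {o : O → C}
variable {A B D A' B' U V : ObjTerm O}

/-- The total trace of a morphism between values of object terms. -/
def totalTr (U : ObjTerm O) (f : (A.tensor U).eval o ⟶ (B.tensor U).eval o) :
    A.eval o ⟶ B.eval o :=
  TracedCategory.tr (U := U.eval o) f

theorem totalTr_naturality (f : (A.tensor U).eval o ⟶ (B.tensor U).eval o)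
    (g : A'.eval o ⟶ A.eval o) (h : B.eval o ⟶ B'.eval o) :
    g ≫ totalTr U f ≫ h = totalTr U (tens g (𝟙 (U.eval o)) ≫ f ≫ tens h (𝟙 (U.eval o))) := by
  have := TracedCategory.naturality (U := U.eval o) f g h
  rw [← tensorHom_id, ← tensorHom_id] at this
  exact this

theorem totalTr_dinaturality (f : (A.tensor U).eval o ⟶ (B.tensor V).eval o)
    (g : V.eval o ⟶ U.eval o) :
    totalTr U (f ≫ tens (𝟙 (B.eval o)) g) = totalTr V (tens (𝟙 (A.eval o)) g ≫ f) := by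
  have := TracedCategory.dinaturality (U := U.eval o) (U' := V.eval o) f g
  rw [← id_tensorHom, ← id_tensorHom] at this
  exact this

theorem tens_totalTr (g : A'.eval o ⟶ B'.eval o) (f : (A.tensor U).eval o ⟶ (B.tensor U).eval o) :
    tens g (totalTr U f) = totalTr U ((Rewiring.assoc _ _ _).hom o ≫ tens g f ≫
      (Rewiring.assoc _ _ _).symm.hom o) := by
  rw [Rewiring.hom_assoc, Rewiring.hom_assoc_symm]
  exact TracedCategory.strength (U := U.eval o) f g

theorem totalTr_unit (f : (A.tensor .unit).eval o ⟶ (B.tensor .unit).eval o) :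
    totalTr .unit f =
      (Rewiring.rightUnitor _).symm.hom o ≫ f ≫ (Rewiring.rightUnitor _).hom o := by
  rw [Rewiring.hom_rightUnitor, Rewiring.hom_rightUnitor_symm]
  exact (TracedCategory.vanishing_I (A := A.eval o) (B := B.eval o) f).symm

theorem totalTr_totalTr (f : ((A.tensor U).tensor V).eval o ⟶ ((B.tensor U).tensor V).eval o) :
    totalTr U (totalTr V f) = totalTr (U.tensor V)
      ((Rewiring.assoc _ _ _).symm.hom o ≫ f ≫ (Rewiring.assoc _ _ _).hom o) := by
  rw [Rewiring.hom_assoc, Rewiring.hom_assoc_symm]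
  exact TracedCategory.vanishing_II (A := A.eval o) (B := B.eval o) (U := U.eval o)
    (V := V.eval o) f

theorem totalTr_braid (A : ObjTerm O) : totalTr A ((Rewiring.braid A A).hom o) = 𝟙 (A.eval o) := by
  rw [Rewiring.hom_braid]
  exact TracedCategory.yanking (A.eval o)

theorem hom_comp_totalTr_comp_hom (f : (A.tensor U).eval o ⟶ (B.tensor U).eval o)
    (a : Rewiring A' A) (b : Rewiring B B') :
    a.hom o ≫ totalTr U f ≫ b.hom o =
      totalTr U ((a.sum (.refl U)).hom o ≫ f ≫ (b.sum (.refl U)).hom o) := by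
  rw [totalTr_naturality, Rewiring.tens_hom_id, Rewiring.tens_hom_id]

theorem totalTr_rewire (f : (A.tensor U).eval o ⟶ (B.tensor U).eval o) (a : Rewiring U V) :
    totalTr U f = totalTr V (((Rewiring.refl A).sum a.symm).hom o ≫ f ≫
      ((Rewiring.refl B).sum a).hom o) := by
  rw [← Category.assoc, ← Rewiring.tens_id_hom, ← Rewiring.tens_id_hom, totalTr_dinaturality,
    tens_comp_assoc, Rewiring.hom_comp_symm, Category.comp_id, tens_id, Category.id_comp]

theorem totalTr_tens (f : (A.tensor U).eval o ⟶ (B.tensor U).eval o) (g : A'.eval o ⟶ B'.eval o) :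
    tens (totalTr U f) g = totalTr U ((Rewiring.swapRight _ _ _).hom o ≫ tens f g ≫
      (Rewiring.swapRight _ _ _).hom o) := by
  rw [Rewiring.tens_swap, tens_totalTr, hom_comp_totalTr_comp_hom, Rewiring.tens_swap g f]
  simp only [Category.assoc, Rewiring.hom_trans_assoc, ← Rewiring.hom_trans]
  refine congrArg _ (Rewiring.conj_congr ?_ ?_ _) <;> rintro ((_ | _) | _) <;> rfl

theorem totalTr_tens_totalTr (f : (A.tensor U).eval o ⟶ (B.tensor U).eval o)
    (g : (A'.tensor V).eval o ⟶ (B'.tensor V).eval o) :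
    tens (totalTr U f) (totalTr V g) = totalTr (U.tensor V)
      ((Rewiring.interchange _ _ _ _).hom o ≫ tens f g ≫
        (Rewiring.interchange _ _ _ _).hom o) := by
  rw [totalTr_tens, tens_totalTr, hom_comp_totalTr_comp_hom, totalTr_totalTr]
  simp only [Category.assoc, Rewiring.hom_trans_assoc, ← Rewiring.hom_trans]
  refine congrArg _ (Rewiring.conj_congr ?_ ?_ _) <;> rintro ((_ | _) | (_ | _)) <;> rfl

theorem comp_eq_totalTr (f : A.eval o ⟶ B.eval o) (g : B.eval o ⟶ D.eval o) :
    f ≫ g = totalTr B (tens f g ≫ (Rewiring.braid _ _).hom o) := by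
  have h := totalTr_naturality ((Rewiring.braid B B).hom o) f g
  rwa [totalTr_braid, Category.id_comp, ← Rewiring.tens_comp_braid_hom, tens_comp_assoc,
    Category.comp_id, Category.id_comp] at h

end TotalTrace

/-! ### Wirings with hidden wires -/

namespace Rewiring

variable {O : Type w} {A B K : ObjTerm O}

theorem exists_split (A : ObjTerm O) (p : A.Pos) {X : O} (hX : A.label p = X) :
    ∃ (R : ObjTerm O) (s : Rewiring A (R.tensor (.var X))), s p = Sum.inr () := by
  refine ⟨A.erase p, (StructTerm.extract A p X hX).perm.trans (braid _ _), ?_⟩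
  rw [trans_apply, StructTerm.perm_extract_self]
  rfl

theorem exists_eq_sum_refl (e : Rewiring (A.tensor K) (B.tensor K))
    (he : ∀ k, e (Sum.inr k) = Sum.inr k) : ∃ f : Rewiring A B, e = f.sum (refl K) := by
  have hinl (p) : ∃ q, e (Sum.inl p) = Sum.inl q := by
    rcases h : e (Sum.inl p) with q | k
    · exact ⟨q, rfl⟩
    · cases e.injective (h.trans (he k).symm)
  have hinl_symm (q) : ∃ p, e (Sum.inl p) = Sum.inl q := by
    rcases h : e.symm (Sum.inl q) with p | k
    · exact ⟨p, ((e.symm_apply_eq).1 h).symm⟩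
    · cases ((e.symm_apply_eq).1 h).trans (he k)
  choose f hf using hinl
  refine ⟨⟨Equiv.ofBijective f ⟨fun p q h => ?_, fun q => ?_⟩, fun p => ?_⟩, ext ?_⟩
  · exact Sum.inl_injective (e.injective ((hf p).trans ((congrArg _ h).trans (hf q).symm)))
  · obtain ⟨p, hp⟩ := hinl_symm q
    exact ⟨p, Sum.inl_injective ((hf p).symm.trans hp)⟩
  · exact (congrArg (ObjTerm.label (B.tensor K)) (hf p)).symm.trans (e.label_eq (Sum.inl p))
  · rintro (p | k)
    exacts [hf p, he k]

end Rewiring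

section Wires

variable {O : Type w} {C : Type u} [Category.{v} C] [MonoidalCategory C] [SymmetricCategory C]
  [TracedCategory C] (o : O → C) {L P Q P' Q' L' U : ObjTerm O}

/-- The value of a diagram without boxes, given by the rewiring `e` between the sources and the
targets of its wires, where the wires in `L` are hidden. -/
noncomputable def Rewiring.wires (e : Rewiring (P.tensor L) (Q.tensor L)) :
    P.eval o ⟶ Q.eval o :=
  totalTr L (e.hom o)

namespace Rewiring

theorem wires_conj (e : Rewiring (P.tensor L) (Q.tensor L)) (a : Rewiring P' P)
    (b : Rewiring Q Q') : a.hom o ≫ e.wires o ≫ b.hom o =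
      wires o ((a.sum (refl L)).trans (e.trans (b.sum (refl L)))) := by
  rw [wires, wires, hom_comp_totalTr_comp_hom, hom_trans, hom_trans]

theorem tens_wires (e : Rewiring (P.tensor L) (Q.tensor L))
    (e' : Rewiring (P'.tensor L') (Q'.tensor L')) : tens (e.wires o) (e'.wires o) =
      wires o ((interchange P P' L L').trans ((e.sum e').trans (interchange Q L Q' L'))) := by
  rw [wires, wires, wires, totalTr_tens_totalTr, tens_hom, hom_trans, hom_trans]

theorem totalTr_wires (e : Rewiring ((P.tensor U).tensor L) ((Q.tensor U).tensor L)) :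
    totalTr U (e.wires o) =
      wires o ((assoc P U L).symm.trans (e.trans (assoc Q U L))) := by
  rw [wires, wires, totalTr_totalTr, hom_trans, hom_trans]

theorem wires_rewire (e : Rewiring (P.tensor L) (Q.tensor L)) (a : Rewiring L L') :
    e.wires o = wires o (((refl P).sum a.symm).trans (e.trans ((refl Q).sum a))) := by
  rw [wires, wires, totalTr_rewire _ a, hom_trans, hom_trans]

theorem wires_unit (e : Rewiring P Q) : wires o (e.sum (refl .unit)) = e.hom o := by
  rw [wires, totalTr_unit, ← hom_trans, ← hom_trans]
  exact congrArg (hom o) (ext fun _ => rfl)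

theorem totalTr_swapRight (A U : ObjTerm O) : totalTr U ((swapRight A U U).hom o) = 𝟙 _ := by
  rw [swapRight, hom_trans, hom_trans, ← tens_id_hom, ← tens_totalTr, totalTr_braid, tens_id]

/-- A hidden wire that is not a loop can be pulled straight. -/
theorem exists_hom_eq_wires {X : O} (e : Rewiring (P.tensor (.var X)) (Q.tensor (.var X)))
    {q : Q.Pos} (hq : e (Sum.inr ()) = Sum.inl q) :
    ∃ f : Rewiring P Q, f.hom o = e.wires o ∧
      ∀ p, f p = Sum.elim id (fun _ => q) (e (Sum.inl p)) := by
  obtain ⟨p, hp⟩ : ∃ p, e (Sum.inl p) = Sum.inr () := by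
    rcases h : e.symm (Sum.inr ()) with p | ⟨⟩
    · exact ⟨p, ((e.symm_apply_eq).1 h).symm⟩
    · cases ((e.symm_apply_eq).1 h).trans hq
  have hX : P.label p = X := (e.label_eq (Sum.inl p)).symm.trans
    (congrArg (ObjTerm.label (Q.tensor (.var X))) hp)
  obtain ⟨R, s, hs⟩ := exists_split P p hX
  have hs' : s.symm (Sum.inr ()) = p := s.symm_apply_eq.2 hs.symm
  obtain ⟨t, ht⟩ := exists_eq_sum_refl
    ((swapRight R (.var X) (.var X)).trans ((s.symm.sum (refl _)).trans e))
    fun _ => (congrArg (fun r => e (Sum.inl r)) hs').trans hp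
  have he : e = (s.sum (refl _)).trans ((swapRight R (.var X) (.var X)).trans
      (t.sum (refl _))) := by
    rw [← ht]
    refine ext ?_
    rintro (r | _)
    · obtain ⟨y, rfl⟩ := s.symm.toEquiv.surjective r
      change _ = e (Sum.map s.symm id (swapRight _ _ _ (swapRight _ _ _
        (Sum.inl (s (s.symm y))))))
      rw [apply_symm_apply]
      rcases y with _ | _ <;> rfl
    · rfl
  have ht_inr : t (Sum.inr ()) = q := by
    rw [he] at hq
    exact Sum.inl_injective hq
  refine ⟨s.trans t, ?_, fun r => ?_⟩
  · rw [wires, he, hom_trans, hom_trans, hom_trans, ← hom_comp_totalTr_comp_hom, totalTr_swapRight,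
      Category.id_comp]
  · rw [he]
    change t (s r) = Sum.elim id (fun _ => q) (Sum.map t id (swapRight _ _ _ (Sum.inl (s r))))
    rcases s r with _ | ⟨⟩
    exacts [rfl, ht_inr]

end Rewiring
end Wires

/-! ### Wires drawn by a rewiring -/

section Draws

variable {O : Type w} {P Q P' Q' L L' U : ObjTerm O} {W W' : Type} {lab : W → O}
  {lab' : W' → O}

/-- The map on the positions of a tensor product given by maps on those of its factors. -/
def copair (i : P.Pos → W) (w : L.Pos → W) : (P.tensor L).Pos → W :=
  Sum.elim i w

theorem copair_assoc {R S : ObjTerm O} (i : P.Pos → W) (w : (R.tensor S).Pos → W)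
    (p : ((P.tensor R).tensor S).Pos) : copair i w (Rewiring.assoc P R S p) =
      copair (copair i fun r => w (Sum.inl r)) (fun s => w (Sum.inr s)) p := by
  rcases p with (_ | _) | _ <;> rfl

/-- The wires `W`, with labels `lab` and with ends `i` and `j` on the boundary, are those of the
diagram given by the rewiring `e`, where `w` sends a position of `L` to the wire through it: as a
set, `W` is the coequalizer of the two ways to send a hidden position to a source. -/
structure Draws (lab : W → O) (e : Rewiring (P.tensor L) (Q.tensor L)) (i : P.Pos → W)
    (j : Q.Pos → W) (w : L.Pos → W) : Prop where
  apply : ∀ p, copair j w (e p) = copair i w p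
  label : ∀ l, lab (w l) = L.label l
  surjective : Function.Surjective (copair i w)
  factors : ∀ {T : Type} (k : (P.tensor L).Pos → T),
    (∀ l, k (e.symm (Sum.inr l)) = k (Sum.inr l)) → ∃ r : W → T, ∀ p, r (copair i w p) = k p

namespace Draws

variable {e : Rewiring (P.tensor L) (Q.tensor L)} {i : P.Pos → W} {j : Q.Pos → W} {w : L.Pos → W}
  {e' : Rewiring (P'.tensor L') (Q'.tensor L')} {i' : P'.Pos → W'} {j' : Q'.Pos → W'}
  {w' : L'.Pos → W'}

theorem apply_symm (h : Draws lab e i j w) (q : (Q.tensor L).Pos) :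
    copair i w (e.symm q) = copair j w q := by
  rw [← h.apply, e.apply_symm_apply]

theorem of_rewiring {a : Rewiring P Q} (hi : Function.Bijective i) (hj : ∀ p, j (a p) = i p) :
    Draws lab (a.sum (.refl .unit)) i j (fun l : Empty => l.elim) where
  apply := by
    rintro (p | ⟨⟨⟩⟩)
    exact hj p
  label l := nomatch l
  surjective c :=
    let ⟨p, hp⟩ := hi.surjective c
    ⟨Sum.inl p, hp⟩
  factors k _ := ⟨fun c => k (Sum.inl ((Equiv.ofBijective i hi).symm c)), by
    rintro (p | ⟨⟨⟩⟩)
    exact congrArg (fun p => k (Sum.inl p)) ((Equiv.ofBijective i hi).symm_apply_apply p)⟩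

theorem map_equiv (h : Draws lab e i j w) (v : W ≃ W') (hv : ∀ c, lab' (v c) = lab c)
    {i' : P.Pos → W'} {j' : Q.Pos → W'} (hi : ∀ p, i' p = v (i p)) (hj : ∀ q, j' q = v (j q)) :
    Draws lab' e i' j' fun l => v (w l) := by
  have hi' (p) : copair i' (fun l => v (w l)) p = v (copair i w p) := by
    rcases p with p | l
    exacts [hi p, rfl]
  have hj' (q) : copair j' (fun l => v (w l)) q = v (copair j w q) := by
    rcases q with q | l
    exacts [hj q, rfl]
  refine ⟨fun p => ?_, fun l => (hv _).trans (h.label l), fun c => ?_, fun k hk => ?_⟩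
  · rw [hj', hi', h.apply]
  · obtain ⟨p, hp⟩ := h.surjective (v.symm c)
    exact ⟨p, by rw [hi', hp, v.apply_symm_apply]⟩
  · obtain ⟨r, hr⟩ := h.factors k hk
    exact ⟨r ∘ v.symm, fun p => by rw [hi', Function.comp_apply, v.symm_apply_apply, hr]⟩

theorem transport (h : Draws lab e i j w) (a : Rewiring P' P) (b : Rewiring Q Q')
    (c : Rewiring L L') {i' : P'.Pos → W} {j' : Q'.Pos → W} {w' : L'.Pos → W}
    (hi : ∀ p, i' p = i (a p)) (hj : ∀ q, j' (b q) = j q) (hw : ∀ l, w' (c l) = w l) :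
    Draws lab ((a.sum c.symm).trans (e.trans (b.sum c))) i' j' w' := by
  have hw_symm (l) : w' l = w (c.symm l) := by rw [← hw, c.apply_symm_apply]
  have hi' (p) : copair i' w' p = copair i w (a.sum c.symm p) := by
    rcases p with p | l
    exacts [hi p, hw_symm l]
  have hj' (q) : copair j' w' (b.sum c q) = copair j w q := by
    rcases q with q | l
    exacts [hj q, hw l]
  refine ⟨fun p => ?_, fun l => ?_, fun d => ?_, fun k hk => ?_⟩
  · rw [Rewiring.trans_apply, Rewiring.trans_apply, hj', h.apply, hi']
  · rw [hw_symm, h.label, c.symm.label_eq]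
  · obtain ⟨p, rfl⟩ := h.surjective d
    exact ⟨(a.sum c.symm).symm p, by rw [hi', Rewiring.apply_symm_apply]⟩
  · obtain ⟨r, hr⟩ := h.factors (fun p => k ((a.sum c.symm).symm p)) fun l => by
      have hl : k ((a.sum c.symm).symm (e.symm (Sum.inr (c.symm (c l))))) = _ := hk (c l)
      rwa [c.symm_apply_apply] at hl
    exact ⟨r, fun p => by rw [hi', hr, Rewiring.symm_apply_apply]⟩

theorem sum (h : Draws lab e i j w) (h' : Draws lab' e' i' j' w') :
    Draws (Sum.elim lab lab')
      ((Rewiring.interchange P P' L L').trans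
        ((e.sum e').trans (Rewiring.interchange Q L Q' L')))
      (Sum.map i i' : (P.tensor P').Pos → _) (Sum.map j j' : (Q.tensor Q').Pos → _)
      (Sum.map w w') := by
  have hi (p) : copair (P := P.tensor P') (L := L.tensor L') (Sum.map i i') (Sum.map w w') p =
      Sum.map (copair i w) (copair i' w') (Rewiring.interchange P P' L L' p) := by
    rcases p with (_ | _) | (_ | _) <;> rfl
  have hj (q) : copair (P := Q.tensor Q') (L := L.tensor L') (Sum.map j j') (Sum.map w w')
      (Rewiring.interchange Q L Q' L' q) = Sum.map (copair j w) (copair j' w') q := by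
    rcases q with (_ | _) | (_ | _) <;> rfl
  refine ⟨fun p => ?_, Sum.rec h.label h'.label, fun c => ?_, fun k hk => ?_⟩
  · rw [Rewiring.trans_apply, Rewiring.trans_apply, hj, hi]
    rcases Rewiring.interchange P P' L L' p with p | p
    exacts [congrArg Sum.inl (h.apply p), congrArg Sum.inr (h'.apply p)]
  · obtain ⟨p, rfl⟩ := h.surjective.sumMap h'.surjective c
    exact ⟨(Rewiring.interchange P P' L L').symm p,
      (hi _).trans (congrArg _ ((Rewiring.interchange P P' L L').apply_symm_apply p))⟩
  · obtain ⟨r, hr⟩ := h.factors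
      (fun p => k ((Rewiring.interchange P P' L L').symm (Sum.inl p))) fun l => hk (Sum.inl l)
    obtain ⟨r', hr'⟩ := h'.factors
      (fun p => k ((Rewiring.interchange P P' L L').symm (Sum.inr p))) fun l => hk (Sum.inr l)
    refine ⟨Sum.elim r r', ?_⟩
    rintro ((p | p) | (p | p))
    exacts [hr (Sum.inl p), hr' (Sum.inl p), hr (Sum.inr p), hr' (Sum.inr p)]

theorem quot {e : Rewiring ((P.tensor U).tensor L) ((Q.tensor U).tensor L)}
    {i : (P.tensor U).Pos → W} {j : (Q.tensor U).Pos → W} (h : Draws lab e i j w)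
    {r : W → W → Prop} (hr : ∀ u, r (j (Sum.inr u)) (i (Sum.inr u)))
    (exists_of_rel : ∀ a b, r a b → ∃ u, a = j (Sum.inr u) ∧ b = i (Sum.inr u))
    {lab' : Quot r → O} (hlab : ∀ a, lab' (Quot.mk r a) = lab a)
    (hU : ∀ u, lab (i (Sum.inr u)) = U.label u) :
    Draws lab' ((Rewiring.assoc P U L).symm.trans (e.trans (Rewiring.assoc Q U L)))
      (fun p => Quot.mk r (i (Sum.inl p))) (fun q => Quot.mk r (j (Sum.inl q)))
      (fun l => Quot.mk r (copair (fun u => i (Sum.inr u)) w l)) := by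
  set i₁ : P.Pos → Quot r := fun p => Quot.mk r (i (Sum.inl p))
  set j₁ : Q.Pos → Quot r := fun q => Quot.mk r (j (Sum.inl q))
  set w₁ : (U.tensor L).Pos → Quot r := fun l => Quot.mk r (copair (fun u => i (Sum.inr u)) w l)
  have hi (p) : copair i₁ w₁ p = Quot.mk r (copair i w ((Rewiring.assoc P U L).symm p)) := by
    rcases p with _ | (_ | _) <;> rfl
  have hj (q) : copair j₁ w₁ (Rewiring.assoc Q U L q) = Quot.mk r (copair j w q) := by
    rcases q with (q | u) | l
    exacts [rfl, (Quot.sound (hr u)).symm, rfl]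
  refine ⟨fun p => ?_, ?_, fun c => ?_, fun k hk => ?_⟩
  · rw [Rewiring.trans_apply, Rewiring.trans_apply, hj, h.apply, hi]
  · rintro (u | l)
    exacts [(hlab _).trans (hU u), (hlab _).trans (h.label l)]
  · obtain ⟨a, rfl⟩ := Quot.mk_surjective c
    obtain ⟨p, rfl⟩ := h.surjective a
    exact ⟨Rewiring.assoc P U L p, by rw [hi, Rewiring.symm_apply_apply]⟩
  · obtain ⟨s, hs⟩ := h.factors (fun p => k (Rewiring.assoc P U L p)) fun l => hk (Sum.inr l)
    refine ⟨Quot.lift s fun a b hab => ?_, fun p => ?_⟩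
    · obtain ⟨u, rfl, rfl⟩ := exists_of_rel a b hab
      have hu : copair i w _ = j (Sum.inr u) := h.apply_symm (Sum.inl (Sum.inr u))
      rw [← hu, hs]
      exact (hk (Sum.inl u)).trans (hs (Sum.inl (Sum.inr u))).symm
    · rw [hi]
      exact (hs _).trans (by rw [Rewiring.apply_symm_apply])

theorem apply_of_assoc {R S : ObjTerm O}
    {e : Rewiring ((P.tensor R).tensor S) ((Q.tensor R).tensor S)} {w : (R.tensor S).Pos → W}
    (h : Draws lab ((Rewiring.assoc P R S).symm.trans (e.trans (Rewiring.assoc Q R S))) i j w)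
    (p : ((P.tensor R).tensor S).Pos) :
    copair (copair j fun r => w (Sum.inl r)) (fun s => w (Sum.inr s)) (e p) =
      copair (copair i fun r => w (Sum.inl r)) (fun s => w (Sum.inr s)) p := by
  rw [← copair_assoc, ← copair_assoc, ← h.apply, Rewiring.trans_apply, Rewiring.trans_apply,
    Rewiring.symm_apply_apply]

theorem yank {R : ObjTerm O} {X : O}
    {e : Rewiring ((P.tensor R).tensor (.var X)) ((Q.tensor R).tensor (.var X))}
    {w : (R.tensor (.var X)).Pos → W}
    (h : Draws lab ((Rewiring.assoc P R (.var X)).symm.trans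
      (e.trans (Rewiring.assoc Q R (.var X)))) i j w)
    {q : (Q.tensor R).Pos} (hq : e (Sum.inr ()) = Sum.inl q)
    {f : Rewiring (P.tensor R) (Q.tensor R)}
    (hf : ∀ p, f p = Sum.elim id (fun _ => q) (e (Sum.inl p))) :
    Draws lab f i j (fun r => w (Sum.inl r)) := by
  set w₁ : R.Pos → W := fun r => w (Sum.inl r)
  have hw₁ : copair j w₁ q = w (Sum.inr ()) := by
    have := h.apply_of_assoc (Sum.inr ())
    rwa [hq] at this
  have apply_f (p) : copair j w₁ (f p) = copair i w₁ p := by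
    rw [hf]
    refine Eq.trans ?_ (h.apply_of_assoc (Sum.inl p))
    rcases e (Sum.inl p) with r | ⟨⟩
    exacts [rfl, hw₁]
  refine ⟨apply_f, fun r => h.label (Sum.inl r), fun a => ?_, fun k hk => ?_⟩
  · obtain ⟨p, rfl⟩ := h.surjective a
    obtain ⟨p, rfl⟩ := (Rewiring.assoc P R (.var X)).toEquiv.surjective p
    rw [copair_assoc]
    rcases p with p | ⟨⟩
    · exact ⟨p, rfl⟩
    · refine ⟨f.symm q, ?_⟩
      rw [← apply_f, f.apply_symm_apply]
      exact hw₁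
  · set k₁ : ((P.tensor R).tensor (.var X)).Pos → _ := copair k fun _ => k (f.symm q)
    have k₁_eq (p) : k₁ p = k (f.symm (Sum.elim id (fun _ => q) (e p))) := by
      rcases p with p | ⟨⟩
      · rw [← hf, f.symm_apply_apply]
        rfl
      · exact congrArg (fun p => k (f.symm (Sum.elim id (fun _ => q) p))) hq.symm
    obtain ⟨r, hr⟩ := h.factors (fun p => k₁ ((Rewiring.assoc P R (.var X)).symm p)) (by
      intro l
      change k₁ ((Rewiring.assoc P R (.var X)).symm ((Rewiring.assoc P R (.var X))
        (e.symm ((Rewiring.assoc Q R (.var X)).symm (Sum.inr l))))) = _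
      rw [Rewiring.symm_apply_apply, k₁_eq, e.apply_symm_apply]
      rcases l with l | ⟨⟩
      exacts [hk l, rfl])
    exact ⟨r, fun p => (congrArg r (copair_assoc i w (Sum.inl p))).symm.trans ((hr _).trans
      (congrArg k₁ ((Rewiring.assoc P R (.var X)).symm_apply_apply (Sum.inl p))))⟩

section Wires

variable {C : Type u} [Category.{v} C] [MonoidalCategory C] [SymmetricCategory C]
  [TracedCategory C] (o : O → C)

theorem exists_lt_card (h : Draws lab e i j w) {l : L.Pos} (hl : e (Sum.inr l) ≠ Sum.inr l) :
    ∃ (L' : ObjTerm O) (e' : Rewiring (P.tensor L') (Q.tensor L')) (w' : L'.Pos → W),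
      Nat.card L'.Pos < Nat.card L.Pos ∧ Draws lab e' i j w' ∧ e'.wires o = e.wires o := by
  obtain ⟨R, c, hc⟩ := Rewiring.exists_split L l rfl
  set e₁ := ((Rewiring.refl P).sum c.symm).trans (e.trans ((Rewiring.refl Q).sum c))
  set e₂ := (Rewiring.assoc P R (.var _)).trans (e₁.trans (Rewiring.assoc Q R (.var _)).symm)
  have he₂ : e₂ (Sum.inr ()) =
      (Rewiring.assoc Q R (.var _)).symm ((Rewiring.refl Q).sum c (e (Sum.inr l))) :=
    congrArg (fun m => (Rewiring.assoc Q R (.var _)).symm ((Rewiring.refl Q).sum c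
      (e (Sum.inr m)))) (c.symm_apply_eq.2 hc.symm)
  obtain ⟨q, hq⟩ : ∃ q, e₂ (Sum.inr ()) = Sum.inl q := by
    rw [he₂]
    rcases h_l : e (Sum.inr l) with q | m
    · exact ⟨Sum.inl q, rfl⟩
    · change ∃ q, (Rewiring.assoc Q R (.var _)).symm (Sum.inr (c m)) = _
      rcases hm : c m with r | ⟨⟩
      · exact ⟨Sum.inr r, rfl⟩
      · exact (hl (h_l.trans (congrArg Sum.inr (c.injective (hm.trans hc.symm))))).elim
  obtain ⟨f, hf_hom, hf⟩ := Rewiring.exists_hom_eq_wires o e₂ hq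
  have he₁ : e₁ = (Rewiring.assoc P R (.var _)).symm.trans
      (e₂.trans (Rewiring.assoc Q R (.var _))) :=
    Rewiring.ext fun p => by simp only [e₂, Rewiring.trans_apply, Rewiring.apply_symm_apply]
  have h₁ : Draws lab e₁ i j fun m => w (c.symm m) := h.transport (.refl P) (.refl Q) c
    (fun _ => rfl) (fun _ => rfl) fun m => congrArg w (c.symm_apply_apply m)
  rw [he₁] at h₁
  refine ⟨R, f, _, ?_, h₁.yank hq hf, ?_⟩
  · have := R.finite_pos
    calc Nat.card R.Pos < Nat.card R.Pos + Nat.card Unit := by simp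
      _ = Nat.card L.Pos := (Nat.card_sum.symm.trans (Nat.card_congr c.toEquiv).symm)
  · have he := Rewiring.wires_rewire o e c
    change _ = Rewiring.wires o e₁ at he
    rw [he, he₁, ← Rewiring.totalTr_wires, ← hf_hom, Rewiring.wires]

theorem exists_loops (h : Draws lab e i j w) :
    ∃ (φ : Rewiring P Q) (L' : ObjTerm O) (w' : L'.Pos → W),
      Draws lab (φ.sum (.refl L')) i j w' ∧ (φ.sum (.refl L')).wires o = e.wires o := by
  induction hn : Nat.card L.Pos using Nat.strong_induction_on generalizing L with
  | _ n ih =>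
    subst hn
    by_cases loops : ∀ l, e (Sum.inr l) = Sum.inr l
    · obtain ⟨φ, rfl⟩ := Rewiring.exists_eq_sum_refl e loops
      exact ⟨φ, L, w, h, rfl⟩
    · obtain ⟨l, hl⟩ := not_forall.1 loops
      obtain ⟨L', e', w', hlt, h', hw⟩ := h.exists_lt_card o hl
      obtain ⟨φ, K, k, hφ, hk⟩ := ih _ hlt h' rfl
      exact ⟨φ, K, k, hφ, hk.trans hw⟩

theorem injective_of_loops {φ : Rewiring P Q} (h : Draws lab (φ.sum (.refl L)) i j w) :
    Function.Injective (copair i w) := by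
  obtain ⟨r, hr⟩ := h.factors id fun _ => rfl
  exact Function.LeftInverse.injective hr

theorem exists_loop_eq {φ ψ : Rewiring P Q} {w' : L'.Pos → W}
    (h : Draws lab (φ.sum (.refl L)) i j w) (h' : Draws lab (ψ.sum (.refl L')) i j w') (l : L.Pos) :
    ∃ l', w' l' = w l := by
  obtain ⟨p | l', hp⟩ := h'.surjective (w l)
  · cases h.injective_of_loops (show copair i w (Sum.inl p) = copair i w (Sum.inr l) from hp)
  · exact ⟨l', hp⟩

theorem loops_unique {φ ψ : Rewiring P Q} {w' : L'.Pos → W}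
    (h : Draws lab (φ.sum (.refl L)) i j w) (h' : Draws lab (ψ.sum (.refl L')) i j w') :
    (φ.sum (.refl L)).wires o = (ψ.sum (.refl L')).wires o := by
  have hw : Function.Injective w := fun l m hlm =>
    Sum.inr_injective (h.injective_of_loops (a₁ := Sum.inr l) (a₂ := Sum.inr m) hlm)
  have hw' : Function.Injective w' := fun l m hlm =>
    Sum.inr_injective (h'.injective_of_loops (a₁ := Sum.inr l) (a₂ := Sum.inr m) hlm)
  have hφψ : φ = ψ := by
    refine Rewiring.ext fun p => ?_
    obtain ⟨p', hp'⟩ := φ.toEquiv.surjective (ψ p)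
    have hp : i p' = i p := (h.apply (Sum.inl p')).symm.trans ((congrArg j hp').trans
      (h'.apply (Sum.inl p)))
    have := Sum.inl_injective
      (h.injective_of_loops (a₁ := Sum.inl p') (a₂ := Sum.inl p) hp)
    exact this ▸ hp'
  choose s hs using h.exists_loop_eq h'
  have hs_bij : Function.Bijective s := by
    refine ⟨fun l m hlm => hw ?_, fun l' => ?_⟩
    · rw [← hs, ← hs, hlm]
    · obtain ⟨l, hl⟩ := h'.exists_loop_eq h l'
      exact ⟨l, hw' ((hs l).trans hl)⟩
  let a : Rewiring L L' := ⟨Equiv.ofBijective s hs_bij, fun l => by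
    rw [← h.label, ← h'.label]; exact congrArg lab (hs l)⟩
  rw [Rewiring.wires_rewire o _ a, hφψ]
  refine congrArg _ (Rewiring.ext ?_)
  rintro (p | l)
  exacts [rfl, congrArg Sum.inr (a.apply_symm_apply l)]

theorem wires_unique {e' : Rewiring (P.tensor L') (Q.tensor L')} {w' : L'.Pos → W}
    (h : Draws lab e i j w) (h' : Draws lab e' i j w') : e.wires o = e'.wires o := by
  obtain ⟨φ, K, k, hφ, hw⟩ := h.exists_loops o
  obtain ⟨ψ, K', k', hψ, hw'⟩ := h'.exists_loops o
  rw [← hw, ← hw', hφ.loops_unique o hψ]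

end Wires
end Draws
end Draws

/-! ### Substitution of object terms -/

namespace ObjTerm

/-- Substitution of object terms for the variables of an object term. -/
def subst {N : Type u'} {O : Type w} (f : N → ObjTerm O) : ObjTerm N → ObjTerm O
  | .var n => f n
  | .unit => .unit
  | .tensor M M' => .tensor (M.subst f) (M'.subst f)

/-- The map on the positions of a substitution instance of `M` given by maps on those of the object
terms that are substituted. -/
def substElim {N : Type u'} {O : Type w} (f : N → ObjTerm O) {W : Type} :
    (M : ObjTerm N) → (∀ b : M.Pos, (f (M.label b)).Pos → W) → (M.subst f).Pos → W
  | .var _, F => F ()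
  | .unit, _ => Empty.elim
  | .tensor M M', F =>
      copair (M.substElim f fun b => F (Sum.inl b)) (M'.substElim f fun b => F (Sum.inr b))

theorem apply_substElim {N : Type u'} {O : Type w} {f : N → ObjTerm O} {W W' : Type} (g : W → W') :
    ∀ {M : ObjTerm N} (F : ∀ b : M.Pos, (f (M.label b)).Pos → W) (p : (M.subst f).Pos),
      g (M.substElim f F p) = M.substElim f (fun b q => g (F b q)) p
  | .var _, _, _ => rfl
  | .tensor _ _, _, Sum.inl p => apply_substElim g _ p
  | .tensor _ _, _, Sum.inr p => apply_substElim g _ p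

end ObjTerm

namespace StructTerm

variable {N : Type w} {O : Type w} {f : N → ObjTerm O} {M M' : ObjTerm N}

/-- Substitution in a structural term. -/
def subst (f : N → ObjTerm O) : ∀ {M M' : ObjTerm N}, StructTerm M M' →
    StructTerm (M.subst f) (M'.subst f)
  | _, _, .id _ => .id _
  | _, _, .comp s t => .comp (s.subst f) (t.subst f)
  | _, _, .inv s => .inv (s.subst f)
  | _, _, .tensor s t => .tensor (s.subst f) (t.subst f)
  | _, _, .assoc _ _ _ => .assoc _ _ _
  | _, _, .leftUnitor _ => .leftUnitor _
  | _, _, .braid _ _ => .braid _ _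

theorem substElim_perm_subst {W : Type} (t : StructTerm M M') :
    ∀ {F : ∀ b : M.Pos, (f (M.label b)).Pos → W} {F' : ∀ b : M'.Pos, (f (M'.label b)).Pos → W},
      (∀ b, HEq (F' (t.perm b)) (F b)) →
      ∀ p, M'.substElim f F' ((t.subst f).perm p) = M.substElim f F p := by
  induction t with
  | id A =>
    intro F F' h p
    obtain rfl : F' = F := funext fun b => eq_of_heq (h b)
    rfl
  | @comp A B D s t hs ht =>
    intro F F' h p
    let F₁ (b : B.Pos) : (f (B.label b)).Pos → W :=
      cast (congrArg (fun n => (f n).Pos → W) (t.perm.label_eq b)) (F' (t.perm b))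
    have hF₁ (b) : HEq (F₁ b) (F' (t.perm b)) := cast_heq _ _
    exact (ht (fun b => (hF₁ b).symm) _).trans (hs (fun b => (hF₁ _).trans (h b)) p)
  | @inv A B s hs =>
    intro F F' h p
    have hF (b) : HEq (F (s.perm b)) (F' b) := by
      have := h (s.perm b)
      change HEq (F' (s.perm.symm (s.perm b))) _ at this
      rw [s.perm.symm_apply_apply] at this
      exact this.symm
    refine (hs hF _).symm.trans (congrArg _ ?_)
    exact (s.subst f).perm.apply_symm_apply p
  | tensor s t hs ht =>
    rintro F F' h (p | p)
    exacts [hs (fun b => h (Sum.inl b)) p, ht (fun b => h (Sum.inr b)) p]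
  | assoc A B D =>
    rintro F F' h ((p | p) | p)
    exacts [congrArg (A.substElim f · p) (funext fun b => eq_of_heq (h (Sum.inl (Sum.inl b)))),
      congrArg (B.substElim f · p) (funext fun b => eq_of_heq (h (Sum.inl (Sum.inr b)))),
      congrArg (D.substElim f · p) (funext fun b => eq_of_heq (h (Sum.inr b)))]
  | leftUnitor A =>
    rintro F F' h (p | p)
    exacts [p.elim, congrArg (A.substElim f · p) (funext fun b => eq_of_heq (h (Sum.inr b)))]
  | braid A B =>
    rintro F F' h (p | p)
    exacts [congrArg (A.substElim f · p) (funext fun b => eq_of_heq (h (Sum.inl b))),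
      congrArg (B.substElim f · p) (funext fun b => eq_of_heq (h (Sum.inr b)))]

end StructTerm

/-- The rewiring between substitution instances that a rewiring induces. -/
noncomputable def Rewiring.subst {N O : Type w} (f : N → ObjTerm O) {M M' : ObjTerm N}
    (e : Rewiring M M') : Rewiring (M.subst f) (M'.subst f) :=
  ((StructTerm.exists_perm_eq e).choose.subst f).perm

theorem Rewiring.substElim_subst {N O : Type w} {f : N → ObjTerm O} {M M' : ObjTerm N} {W : Type}
    (e : Rewiring M M') {F : ∀ b : M.Pos, (f (M.label b)).Pos → W}
    {F' : ∀ b : M'.Pos, (f (M'.label b)).Pos → W} (h : ∀ b, HEq (F' (e b)) (F b))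
    (p : (M.subst f).Pos) : M'.substElim f F' (e.subst f p) = M.substElim f F p := by
  refine StructTerm.substElim_perm_subst _ (fun b => ?_) p
  rw [(StructTerm.exists_perm_eq e).choose_spec]
  exact h b

/-! ### Boxes -/

section Boxes

variable {S : TraceSignature.{w}} {C : Type u} [Category.{v} C] [MonoidalCategory C]
  (x : TraceValuation C S)

/-- The tensor product of the values of the boxes listed by `M`. -/
def boxHom : (M : ObjTerm S.Mor) → ((M.subst S.dom).eval x.obj ⟶ (M.subst S.cod).eval x.obj)
  | .var m => x.mor m
  | .unit => 𝟙 (𝟙_ C)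
  | .tensor M M' => tens (boxHom M) (boxHom M')

variable [SymmetricCategory C]

theorem boxHom_eval {M M' : ObjTerm S.Mor} (t : StructTerm M M') :
    ((t.subst S.dom).eval x.obj).hom ≫ boxHom x M' =
      boxHom x M ≫ ((t.subst S.cod).eval x.obj).hom := by
  induction t with
  | id A => exact (Category.id_comp _).trans (Category.comp_id _).symm
  | comp s t hs ht =>
    change (_ ≫ _) ≫ _ = _ ≫ _ ≫ _
    rw [Category.assoc, ht, reassoc_of% hs]
  | inv s hs =>
    change Iso.inv _ ≫ _ = _ ≫ Iso.inv _
    rw [Iso.inv_comp_eq, ← Category.assoc, hs, Category.assoc, Iso.hom_inv_id, Category.comp_id]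
  | tensor s t hs ht =>
    change tens _ _ ≫ tens _ _ = tens _ _ ≫ tens _ _
    rw [tens_comp, tens_comp, hs, ht]
  | assoc A B D => exact (associator_naturality _ _ _).symm
  | leftUnitor A =>
    exact (leftUnitor_naturality _).symm.trans (congrArg (· ≫ _) (id_tensorHom _ _).symm)
  | braid A B => exact (BraidedCategory.braiding_naturality _ _).symm

theorem boxHom_naturality {M M' : ObjTerm S.Mor} (e : Rewiring M M') :
    (e.subst S.dom).hom x.obj ≫ boxHom x M' = boxHom x M ≫ (e.subst S.cod).hom x.obj := by
  rw [Rewiring.subst, Rewiring.subst, Rewiring.hom_perm, Rewiring.hom_perm, boxHom_eval]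

variable [TracedCategory C] {A B A' B' U : ObjTerm S.Obj} {M M' : ObjTerm S.Mor}

/-- The value of a diagram with boxes `M`, given the value `φ` of its part without boxes, for which
the outputs of the boxes are inputs and the inputs of the boxes are outputs. -/
def closeBoxes (M : ObjTerm S.Mor) (φ : (A.tensor (M.subst S.cod)).eval x.obj ⟶
    (B.tensor (M.subst S.dom)).eval x.obj) : A.eval x.obj ⟶ B.eval x.obj :=
  totalTr (M.subst S.dom) (tens (𝟙 (A.eval x.obj)) (boxHom x M) ≫ φ)

theorem closeBoxes_var (m : S.Mor) :
    closeBoxes x (.var m) ((Rewiring.braid (S.dom m) (S.cod m)).hom x.obj) = x.mor m := by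
  refine (comp_eq_totalTr (𝟙 _) (x.mor m)).symm.trans (Category.id_comp _)

theorem closeBoxes_unit (a : Rewiring A B) :
    closeBoxes x .unit ((a.sum (.refl .unit)).hom x.obj) = a.hom x.obj := by
  refine (totalTr_unit _).trans ?_
  change _ ≫ (tens _ (𝟙 (ObjTerm.eval x.obj .unit)) ≫ _) ≫ _ = _
  rw [tens_id, Category.id_comp, ← Rewiring.hom_trans, ← Rewiring.hom_trans]
  exact congrArg (Rewiring.hom x.obj) (Rewiring.ext fun _ => rfl)

theorem tens_closeBoxes (φ : (A.tensor (M.subst S.cod)).eval x.obj ⟶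
    (B.tensor (M.subst S.dom)).eval x.obj) (φ' : (A'.tensor (M'.subst S.cod)).eval x.obj ⟶
    (B'.tensor (M'.subst S.dom)).eval x.obj) :
    tens (closeBoxes x M φ) (closeBoxes x M' φ') = closeBoxes x (M.tensor M')
      ((Rewiring.interchange _ _ _ _).hom x.obj ≫ tens φ φ' ≫
        (Rewiring.interchange _ _ _ _).hom x.obj) := by
  rw [closeBoxes, closeBoxes, totalTr_tens_totalTr, ← tens_comp, Category.assoc]
  refine congrArg (totalTr _) ?_
  rw [← Category.assoc, ← Rewiring.tens_comp_interchange_hom, Category.assoc, tens_id]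
  rfl

theorem closeBoxes_comp (φ : (A.tensor (M.subst S.cod)).eval x.obj ⟶
    (B.tensor (M.subst S.dom)).eval x.obj) (h : B.eval x.obj ⟶ B'.eval x.obj) :
    closeBoxes x M φ ≫ h = closeBoxes x M (φ ≫ tens h (𝟙 _)) := by
  have := totalTr_naturality (tens (𝟙 (A.eval x.obj)) (boxHom x M) ≫ φ) (𝟙 _) h
  rwa [Category.id_comp, tens_id, Category.id_comp, Category.assoc] at this

theorem totalTr_closeBoxes (φ : ((A.tensor U).tensor (M.subst S.cod)).eval x.obj ⟶
    ((B.tensor U).tensor (M.subst S.dom)).eval x.obj) :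
    totalTr U (closeBoxes x M φ) = closeBoxes x M (totalTr U
      ((Rewiring.swapRight _ _ _).hom x.obj ≫ φ ≫ (Rewiring.swapRight _ _ _).hom x.obj)) := by
  have totalTr_comm (ψ : ((A.tensor U).tensor (M.subst S.dom)).eval x.obj ⟶
      ((B.tensor U).tensor (M.subst S.dom)).eval x.obj) :
      totalTr U (totalTr (M.subst S.dom) ψ) = totalTr (M.subst S.dom) (totalTr U
        ((Rewiring.swapRight _ _ _).hom x.obj ≫ ψ ≫ (Rewiring.swapRight _ _ _).hom x.obj)) := by
    rw [totalTr_totalTr, totalTr_totalTr, totalTr_rewire _ (Rewiring.braid _ _)]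
    simp only [Category.assoc, Rewiring.hom_trans_assoc, ← Rewiring.hom_trans]
    refine congrArg _ (Rewiring.conj_congr ?_ ?_ _)
    · rintro (_ | (_ | _)) <;> rfl
    · rintro ((_ | _) | _) <;> rfl
  have box_naturality := totalTr_naturality (U := U)
    ((Rewiring.swapRight _ _ _).hom x.obj ≫ φ ≫ (Rewiring.swapRight _ _ _).hom x.obj)
    (tens (𝟙 (A.eval x.obj)) (boxHom x M)) (𝟙 _)
  rw [Category.comp_id, tens_id, Category.comp_id, ← Category.assoc (tens (tens _ _) _),
    Rewiring.tens_comp_swapRight_hom, tens_id] at box_naturality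
  rw [closeBoxes, closeBoxes, totalTr_comm, box_naturality]
  simp only [Category.assoc]

theorem closeBoxes_rewire (φ : (A.tensor (M.subst S.cod)).eval x.obj ⟶
    (B.tensor (M.subst S.dom)).eval x.obj) (c : Rewiring M M') :
    closeBoxes x M φ = closeBoxes x M' (((Rewiring.refl A).sum (c.subst S.cod).symm).hom x.obj ≫
      φ ≫ ((Rewiring.refl B).sum (c.subst S.dom)).hom x.obj) := by
  have box_naturality : (c.subst S.dom).symm.hom x.obj ≫ boxHom x M =
      boxHom x M' ≫ (c.subst S.cod).symm.hom x.obj := by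
    rw [← Category.comp_id (boxHom x M), ← Rewiring.hom_comp_symm x.obj (c.subst S.cod),
      ← Category.assoc (boxHom x M), ← boxHom_naturality, Category.assoc, ← Category.assoc,
      Rewiring.hom_symm_comp, Category.id_comp]
  rw [closeBoxes, closeBoxes, totalTr_rewire _ (c.subst S.dom)]
  simp only [← Rewiring.tens_id_hom, Category.assoc, tens_comp_assoc, Category.id_comp,
    box_naturality]

end Boxes

/-! ### Values of diagrams -/

namespace TraceDiagram

/-- The diagram `G` followed by a rewiring of its output. -/
def rewireOut {S : TraceSignature.{w}} {A B B' : ObjTerm S.Obj} (G : TraceDiagram S A B)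
    (b : Rewiring B B') : TraceDiagram S A B' where
  __ := G
  out q := G.out (b.symm q)
  label_inp := G.label_inp
  label_out q := (G.label_out _).trans (b.symm.label_eq q)

/-- A composite is the trace of a tensor product, with the outputs exchanged. -/
def compIsoTrace {S : TraceSignature.{w}} {A B D : ObjTerm S.Obj} (G : TraceDiagram S A B)
    (G' : TraceDiagram S B D) :
    ((G.tensor G').rewireOut (.braid B D)).trace.Iso (G.comp G') where
  wire := Quot.congr (Equiv.refl _) fun _ _ =>
    ⟨by rintro ⟨p⟩; exact .join p, by
      rintro ⟨p⟩; exact .join (D := (G.tensor G').rewireOut (.braid B D)) p⟩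
  box _ := Equiv.refl _
  label_wire := by rintro ⟨_⟩; rfl
  wire_inp _ := rfl
  wire_out _ := rfl
  wire_boxIn _ _ := rfl
  wire_boxOut _ _ := rfl

section Denotes

variable {S : TraceSignature.{w}} {C : Type u} [Category.{v} C] [MonoidalCategory C]
  [SymmetricCategory C] [TracedCategory C] {x : TraceValuation C S}
  {A B A' B' D U : ObjTerm S.Obj}

/-- `G` denotes `f` if `f` is the value of a list `M` of its boxes, closed up by a rewiring that
draws the wires of `G`. -/
def Denotes (G : TraceDiagram S A B) (x : TraceValuation C S)
    (f : A.eval x.obj ⟶ B.eval x.obj) : Prop :=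
  ∃ (M : ObjTerm S.Mor) (box : ∀ b : M.Pos, G.Box (M.label b)) (L : ObjTerm S.Obj)
    (e : Rewiring ((A.tensor (M.subst S.cod)).tensor L) ((B.tensor (M.subst S.dom)).tensor L))
    (w : L.Pos → G.Wire),
    Function.Bijective (fun b => (⟨M.label b, box b⟩ : Σ m, G.Box m)) ∧
    Draws G.label e (copair G.inp (M.substElim S.cod fun b => G.boxOut (box b)))
      (copair G.out (M.substElim S.dom fun b => G.boxIn (box b))) w ∧
    closeBoxes x M (e.wires x.obj) = f

namespace Denotes

variable {G : TraceDiagram S A B} {f g : A.eval x.obj ⟶ B.eval x.obj}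

theorem single (m : S.Mor) : (single m).Denotes x (x.mor m) := by
  refine ⟨.var m, fun _ => ⟨rfl⟩, .unit, _, _, ⟨fun _ _ _ => rfl, ?_⟩,
    Draws.of_rewiring (a := Rewiring.braid (S.dom m) (S.cod m)) ?_ ?_, ?_⟩
  · rintro ⟨_, ⟨rfl⟩⟩
    exact ⟨(), rfl⟩
  · exact (congrArg _ (funext (Sum.rec (fun _ => rfl) fun _ => rfl))).mpr Function.bijective_id
  · rintro (_ | _) <;> rfl
  · exact (congrArg (closeBoxes x (.var m)) (Rewiring.wires_unit _ _)).trans (closeBoxes_var x m)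

theorem wiring (a : Rewiring A B) (ha : ∀ p, A.label (a.symm p) = B.label p)
    (hf : a.hom x.obj = f) : (wiring a.symm.toEquiv ha).Denotes x f := by
  subst hf
  refine ⟨.unit, fun b : Empty => b.elim, .unit, _, _, ⟨fun b : Empty => b.elim, fun b => b.2.elim⟩,
    Draws.of_rewiring (a := a.sum (.refl .unit)) ⟨?_, fun p => ⟨Sum.inl p, rfl⟩⟩ ?_, ?_⟩
  · rintro (p | ⟨⟨⟩⟩) (q | ⟨⟨⟩⟩) hpq
    exact congrArg Sum.inl hpq
  · rintro (p | ⟨⟨⟩⟩)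
    exact a.symm_apply_apply p
  · exact (congrArg (closeBoxes x .unit) (Rewiring.wires_unit _ _)).trans (closeBoxes_unit x a)

theorem tensor {G' : TraceDiagram S A' B'} {f' : A'.eval x.obj ⟶ B'.eval x.obj}
    (h : G.Denotes x f) (h' : G'.Denotes x f') : (G.tensor G').Denotes x (tens f f') := by
  obtain ⟨M, box, L, e, w, hbox, hdraws, rfl⟩ := h
  obtain ⟨M', box', L', e', w', hbox', hdraws', rfl⟩ := h'
  refine ⟨M.tensor M', Sum.rec (fun b => Sum.inl (box b)) (fun b => Sum.inr (box' b)), _, _, _, ?_,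
    (hdraws.sum hdraws').transport (.interchange _ _ _ _) (.interchange _ _ _ _) (.refl _)
      ?_ ?_ (fun _ => rfl), ?_⟩
  · have hbox_sum := (Equiv.sigmaSumDistrib G.Box G'.Box).symm.bijective.comp (hbox.sumMap hbox')
    exact (congrArg _ (funext (Sum.rec (fun _ => rfl) fun _ => rfl))).mpr hbox_sum
  · rintro ((p | p) | (p | p))
    exacts [rfl, rfl, (ObjTerm.apply_substElim Sum.inl _ p).symm,
      (ObjTerm.apply_substElim Sum.inr _ p).symm]
  · rintro ((p | p) | (p | p))
    exacts [rfl, (ObjTerm.apply_substElim Sum.inl _ p).symm, rfl,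
      (ObjTerm.apply_substElim Sum.inr _ p).symm]
  · refine (congrArg (closeBoxes x _) ?_).trans (tens_closeBoxes x _ _).symm
    rw [Rewiring.tens_wires]
    exact (Rewiring.wires_conj _ _ _ _).symm

theorem trace {G : TraceDiagram S (A.tensor U) (B.tensor U)}
    {f : (A.tensor U).eval x.obj ⟶ (B.tensor U).eval x.obj} (h : G.Denotes x f) :
    G.trace.Denotes x (totalTr U f) := by
  obtain ⟨M, box, L, e, w, hbox, hdraws, rfl⟩ := h
  have swapped : Draws G.label _
      (copair (copair (fun p => G.inp (Sum.inl p)) (M.substElim S.cod fun b => G.boxOut (box b)))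
        fun u => G.inp (Sum.inr u))
      (copair (copair (fun q => G.out (Sum.inl q)) (M.substElim S.dom fun b => G.boxIn (box b)))
        fun u => G.out (Sum.inr u)) w :=
    hdraws.transport (.swapRight _ _ _) (.swapRight _ _ _) (.refl _)
      (by rintro ((_ | _) | _) <;> rfl) (by rintro ((_ | _) | _) <;> rfl) fun _ => rfl
  have joined := swapped.quot (r := TraceRel G) (lab' := G.trace.label) (fun u => .join u)
    (by rintro _ _ ⟨u⟩; exact ⟨u, rfl, rfl⟩) (fun _ => rfl) fun u => G.label_inp (Sum.inr u)
  refine ⟨M, box, _, _, _, hbox, joined.map_equiv (Equiv.refl _) (fun _ => rfl) ?_ ?_, ?_⟩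
  · rintro (p | p)
    exacts [rfl, (ObjTerm.apply_substElim (Quot.mk _) _ p).symm]
  · rintro (p | p)
    exacts [rfl, (ObjTerm.apply_substElim (Quot.mk _) _ p).symm]
  · rw [totalTr_closeBoxes, Rewiring.wires_conj, Rewiring.totalTr_wires]
    rfl

theorem rewireOut (h : G.Denotes x f) (b : Rewiring B B') :
    (G.rewireOut b).Denotes x (f ≫ b.hom x.obj) := by
  obtain ⟨M, box, L, e, w, hbox, hdraws, rfl⟩ := h
  refine ⟨M, box, _, _, w, hbox,
    hdraws.transport (.refl _) (b.sum (.refl _)) (.refl _) (fun _ => rfl) ?_ (fun _ => rfl), ?_⟩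
  · rintro (q | q)
    exacts [congrArg G.out (b.symm_apply_apply q), rfl]
  · have wires_comp := Rewiring.wires_conj x.obj e (.refl _) (b.sum (.refl _))
    rw [Rewiring.hom_refl, Category.id_comp] at wires_comp
    rw [closeBoxes_comp, Rewiring.tens_hom_id, wires_comp]
    rfl

theorem of_iso {G' : TraceDiagram S A B} (h : G.Denotes x f) (v : G.Iso G') :
    G'.Denotes x f := by
  obtain ⟨M, box, L, e, w, hbox, hdraws, rfl⟩ := h
  refine ⟨M, fun b => v.box _ (box b), L, e, _, ?_, hdraws.map_equiv v.wire v.label_wire ?_ ?_, rfl⟩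
  · exact (Equiv.sigmaCongrRight v.box).bijective.comp hbox
  · rintro (p | p)
    · exact (v.wire_inp p).symm
    · refine Eq.trans ?_ (ObjTerm.apply_substElim v.wire _ p).symm
      simp only [v.wire_boxOut]
      rfl
  · rintro (p | p)
    · exact (v.wire_out p).symm
    · refine Eq.trans ?_ (ObjTerm.apply_substElim v.wire _ p).symm
      simp only [v.wire_boxIn]
      rfl

theorem comp {G' : TraceDiagram S B D} {g : B.eval x.obj ⟶ D.eval x.obj} (h : G.Denotes x f)
    (h' : G'.Denotes x g) : (G.comp G').Denotes x (f ≫ g) := by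
  rw [comp_eq_totalTr]
  exact ((h.tensor h').rewireOut _).trace.of_iso (compIsoTrace G G')

theorem unique (h : G.Denotes x f) (h' : G.Denotes x g) : f = g := by
  obtain ⟨M, box, L, e, w, hbox, hdraws, rfl⟩ := h
  obtain ⟨M', box', L', e', w', hbox', hdraws', rfl⟩ := h'
  let c : Rewiring M M' :=
    ⟨(Equiv.ofBijective _ hbox).trans (Equiv.ofBijective _ hbox').symm, fun b =>
      congrArg Sigma.fst ((Equiv.ofBijective _ hbox').apply_symm_apply ⟨M.label b, box b⟩)⟩
  have hc (b) : (⟨M'.label (c b), box' (c b)⟩ : Σ m, G.Box m) = ⟨M.label b, box b⟩ :=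
    (Equiv.ofBijective _ hbox').apply_symm_apply ⟨M.label b, box b⟩
  rw [closeBoxes_rewire _ _ c, Rewiring.wires_conj]
  refine congrArg _ (Draws.wires_unique _
    (hdraws.transport _ _ (.refl _) ?_ ?_ fun _ => rfl) hdraws')
  · rintro (p | p)
    · rfl
    · refine (congrArg _ ((c.subst S.cod).apply_symm_apply p).symm).trans
        (c.substElim_subst (F := fun b => G.boxOut (box b)) (fun b => ?_) _)
      exact congr_arg_heq (fun b : Σ m, G.Box m => G.boxOut b.2) (hc b)
  · rintro (p | p)
    · rfl
    · exact c.substElim_subst (F := fun b => G.boxIn (box b))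
        (fun b => congr_arg_heq (fun b : Σ m, G.Box m => G.boxIn b.2) (hc b)) p

end Denotes

end Denotes

end TraceDiagram

theorem TraceTerm.denotes_eval {S : TraceSignature.{w}} {C : Type u} [Category.{v} C]
    [MonoidalCategory C] [SymmetricCategory C] [TracedCategory C] (x : TraceValuation C S)
    {A B : ObjTerm S.Obj} (t : TraceTerm S A B) : t.diagram.Denotes x (t.eval x) := by
  induction t with
  | var m => exact .single m
  | id A => exact .wiring (.refl A) _ (Rewiring.hom_refl x.obj A)
  | comp f g hf hg => exact hf.comp hg
  | tensor f g hf hg => exact hf.tensor hg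
  | assoc A B D => exact .wiring (.assoc A B D) _ (Rewiring.hom_assoc x.obj A B D)
  | assocInv A B D =>
    exact .wiring (.symm (.assoc A B D)) _ (Rewiring.hom_assoc_symm x.obj A B D)
  | leftUnitor A => exact .wiring (.leftUnitor A) _ (Rewiring.hom_leftUnitor x.obj A)
  | leftUnitorInv A =>
    exact .wiring (.symm (.leftUnitor A)) _ (Rewiring.hom_leftUnitor_symm x.obj A)
  | rightUnitor A => exact .wiring (.rightUnitor A) _ (Rewiring.hom_rightUnitor x.obj A)
  | rightUnitorInv A =>
    exact .wiring (.symm (.rightUnitor A)) _ (Rewiring.hom_rightUnitor_symm x.obj A)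
  | symm A B => exact .wiring (.braid A B) _ (Rewiring.hom_braid x.obj A B)
  | trace f hf => exact hf.trace

theorem eval_eq_of_iso {S : TraceSignature.{w}} {C : Type u} [Category.{v} C] [MonoidalCategory C]
    [SymmetricCategory C] [TracedCategory C] {A B : ObjTerm S.Obj} {s t : TraceTerm S A B}
    (h : Nonempty (s.diagram.Iso t.diagram)) (x : TraceValuation C S) : s.eval x = t.eval x :=
  ((s.denotes_eval x).of_iso h.some).unique (t.denotes_eval x)

theorem isTracedLaw_of_graphicallyProvable {S : TraceSignature.{w}} {A B : ObjTerm S.Obj}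
    {s t : TraceTerm S A B} (h : GraphicallyProvable s t) : IsTracedLaw.{w, u, v} s t := by
  intro C _ _ _ _ x
  induction h with
  | refl => rfl
  | tail _ hstep ih => exact ih.trans (eval_eq_of_iso hstep x)

/-! ### Partial traces -/

section PartialTrace

variable {O : Type w} {C : Type u} [Category.{v} C] [MonoidalCategory C] [SymmetricCategory C]
  [PartiallyTracedCategory C] {o : O → C} {A B A' B' U V : ObjTerm O}

/-- The partial trace of a morphism between values of object terms. -/
def partialTr (U : ObjTerm O) (f : (A.tensor U).eval o ⟶ (B.tensor U).eval o) :
    Part (A.eval o ⟶ B.eval o) :=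
  PartiallyTracedCategory.tr (U := U.eval o) f

theorem comp_mem_partialTr {f : (A.tensor U).eval o ⟶ (B.tensor U).eval o}
    {k : A.eval o ⟶ B.eval o} (hk : k ∈ partialTr U f) (g : A'.eval o ⟶ A.eval o)
    (h : B.eval o ⟶ B'.eval o) :
    g ≫ k ≫ h ∈ partialTr U (tens g (𝟙 (U.eval o)) ≫ f ≫ tens h (𝟙 (U.eval o))) := by
  have := PartiallyTracedCategory.naturality (U := U.eval o) f g h _
    (Part.mem_map (fun k => g ≫ k ≫ h) hk)
  rw [← tensorHom_id, ← tensorHom_id] at this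
  exact this

theorem partialTr_dinaturality (f : (A.tensor U).eval o ⟶ (B.tensor V).eval o)
    (g : V.eval o ⟶ U.eval o) :
    partialTr U (f ≫ tens (𝟙 (B.eval o)) g) = partialTr V (tens (𝟙 (A.eval o)) g ≫ f) := by
  have := PartiallyTracedCategory.dinaturality (U := U.eval o) (U' := V.eval o) f g
  rw [← id_tensorHom, ← id_tensorHom] at this
  exact this

theorem tens_mem_partialTr {f : (A.tensor U).eval o ⟶ (B.tensor U).eval o}
    {k : A.eval o ⟶ B.eval o} (hk : k ∈ partialTr U f) (g : A'.eval o ⟶ B'.eval o) :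
    tens g k ∈ partialTr U ((Rewiring.assoc _ _ _).hom o ≫ tens g f ≫
      (Rewiring.assoc _ _ _).symm.hom o) := by
  rw [Rewiring.hom_assoc, Rewiring.hom_assoc_symm]
  exact PartiallyTracedCategory.strength (U := U.eval o) f g _ (Part.mem_map (fun k => g ⊗ₘ k) hk)

theorem partialTr_unit (f : (A.tensor .unit).eval o ⟶ (B.tensor .unit).eval o) :
    partialTr .unit f =
      Part.some ((Rewiring.rightUnitor _).symm.hom o ≫ f ≫ (Rewiring.rightUnitor _).hom o) := by
  rw [Rewiring.hom_rightUnitor, Rewiring.hom_rightUnitor_symm]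
  exact (PartiallyTracedCategory.vanishing_I (A := A.eval o) (B := B.eval o) f).symm

theorem partialTr_of_mem {f : ((A.tensor U).tensor V).eval o ⟶ ((B.tensor U).tensor V).eval o}
    {k : (A.tensor U).eval o ⟶ (B.tensor U).eval o} (hk : k ∈ partialTr V f) :
    partialTr U k = partialTr (U.tensor V)
      ((Rewiring.assoc _ _ _).symm.hom o ≫ f ≫ (Rewiring.assoc _ _ _).hom o) := by
  rw [Rewiring.hom_assoc, Rewiring.hom_assoc_symm]
  have h := PartiallyTracedCategory.vanishing_II (A := A.eval o) (B := B.eval o) (U := U.eval o)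
    (V := V.eval o) f hk.1
  have hf : PartiallyTracedCategory.tr (U := V.eval o) f = Part.some k := Part.eq_some_iff.2 hk
  exact ((congrArg (Part.bind · _) hf).trans (Part.bind_some _ _)).symm.trans h

theorem partialTr_braid (A : ObjTerm O) :
    partialTr A ((Rewiring.braid A A).hom o) = Part.some (𝟙 (A.eval o)) := by
  rw [Rewiring.hom_braid]
  exact PartiallyTracedCategory.yanking (A.eval o)

theorem mem_partialTr_tens {f : (A.tensor U).eval o ⟶ (B.tensor U).eval o}
    {k : A.eval o ⟶ B.eval o} (hk : k ∈ partialTr U f) (g : A'.eval o ⟶ B'.eval o) :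
    tens k g ∈ partialTr U ((Rewiring.swapRight _ _ _).hom o ≫ tens f g ≫
      (Rewiring.swapRight _ _ _).hom o) := by
  rw [Rewiring.tens_swap k]
  convert comp_mem_partialTr (tens_mem_partialTr hk g) _ _ using 1
  rw [Rewiring.tens_swap g f, Rewiring.tens_hom_id, Rewiring.tens_hom_id]
  simp only [Category.assoc, Rewiring.hom_trans_assoc, ← Rewiring.hom_trans]
  refine congrArg _ (Rewiring.conj_congr ?_ ?_ _) <;> rintro ((_ | _) | _) <;> rfl

end PartialTrace

/-! ### Formal traces -/

/-- A representative `⟨U, f⟩` of the formal trace of `f` over `U`. -/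
abbrev FormalTrace {O : Type w} {C : Type u} [Category.{v} C] [MonoidalCategory C] (o : O → C)
    (A B : ObjTerm O) : Type (max w v) :=
  Σ U : ObjTerm O, (A.tensor U).eval o ⟶ (B.tensor U).eval o

/-- The identifications of formal traces: dinaturality, and vanishing II for an inner trace that is
defined in `C`. -/
inductive FormalTrace.Step {O : Type w} {C : Type u} [Category.{v} C] [MonoidalCategory C]
    [SymmetricCategory C] [PartiallyTracedCategory C] {o : O → C} {A B : ObjTerm O} :
    FormalTrace o A B → FormalTrace o A B → Prop
  | slide {U V : ObjTerm O} (f : (A.tensor U).eval o ⟶ (B.tensor V).eval o)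
      (h : V.eval o ⟶ U.eval o) :
      Step ⟨U, f ≫ tens (𝟙 (B.eval o)) h⟩ ⟨V, tens (𝟙 (A.eval o)) h ≫ f⟩
  | nest {U V : ObjTerm O} {f : ((A.tensor U).tensor V).eval o ⟶ ((B.tensor U).tensor V).eval o}
      {k : (A.tensor U).eval o ⟶ (B.tensor U).eval o} (hk : k ∈ partialTr V f) :
      Step ⟨U, k⟩
        ⟨U.tensor V, (Rewiring.assoc _ _ _).symm.hom o ≫ f ≫ (Rewiring.assoc _ _ _).hom o⟩

/-- The morphisms of the totally traced category into which `C` embeds: formal traces of morphisms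
of `C`, up to `FormalTrace.Step`. -/
def FormalHom {O : Type w} {C : Type u} [Category.{v} C] [MonoidalCategory C]
    [SymmetricCategory C] [PartiallyTracedCategory C] (o : O → C) (A B : ObjTerm O) :
    Type (max w v) :=
  Quot (FormalTrace.Step (o := o) (A := A) (B := B))

section Padding

open Rewiring

variable {O : Type w} {C : Type u} [Category.{v} C] [MonoidalCategory C] [SymmetricCategory C]
  {o : O → C} {A B R R' X : ObjTerm O}

theorem tens_tens_id (f : A.eval o ⟶ B.eval o) :
    tens (tens f (𝟙 (R.eval o))) (𝟙 (R'.eval o)) =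
      (assoc _ _ _).hom o ≫ tens f (𝟙 ((R.tensor R').eval o)) ≫ (assoc _ _ _).symm.hom o := by
  rw [← tens_id, ← Category.assoc, ← tens_comp_assoc_hom, Category.assoc, hom_comp_symm,
    Category.comp_id]

theorem tens_id_comp_hom (f : A.eval o ⟶ B.eval o) (e : Rewiring R R') :
    tens f (𝟙 (R.eval o)) ≫ ((refl B).sum e).hom o =
      ((refl A).sum e).hom o ≫ tens f (𝟙 (R'.eval o)) := by
  rw [← tens_id_hom, ← tens_id_hom, tens_comp, tens_comp, Category.comp_id, Category.id_comp,
    Category.id_comp, Category.comp_id]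

theorem pad_congr (e : Rewiring R R') {f : A.eval o ⟶ B.eval o} {a : Rewiring X (A.tensor R)}
    {a' : Rewiring X (A.tensor R')} {Z : C} {b : (B.tensor R).eval o ⟶ Z}
    {b' : (B.tensor R').eval o ⟶ Z} (ha : ∀ p, a.trans ((refl A).sum e) p = a' p)
    (hb : b = ((refl B).sum e).hom o ≫ b') :
    a.hom o ≫ tens f (𝟙 (R.eval o)) ≫ b = a'.hom o ≫ tens f (𝟙 (R'.eval o)) ≫ b' := by
  rw [hb, ← ext ha, hom_trans, Category.assoc, ← Category.assoc (tens f _), tens_id_comp_hom,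
    Category.assoc]

end Padding

namespace FormalHom

open Rewiring

variable {O : Type w} {C : Type u} [Category.{v} C] [MonoidalCategory C] [SymmetricCategory C]

section Frame

variable {o : O → C} {A B A' B' R U V : ObjTerm O}

/-- The morphism `f`, with the strands `R` beside it, between `a` and `b`. -/
noncomputable def frameHom (a : A'.eval o ⟶ (A.tensor R).eval o)
    (b : (B.tensor R).eval o ⟶ B'.eval o) (f : (A.tensor U).eval o ⟶ (B.tensor V).eval o) :
    (A'.tensor U).eval o ⟶ (B'.tensor V).eval o :=
  tens a (𝟙 (U.eval o)) ≫ (swapRight _ _ _).hom o ≫ tens f (𝟙 (R.eval o)) ≫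
    (swapRight _ _ _).hom o ≫ tens b (𝟙 (V.eval o))

theorem frameHom_comp (a : A'.eval o ⟶ (A.tensor R).eval o)
    (b : (B.tensor R).eval o ⟶ B'.eval o) (f : (A.tensor U).eval o ⟶ (B.tensor V).eval o)
    (h : V.eval o ⟶ U.eval o) :
    frameHom a b (f ≫ tens (𝟙 (B.eval o)) h) = frameHom a b f ≫ tens (𝟙 (B'.eval o)) h := by
  simp only [frameHom, comp_tens_id, Category.assoc]
  rw [← Category.assoc (tens (tens _ h) _), tens_comp_swapRight_hom, Category.assoc, tens_comp,
    tens_comp, tens_id, Category.comp_id, Category.id_comp, Category.id_comp, Category.comp_id]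

theorem frameHom_precomp (a : A'.eval o ⟶ (A.tensor R).eval o)
    (b : (B.tensor R).eval o ⟶ B'.eval o) (f : (A.tensor U).eval o ⟶ (B.tensor V).eval o)
    (h : V.eval o ⟶ U.eval o) :
    frameHom a b (tens (𝟙 (A.eval o)) h ≫ f) = tens (𝟙 (A'.eval o)) h ≫ frameHom a b f := by
  simp only [frameHom, comp_tens_id, Category.assoc]
  rw [← Category.assoc (Rewiring.hom _ _) (tens (tens _ h) _), ← tens_comp_swapRight_hom,
    Category.assoc, tens_comp_assoc, tens_comp_assoc, tens_id, Category.comp_id, Category.id_comp,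
    Category.id_comp, Category.comp_id]

theorem frameHom_mem_partialTr [PartiallyTracedCategory C]
    {f : ((A.tensor U).tensor V).eval o ⟶ ((B.tensor U).tensor V).eval o}
    {k : (A.tensor U).eval o ⟶ (B.tensor U).eval o} (hk : k ∈ partialTr V f)
    (a : A'.eval o ⟶ (A.tensor R).eval o) (b : (B.tensor R).eval o ⟶ B'.eval o) :
    frameHom a b k ∈ partialTr V ((assoc _ _ _).hom o ≫
      frameHom a b ((assoc _ _ _).symm.hom o ≫ f ≫ (assoc _ _ _).hom o) ≫
        (assoc _ _ _).symm.hom o) := by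
  have h := comp_mem_partialTr (mem_partialTr_tens hk (𝟙 (R.eval o)))
    (tens a (𝟙 (U.eval o)) ≫ (swapRight _ _ _).hom o)
    ((swapRight _ _ _).hom o ≫ tens b (𝟙 (U.eval o)))
  convert h using 2
  · simp only [frameHom, comp_tens_id, tens_tens_id, tens_hom_id, Category.assoc, hom_trans_assoc,
      ← hom_trans]
    refine congrArg _ (congrArg _ (hom_comp_congr ?_ (congrArg _ (hom_comp_congr ?_ rfl))))
    · rintro ((_ | _) | (_ | _)) <;> rfl
    · rintro (((_ | _) | _) | _) <;> rfl
  · simp only [frameHom, Category.assoc]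

end Frame

variable [PartiallyTracedCategory C] {o : O → C}
variable {A B D E A' B' D' A'' B'' R R' U V W : ObjTerm O}

/-- The formal trace of `f` over `U`. -/
def mk (U : ObjTerm O) (f : (A.tensor U).eval o ⟶ (B.tensor U).eval o) : FormalHom o A B :=
  Quot.mk _ ⟨U, f⟩

theorem mk_slide (f : (A.tensor U).eval o ⟶ (B.tensor V).eval o) (h : V.eval o ⟶ U.eval o) :
    mk U (f ≫ tens (𝟙 (B.eval o)) h) = mk V (tens (𝟙 (A.eval o)) h ≫ f) :=
  Quot.sound (.slide f h)

theorem mk_nest {f : ((A.tensor U).tensor V).eval o ⟶ ((B.tensor U).tensor V).eval o}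
    {k : (A.tensor U).eval o ⟶ (B.tensor U).eval o} (hk : k ∈ partialTr V f) :
    mk U k = mk (U.tensor V) ((assoc _ _ _).symm.hom o ≫ f ≫ (assoc _ _ _).hom o) :=
  Quot.sound (.nest hk)

theorem mk_rewire (e : Rewiring U V) (f : (A.tensor U).eval o ⟶ (B.tensor U).eval o) :
    mk U f = mk V (((refl A).sum e.symm).hom o ≫ f ≫ ((refl B).sum e).hom o) := by
  rw [← tens_id_hom, ← tens_id_hom, ← mk_slide, Category.assoc, tens_comp, hom_comp_symm,
    Category.comp_id, tens_id, Category.comp_id]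

/-- The morphism of `C`, regarded as a formal trace over the unit. -/
noncomputable def ofHom (f : A.eval o ⟶ B.eval o) : FormalHom o A B :=
  mk .unit ((rightUnitor A).hom o ≫ f ≫ (rightUnitor B).symm.hom o)

/-- The trace that the formal trace stands for, if it is defined in `C`. -/
def value : FormalHom o A B → Part (A.eval o ⟶ B.eval o) :=
  Quot.lift (fun F => partialTr F.1 F.2) (by
    rintro _ _ (⟨f, h⟩ | ⟨hk⟩)
    exacts [partialTr_dinaturality f h, partialTr_of_mem hk])

theorem value_ofHom (f : A.eval o ⟶ B.eval o) : (ofHom f).value = Part.some f := by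
  refine (partialTr_unit _).trans (congrArg _ ?_)
  rw [Category.assoc, Category.assoc, hom_symm_comp, Category.comp_id, ← Category.assoc,
    hom_symm_comp, Category.id_comp]

theorem ofHom_injective : Function.Injective (ofHom : (A.eval o ⟶ B.eval o) → FormalHom o A B) :=
  fun f g h => Part.some_injective ((value_ofHom f).symm.trans ((congrArg value h).trans
    (value_ofHom g)))

/-- The formal trace of a morphism, with the strands `R` beside it, between `a` and `b`. -/
noncomputable def frame (F : FormalHom o A B) (a : A'.eval o ⟶ (A.tensor R).eval o)
    (b : (B.tensor R).eval o ⟶ B'.eval o) : FormalHom o A' B' :=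
  Quot.lift (fun F : FormalTrace o A B => mk F.1 (frameHom a b F.2)) (by
    rintro _ _ (⟨f, h⟩ | ⟨hk⟩)
    · simp only [frameHom_comp, frameHom_precomp, mk_slide]
    · refine (mk_nest (frameHom_mem_partialTr hk a b)).trans (congrArg _ ?_)
      simp only [Category.assoc, hom_symm_comp, Category.comp_id]
      rw [← Category.assoc, hom_symm_comp, Category.id_comp]) F

/-- The trace of formal traces, as in vanishing II. -/
noncomputable def trace (W : ObjTerm O) (F : FormalHom o (A.tensor W) (B.tensor W)) :
    FormalHom o A B :=
  Quot.lift (fun F : FormalTrace o (A.tensor W) (B.tensor W) => mk (W.tensor F.1)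
      ((assoc _ _ _).symm.hom o ≫ F.2 ≫ (assoc _ _ _).hom o)) (by
    rintro _ _ (⟨f, h⟩ | @⟨U, V, f, k, hk⟩)
    · simp only [← tens_id, Category.assoc, tens_comp_assoc_hom]
      rw [← Category.assoc f, ← Category.assoc, tens_id, mk_slide, ← Category.assoc, ← tens_id,
        tens_comp_assoc_symm_hom, Category.assoc]
    · refine (mk_nest (comp_mem_partialTr hk _ _)).trans ?_
      rw [mk_rewire (assoc W U V)]
      simp only [tens_hom_id, Category.assoc, hom_trans_assoc, ← hom_trans]
      refine congrArg _ (conj_congr ?_ ?_ _)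
      · rintro (_ | _ | _ | _) <;> rfl
      · rintro (((_ | _) | _) | _) <;> rfl) F

theorem exists_eq_mk (F : FormalHom o A B) : ∃ U f, F = mk U f := by
  obtain ⟨U, f⟩ := F
  exact ⟨U, f, rfl⟩

theorem mk_eq_trace (f : (A.tensor U).eval o ⟶ (B.tensor U).eval o) :
    mk U f = trace U (ofHom f) := by
  refine (mk_rewire (rightUnitor U).symm f).trans (congrArg _ ?_)
  simp only [Category.assoc, hom_trans_assoc, ← hom_trans]
  refine conj_congr ?_ ?_ _
  · rintro (_ | _ | ⟨⟨⟩⟩) <;> rfl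
  · rintro (_ | _) <;> rfl

theorem frame_ofHom (f : A.eval o ⟶ B.eval o) (a : A'.eval o ⟶ (A.tensor R).eval o)
    (b : (B.tensor R).eval o ⟶ B'.eval o) :
    (ofHom f).frame a b = ofHom (a ≫ tens f (𝟙 (R.eval o)) ≫ b) := by
  refine congrArg (mk _) ?_
  simp only [frameHom, tens_id_unit, comp_tens_id, tens_hom_id, Category.assoc, hom_trans_assoc]
  refine congrArg _ (congrArg _ (hom_comp_eq ?_ (congrArg _ (hom_comp_eq ?_ rfl)))) <;>
    rintro (_ | _) <;> rfl

theorem frame_frame (F : FormalHom o A B) (a : A'.eval o ⟶ (A.tensor R).eval o)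
    (b : (B.tensor R).eval o ⟶ B'.eval o) (a' : A''.eval o ⟶ (A'.tensor R').eval o)
    (b' : (B'.tensor R').eval o ⟶ B''.eval o) :
    (F.frame a b).frame a' b' =
      F.frame (a' ≫ tens a (𝟙 (R'.eval o)) ≫ (assoc _ _ _).hom o)
        ((assoc _ _ _).symm.hom o ≫ tens b (𝟙 (R'.eval o)) ≫ b') := by
  obtain ⟨U, f, rfl⟩ := F.exists_eq_mk
  refine congrArg (mk U) ?_
  simp only [frameHom, comp_tens_id, tens_tens_id, tens_hom_id, Category.assoc, hom_trans_assoc]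
  refine congrArg _ (pad_congr (braid U R') ?_ ?_)
  · rintro ((_ | _) | _) <;> rfl
  simp only [hom_trans_assoc]
  refine hom_comp_congr ?_ (congrArg _ ?_)
  · rintro ((_ | _) | (_ | _)) <;> rfl
  refine (pad_congr (braid U R') ?_ ?_)
  · rintro ((_ | _) | (_ | _)) <;> rfl
  simp only [hom_trans_assoc]
  refine hom_comp_congr ?_ rfl
  rintro (_ | (_ | _)) <;> rfl

theorem frame_congr (F : FormalHom o A B) (a : A'.eval o ⟶ (A.tensor R).eval o)
    (r : R.eval o ⟶ R'.eval o) (b : (B.tensor R').eval o ⟶ B'.eval o) :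
    F.frame (a ≫ tens (𝟙 (A.eval o)) r) b = F.frame a (tens (𝟙 (B.eval o)) r ≫ b) := by
  obtain ⟨U, f, rfl⟩ := F.exists_eq_mk
  refine congrArg (mk U) ?_
  simp only [frameHom, comp_tens_id, Category.assoc]
  refine congrArg _ ?_
  rw [← Category.assoc (Rewiring.hom _ _) (tens (tens _ r) _), ← tens_comp_swapRight_hom,
    ← Category.assoc, tens_comp_swapRight_hom, Category.assoc, Category.assoc, tens_comp_assoc,
    tens_comp_assoc, tens_id, tens_id, Category.id_comp, Category.id_comp, Category.comp_id,
    Category.comp_id]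

theorem frame_rightUnitor (F : FormalHom o A B) :
    F.frame ((rightUnitor A).symm.hom o) ((rightUnitor B).hom o) = F := by
  obtain ⟨U, f, rfl⟩ := F.exists_eq_mk
  refine congrArg (mk U) ?_
  simp only [frameHom, tens_id_unit, tens_hom_id, Category.assoc, hom_trans_assoc, ← hom_trans]
  refine hom_comp_eq ?_ ((congrArg _ (hom_eq_id ?_)).trans (Category.comp_id f)) <;>
    rintro (_ | _) <;> rfl

theorem trace_frame (F : FormalHom o (A.tensor W) (B.tensor W))
    (a : A'.eval o ⟶ (A.tensor R).eval o) (b : (B.tensor R).eval o ⟶ B'.eval o) :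
    (F.trace W).frame a b =
      (F.frame (tens a (𝟙 (W.eval o)) ≫ (swapRight _ _ _).hom o)
        ((swapRight _ _ _).hom o ≫ tens b (𝟙 (W.eval o)))).trace W := by
  obtain ⟨U, f, rfl⟩ := F.exists_eq_mk
  refine congrArg (mk (W.tensor U)) ?_
  simp only [frameHom, comp_tens_id, tens_tens_id, tens_hom_id, Category.assoc, hom_trans_assoc,
    ← hom_trans, symm_trans_self, hom_refl, Category.id_comp, Category.comp_id]
  refine congrArg _ (hom_comp_congr ?_ (congrArg _ (hom_comp_congr ?_ rfl)))
  · rintro ((_ | _) | (_ | _)) <;> rfl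
  · rintro (((_ | _) | _) | _) <;> rfl

theorem trace_slide (F : FormalHom o A B)
    (a : (A'.tensor U).eval o ⟶ (A.tensor R).eval o)
    (b : (B.tensor R).eval o ⟶ (B'.tensor V).eval o) (h : V.eval o ⟶ U.eval o) :
    (F.frame a (b ≫ tens (𝟙 (B'.eval o)) h)).trace U =
      (F.frame (tens (𝟙 (A'.eval o)) h ≫ a) b).trace V := by
  obtain ⟨W, f, rfl⟩ := F.exists_eq_mk
  have slide := mk_slide ((assoc A' U W).symm.hom o ≫ frameHom a b f ≫ (assoc B' V W).hom o)
    (tens h (𝟙 (W.eval o)))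
  simp only [frameHom, Category.assoc, ← tens_comp_assoc_hom] at slide
  rw [← Category.assoc (tens _ (tens h _)), tens_comp_assoc_symm_hom] at slide
  refine Eq.trans (congrArg (mk _) ?_) (slide.trans (congrArg (mk _) ?_)) <;>
    simp only [frameHom, comp_tens_id, Category.assoc]

theorem trace_trace (F : FormalHom o A B)
    (a : ((A'.tensor U).tensor V).eval o ⟶ (A.tensor R).eval o)
    (b : (B.tensor R).eval o ⟶ ((B'.tensor U).tensor V).eval o) :
    ((F.frame a b).trace V).trace U = (F.frame ((assoc _ _ _).symm.hom o ≫ a)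
      (b ≫ (assoc _ _ _).hom o)).trace (U.tensor V) := by
  obtain ⟨W, f, rfl⟩ := F.exists_eq_mk
  refine (mk_rewire (assoc U V W).symm _).trans (congrArg (mk _) ?_)
  simp only [frameHom, comp_tens_id, tens_hom_id, Category.assoc, hom_trans_assoc, ← hom_trans]
  refine hom_comp_congr ?_ (congrArg _ (congrArg _ (congrArg _ (congrArg _ (congrArg _
    (congrArg (Rewiring.hom o) (ext ?_)))))))
  · rintro (_ | ((_ | _) | _)) <;> rfl
  · rintro (((_ | _) | _) | _) <;> rfl

theorem trace_ofHom {f : (A.tensor U).eval o ⟶ (B.tensor U).eval o} {k : A.eval o ⟶ B.eval o}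
    (hk : k ∈ partialTr U f) : trace U (ofHom f) = ofHom k := by
  have mem := comp_mem_partialTr hk ((rightUnitor A).hom o) ((rightUnitor B).symm.hom o)
  refine (mk_eq_trace f).symm.trans ((mk_rewire (leftUnitor U).symm f).trans
    (Eq.trans (congrArg _ ?_) (mk_nest mem).symm))
  simp only [tens_hom_id, Category.assoc, hom_trans_assoc, ← hom_trans]
  refine conj_congr ?_ ?_ f
  · rintro (_ | ⟨⟨⟩⟩ | _) <;> rfl
  · rintro (_ | _) <;> rfl

theorem trace_unit (F : FormalHom o A B) (a : (A'.tensor .unit).eval o ⟶ (A.tensor R).eval o)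
    (b : (B.tensor R).eval o ⟶ (B'.tensor .unit).eval o) :
    trace .unit (F.frame a b) =
      F.frame ((rightUnitor A').symm.hom o ≫ a) (b ≫ (rightUnitor B').hom o) := by
  obtain ⟨U, f, rfl⟩ := F.exists_eq_mk
  refine (mk_rewire (leftUnitor U) _).trans (congrArg (mk U) ?_)
  simp only [frameHom, comp_tens_id, tens_hom_id, Category.assoc, hom_trans_assoc, ← hom_trans]
  refine hom_comp_congr ?_ (congrArg _ (congrArg _ (congrArg _ (congrArg _ (congrArg _
    (congrArg (Rewiring.hom o) (ext ?_)))))))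
  · rintro (_ | _) <;> rfl
  · rintro ((_ | ⟨⟨⟩⟩) | _) <;> rfl

theorem frame_of_mem (F : FormalHom o A B) {a : A'.eval o ⟶ (A.tensor R).eval o}
    {f : ((B.tensor R).tensor V).eval o ⟶ (B'.tensor V).eval o}
    {k : (B.tensor R).eval o ⟶ B'.eval o} (hk : k ∈ partialTr V f) :
    F.frame a k = trace V (F.frame (tens a (𝟙 (V.eval o)) ≫ (assoc _ _ _).hom o)
      ((assoc _ _ _).symm.hom o ≫ f)) := by
  obtain ⟨U, g, rfl⟩ := F.exists_eq_mk
  have mem := comp_mem_partialTr (mem_partialTr_tens hk (𝟙 (U.eval o)))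
    (tens a (𝟙 (U.eval o)) ≫ (swapRight _ _ _).hom o ≫ tens g (𝟙 (R.eval o)) ≫
      (swapRight _ _ _).hom o) (𝟙 _)
  simp only [Category.comp_id, Category.assoc] at mem
  refine (mk_nest mem).trans ((mk_rewire (braid U V) _).trans (congrArg (mk _) ?_))
  simp only [frameHom, comp_tens_id, tens_tens_id, tens_hom_id, tens_id, Category.comp_id,
    Category.assoc, hom_trans_assoc, ← hom_trans]
  refine pad_congr (braid U V) ?_ ?_
  · rintro (_ | (_ | _)) <;> rfl
  simp only [hom_trans_assoc]
  refine hom_comp_congr ?_ (congrArg _ (hom_comp_congr ?_ (congrArg _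
    (congrArg (Rewiring.hom o) (ext ?_)))))
  · rintro ((_ | _) | (_ | _)) <;> rfl
  · rintro ((_ | _) | (_ | _)) <;> rfl
  · rintro ((_ | _) | _) <;> rfl

theorem trace_comm (F : FormalHom o A B)
    (a : ((A'.tensor U).tensor V).eval o ⟶ (A.tensor R).eval o)
    (b : (B.tensor R).eval o ⟶ ((B'.tensor U).tensor V).eval o) :
    ((F.frame a b).trace V).trace U = ((F.frame ((swapRight _ _ _).hom o ≫ a)
      (b ≫ (swapRight _ _ _).hom o)).trace U).trace V := by
  have slide := F.trace_slide ((assoc A' U V).symm.hom o ≫ a)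
    (b ≫ (swapRight _ _ _).hom o ≫ (assoc _ _ _).hom o) ((braid V U).hom o)
  simp only [tens_id_hom, Category.assoc, hom_trans_assoc, ← hom_trans] at slide
  rw [trace_trace, trace_trace]
  simp only [Category.assoc, hom_trans_assoc, ← hom_trans]
  convert slide using 2
  · refine congrArg _ (congrArg _ (congrArg (Rewiring.hom o) (ext ?_)))
    rintro ((_ | _) | _) <;> rfl
  · refine congrArg (F.frame · _) (hom_comp_congr ?_ rfl)
    rintro (_ | (_ | _)) <;> rfl

theorem frame_hom_congr (F : FormalHom o A B) (e : Rewiring R R') {a : Rewiring A' (A.tensor R)}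
    {a' : Rewiring A' (A.tensor R')} {b : (B.tensor R).eval o ⟶ B'.eval o}
    {b' : (B.tensor R').eval o ⟶ B'.eval o} (ha : ∀ p, a.trans ((refl A).sum e) p = a' p)
    (hb : b = ((refl B).sum e).hom o ≫ b') :
    F.frame (a.hom o) b = F.frame (a'.hom o) b' := by
  rw [← ext ha, hom_trans, ← tens_id_hom, frame_congr, tens_id_hom, hb]

/-- Composition of formal traces: the trace of the second factor is pulled out. -/
noncomputable def comp (F : FormalHom o A B) (G : FormalHom o B D) : FormalHom o A D :=
  Quot.lift (fun G : FormalTrace o B D => trace G.1 (F.frame (𝟙 ((A.tensor G.1).eval o)) G.2)) (by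
    rintro _ _ (⟨g, h⟩ | ⟨hk⟩)
    · simp only [trace_slide]
      rw [Category.comp_id, ← frame_congr, Category.id_comp]
    · simp only [F.frame_of_mem hk, trace_trace, tens_id, Category.id_comp, hom_symm_comp,
        Category.assoc]) G

theorem comp_mk (F : FormalHom o A B) (g : (B.tensor V).eval o ⟶ (D.tensor V).eval o) :
    F.comp (mk V g) = trace V (F.frame (𝟙 ((A.tensor V).eval o)) g) := rfl

theorem ofHom_comp_frame (f : D.eval o ⟶ A'.eval o) (G : FormalHom o A B)
    (a : A'.eval o ⟶ (A.tensor R).eval o) (b : (B.tensor R).eval o ⟶ B'.eval o) :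
    (ofHom f).comp (G.frame a b) = G.frame (f ≫ a) b := by
  obtain ⟨V, g, rfl⟩ := G.exists_eq_mk
  refine (comp_mk (ofHom f) (frameHom a b g)).trans ?_
  rw [frame_ofHom, ← mk_eq_trace, Category.id_comp]
  refine congrArg (mk V) ?_
  simp only [frameHom, comp_tens_id, Category.assoc]

theorem frame_comp_ofHom (F : FormalHom o A B) (a : A'.eval o ⟶ (A.tensor R).eval o)
    (b : (B.tensor R).eval o ⟶ B'.eval o) (g : B'.eval o ⟶ D.eval o) :
    (F.frame a b).comp (ofHom g) = F.frame a (b ≫ g) := by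
  refine (comp_mk _ _).trans ?_
  have right_wire : (rightUnitor (A.tensor R)).symm.trans (assoc A R .unit) =
      (refl A).sum (rightUnitor R).symm := ext (by rintro (_ | _) <;> rfl)
  have left_wire : ((refl B).sum (rightUnitor R).symm).trans ((assoc B R .unit).symm.trans
      (rightUnitor (B.tensor R))) = refl _ := ext (by rintro (_ | _) <;> rfl)
  rw [trace_unit, frame_frame, tens_id_unit, tens_id_unit]
  simp only [Category.assoc, Category.id_comp, hom_trans_assoc, symm_trans_self, hom_refl,
    Category.comp_id, ← hom_trans, right_wire]
  rw [← tens_id_hom, frame_congr, tens_id_hom]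
  simp only [hom_trans_assoc, left_wire, hom_refl, Category.id_comp]

theorem ofHom_comp_ofHom (f : A.eval o ⟶ B.eval o) (g : B.eval o ⟶ D.eval o) :
    (ofHom f).comp (ofHom g) = ofHom (f ≫ g) := by
  refine (comp_mk (ofHom f) _).trans ?_
  rw [frame_ofHom, Category.id_comp, ← mk_eq_trace, tens_id_unit]
  refine congrArg (mk _) ?_
  simp only [Category.assoc]
  rw [← Category.assoc (Rewiring.hom o (rightUnitor B).symm), hom_symm_comp, Category.id_comp]

theorem id_comp (F : FormalHom o A B) : (ofHom (𝟙 (A.eval o))).comp F = F := by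
  rw [← F.frame_rightUnitor, ofHom_comp_frame, Category.id_comp]

theorem comp_id (F : FormalHom o A B) : F.comp (ofHom (𝟙 (B.eval o))) = F := by
  rw [← F.frame_rightUnitor, frame_comp_ofHom, Category.comp_id]

theorem frame_comp_frame (F : FormalHom o A B) (G : FormalHom o B D)
    (a : A'.eval o ⟶ (A.tensor R).eval o) (b : (D.tensor R).eval o ⟶ D'.eval o) :
    (F.frame a (𝟙 _)).comp (G.frame (𝟙 _) b) = (F.comp G).frame a b := by
  obtain ⟨V, g, rfl⟩ := G.exists_eq_mk
  refine (comp_mk _ (frameHom (𝟙 _) b g)).trans ?_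
  rw [comp_mk, trace_frame, frame_frame, frame_frame]
  simp only [frameHom, tens_id, Category.id_comp, Category.assoc, hom_trans_assoc, ← hom_trans]
  rw [← ofHom_comp_frame, ← ofHom_comp_frame]
  refine congrArg _ (congrArg _ (frame_hom_congr F (braid R V) ?_ ?_))
  · rintro ((_ | _) | _) <;> rfl
  rw [hom_trans_assoc]
  refine hom_comp_congr ?_ rfl
  rintro (_ | (_ | _)) <;> rfl

/-- The formal trace with the strands `R` on its right. -/
noncomputable def whiskerRight (F : FormalHom o A B) (R : ObjTerm O) :
    FormalHom o (A.tensor R) (B.tensor R) :=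
  F.frame (𝟙 _) (𝟙 _)

/-- The formal trace with the strands `R` on its left. -/
noncomputable def whiskerLeft (R : ObjTerm O) (F : FormalHom o A B) :
    FormalHom o (R.tensor A) (R.tensor B) :=
  F.frame ((braid R A).hom o) ((braid B R).hom o)

theorem comp_trace (F : FormalHom o A B) (G : FormalHom o (B.tensor W) (D.tensor W)) :
    F.comp (G.trace W) = ((F.whiskerRight W).comp G).trace W := by
  obtain ⟨V, g, rfl⟩ := G.exists_eq_mk
  refine (comp_mk F _).trans ?_
  rw [comp_mk, whiskerRight, frame_frame, trace_trace]
  simp only [tens_id, Category.id_comp, Category.assoc, hom_symm_comp]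

theorem trace_comp (F : FormalHom o (A.tensor W) (B.tensor W)) (G : FormalHom o B D) :
    (F.trace W).comp G = (F.comp (G.whiskerRight W)).trace W := by
  obtain ⟨V, g, rfl⟩ := G.exists_eq_mk
  refine Eq.trans ?_ (congrArg _ (comp_mk F (frameHom (𝟙 _) (𝟙 _) g)).symm)
  have swap_swap : (swapRight A W V).trans (swapRight A V W) = refl _ :=
    ext (by rintro ((_ | _) | _) <;> rfl)
  rw [comp_mk, trace_frame, trace_comm]
  simp only [frameHom, tens_id, Category.id_comp, Category.comp_id, Category.assoc, ← hom_trans,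
    swap_swap, hom_refl]

theorem comp_assoc (F : FormalHom o A B) (G : FormalHom o B D) (H : FormalHom o D E) :
    (F.comp G).comp H = F.comp (G.comp H) := by
  obtain ⟨W, h, rfl⟩ := H.exists_eq_mk
  rw [comp_mk, comp_mk, comp_trace, whiskerRight, frame_comp_frame]

theorem comp_whiskerRight (F : FormalHom o A B) (G : FormalHom o B D) (R : ObjTerm O) :
    (F.comp G).whiskerRight R = (F.whiskerRight R).comp (G.whiskerRight R) :=
  (frame_comp_frame F G _ _).symm

theorem whiskerLeft_comp (R : ObjTerm O) (F : FormalHom o A B) (G : FormalHom o B D) :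
    (F.comp G).whiskerLeft R = (F.whiskerLeft R).comp (G.whiskerLeft R) := by
  have braid_braid : (braid B R).trans (braid R B) = refl _ := ext (by rintro (_ | _) <;> rfl)
  have split : F.whiskerLeft R = (F.frame ((braid R A).hom o) (𝟙 _)).comp
      (ofHom ((braid B R).hom o)) := by rw [frame_comp_ofHom, Category.id_comp, whiskerLeft]
  rw [split, comp_assoc, whiskerLeft, whiskerLeft, ofHom_comp_frame, ← hom_trans, braid_braid,
    hom_refl, frame_comp_frame]

theorem ofHom_whiskerRight (f : A.eval o ⟶ B.eval o) :
    (ofHom f).whiskerRight R = ofHom (tens f (𝟙 (R.eval o))) := by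
  rw [whiskerRight, frame_ofHom, Category.id_comp, Category.comp_id]

theorem whiskerLeft_ofHom (f : A.eval o ⟶ B.eval o) :
    (ofHom f).whiskerLeft R = ofHom (tens (𝟙 (R.eval o)) f) := by
  rw [whiskerLeft, frame_ofHom, tens_swap (𝟙 _) f]

theorem whiskerRight_comp_assoc (F : FormalHom o A B) (X Y : ObjTerm O) :
    ((F.whiskerRight X).whiskerRight Y).comp (ofHom ((assoc B X Y).hom o)) =
      (ofHom ((assoc A X Y).hom o)).comp (F.whiskerRight (X.tensor Y)) := by
  rw [whiskerRight, whiskerRight, whiskerRight, frame_frame, frame_comp_ofHom, ofHom_comp_frame]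
  simp only [tens_id, Category.id_comp, Category.comp_id, hom_symm_comp]

theorem whiskerLeft_whiskerRight_comp_assoc (X : ObjTerm O) (F : FormalHom o A B) (Y : ObjTerm O) :
    ((F.whiskerLeft X).whiskerRight Y).comp (ofHom ((assoc X B Y).hom o)) =
      (ofHom ((assoc X A Y).hom o)).comp ((F.whiskerRight Y).whiskerLeft X) := by
  rw [whiskerLeft, whiskerLeft, whiskerRight, whiskerRight, frame_frame, frame_frame,
    frame_comp_ofHom, ofHom_comp_frame]
  simp only [tens_id, Category.id_comp, Category.assoc, hom_trans_assoc, tens_hom_id, ← hom_trans]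
  refine frame_hom_congr F (braid X Y) ?_ (Eq.trans (congrArg _ (ext ?_)) (hom_trans o _ _))
  · rintro ((_ | _) | _) <;> rfl
  · rintro (_ | (_ | _)) <;> rfl

theorem whiskerLeft_comp_assoc (X Y : ObjTerm O) (F : FormalHom o A B) :
    (F.whiskerLeft (X.tensor Y)).comp (ofHom ((assoc X Y B).hom o)) =
      (ofHom ((assoc X Y A).hom o)).comp ((F.whiskerLeft Y).whiskerLeft X) := by
  rw [whiskerLeft, whiskerLeft, whiskerLeft, frame_frame, frame_comp_ofHom, ofHom_comp_frame]
  simp only [tens_hom_id, ← hom_trans]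
  refine frame_hom_congr F (braid X Y) ?_ (Eq.trans (congrArg _ (ext ?_)) (hom_trans o _ _))
  · rintro ((_ | _) | _) <;> rfl
  · rintro (_ | (_ | _)) <;> rfl

theorem whiskerLeft_trace (R : ObjTerm O) (F : FormalHom o (A.tensor U) (B.tensor U)) :
    (F.trace U).whiskerLeft R = ((ofHom ((assoc R A U).hom o)).comp ((F.whiskerLeft R).comp
      (ofHom ((assoc R B U).symm.hom o)))).trace U := by
  rw [whiskerLeft, whiskerLeft, trace_frame, frame_comp_ofHom, ofHom_comp_frame]
  simp only [tens_hom_id, ← hom_trans]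
  refine congrArg _ (congrArg₂ F.frame (congrArg _ (ext ?_)) (congrArg _ (ext ?_)))
  · rintro ((_ | _) | _) <;> rfl
  · rintro ((_ | _) | _) <;> rfl

theorem whiskerLeft_mk (R : ObjTerm O) (f : (A.tensor U).eval o ⟶ (B.tensor U).eval o) :
    (mk U f).whiskerLeft R = (ofHom ((assoc R A U).hom o ≫ tens (𝟙 (R.eval o)) f ≫
      (assoc R B U).symm.hom o)).trace U := by
  rw [mk_eq_trace, whiskerLeft_trace, whiskerLeft_ofHom, ofHom_comp_ofHom, ofHom_comp_ofHom]

theorem whisker_exchange (F : FormalHom o A B) (G : FormalHom o A' B') :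
    (F.whiskerRight A').comp (G.whiskerLeft B) = (G.whiskerLeft A).comp (F.whiskerRight B') := by
  obtain ⟨V, g, rfl⟩ := G.exists_eq_mk
  rw [whiskerLeft_mk, whiskerLeft_mk, comp_trace, trace_comp, whiskerRight, whiskerRight,
    whiskerRight, whiskerRight, frame_frame, frame_frame, frame_comp_ofHom, ofHom_comp_frame]
  simp only [tens_id, Category.id_comp, Category.comp_id, Category.assoc, hom_symm_comp]
  rw [hom_trans_assoc, symm_trans_self, hom_refl, Category.id_comp, ← frame_congr]

theorem whiskerLeft_comp_leftUnitor (F : FormalHom o A B) :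
    (F.whiskerLeft .unit).comp (ofHom ((leftUnitor B).hom o)) =
      (ofHom ((leftUnitor A).hom o)).comp F := by
  rw [← F.frame_rightUnitor, ofHom_comp_frame, frame_rightUnitor, whiskerLeft, frame_comp_ofHom,
    ← hom_trans, ← hom_trans]
  refine congrArg₂ F.frame (congrArg _ (ext ?_)) (congrArg _ (ext ?_))
  · rintro (⟨⟨⟩⟩ | _); rfl
  · rintro (_ | ⟨⟨⟩⟩); rfl

theorem whiskerRight_comp_rightUnitor (F : FormalHom o A B) :
    (F.whiskerRight .unit).comp (ofHom ((rightUnitor B).hom o)) =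
      (ofHom ((rightUnitor A).hom o)).comp F := by
  conv_rhs => rw [← F.frame_rightUnitor, ofHom_comp_frame, hom_comp_symm]
  rw [whiskerRight, frame_comp_ofHom, Category.id_comp]

theorem whiskerRight_comp_braid (F : FormalHom o A B) (R : ObjTerm O) :
    (F.whiskerRight R).comp (ofHom ((braid B R).hom o)) =
      (ofHom ((braid A R).hom o)).comp (F.whiskerLeft R) := by
  have braid_braid : (braid A R).trans (braid R A) = refl _ := ext (by rintro (_ | _) <;> rfl)
  rw [whiskerRight, whiskerLeft, frame_comp_ofHom, ofHom_comp_frame, ← hom_trans, braid_braid,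
    hom_refl, Category.id_comp]

theorem whiskerLeft_comp_braid (R : ObjTerm O) (F : FormalHom o A B) :
    (F.whiskerLeft R).comp (ofHom ((braid R B).hom o)) =
      (ofHom ((braid R A).hom o)).comp (F.whiskerRight R) := by
  have braid_braid : (braid B R).trans (braid R B) = refl _ := ext (by rintro (_ | _) <;> rfl)
  rw [whiskerRight, whiskerLeft, frame_comp_ofHom, ofHom_comp_frame, ← hom_trans, braid_braid,
    hom_refl, Category.comp_id]

theorem trace_dinaturality (F : FormalHom o (A.tensor U) (B.tensor V)) (G : FormalHom o V U) :
    (F.comp (G.whiskerLeft B)).trace U = ((G.whiskerLeft A).comp F).trace V := by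
  obtain ⟨W, g, rfl⟩ := G.exists_eq_mk
  rw [whiskerLeft_mk, whiskerLeft_mk, comp_trace, trace_comp, whiskerRight, frame_comp_ofHom,
    ofHom_comp_frame, trace_trace, trace_trace]
  simp only [Category.id_comp, Category.comp_id, Category.assoc, hom_symm_comp]
  rw [trace_slide, hom_trans_assoc, symm_trans_self, hom_refl, Category.id_comp]

/-- The tensor product of formal traces. -/
noncomputable def tensor (F : FormalHom o A B) (G : FormalHom o A' B') :
    FormalHom o (A.tensor A') (B.tensor B') :=
  (F.whiskerRight A').comp (G.whiskerLeft B)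

theorem tensor_trace (G : FormalHom o X Y) (F : FormalHom o (A.tensor U) (B.tensor U)) :
    G.tensor (F.trace U) = ((ofHom ((assoc X A U).hom o)).comp ((G.tensor F).comp
      (ofHom ((assoc Y B U).symm.hom o)))).trace U := by
  rw [tensor, whiskerLeft_trace, comp_trace, ← comp_assoc, whiskerRight_comp_assoc, tensor,
    comp_assoc, comp_assoc]

theorem trace_unit_eq (F : FormalHom o (A.tensor .unit) (B.tensor .unit)) :
    F.trace .unit = (ofHom ((rightUnitor A).symm.hom o)).comp
      (F.comp (ofHom ((rightUnitor B).hom o))) := by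
  rw [← F.frame_rightUnitor, trace_unit, frame_comp_ofHom, ofHom_comp_frame]

theorem trace_trace_eq (F : FormalHom o ((A.tensor U).tensor V) ((B.tensor U).tensor V)) :
    (F.trace V).trace U = ((ofHom ((assoc A U V).symm.hom o)).comp
      (F.comp (ofHom ((assoc B U V).hom o)))).trace (U.tensor V) := by
  rw [← F.frame_rightUnitor, trace_trace, frame_comp_ofHom, ofHom_comp_frame]

theorem trace_braid (A : ObjTerm O) :
    trace A (ofHom ((braid A A).hom o)) = ofHom (𝟙 (A.eval o)) :=
  trace_ofHom (Part.eq_some_iff.1 (partialTr_braid A))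

theorem tensor_comp (F : FormalHom o A B) (G : FormalHom o B D) (F' : FormalHom o A' B')
    (G' : FormalHom o B' D') :
    (F.tensor F').comp (G.tensor G') = (F.comp G).tensor (F'.comp G') := by
  rw [tensor, tensor, tensor, comp_whiskerRight, whiskerLeft_comp, comp_assoc, comp_assoc,
    ← comp_assoc _ _ (G'.whiskerLeft D), ← whisker_exchange, comp_assoc]

theorem ofHom_tensor_ofHom (f : A.eval o ⟶ B.eval o) (g : A'.eval o ⟶ B'.eval o) :
    (ofHom f).tensor (ofHom g) = ofHom (tens f g) := by
  rw [tensor, ofHom_whiskerRight, whiskerLeft_ofHom, ofHom_comp_ofHom, tens_comp, Category.id_comp,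
    Category.comp_id]

theorem whiskerRight_id (A R : ObjTerm O) :
    (ofHom (𝟙 (A.eval o))).whiskerRight R = ofHom (𝟙 ((A.tensor R).eval o)) := by
  rw [ofHom_whiskerRight, tens_id]

theorem whiskerLeft_id (R A : ObjTerm O) :
    (ofHom (𝟙 (A.eval o))).whiskerLeft R = ofHom (𝟙 ((R.tensor A).eval o)) := by
  rw [whiskerLeft_ofHom, tens_id]

theorem tensor_id (F : FormalHom o A B) (R : ObjTerm O) :
    F.tensor (ofHom (𝟙 (R.eval o))) = F.whiskerRight R := by
  rw [tensor, whiskerLeft_id, comp_id]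

theorem id_tensor (R : ObjTerm O) (F : FormalHom o A B) :
    (ofHom (𝟙 (R.eval o))).tensor F = F.whiskerLeft R := by
  rw [tensor, whiskerRight_id, id_comp]

theorem tensor_comp_assoc (F : FormalHom o A B) (G : FormalHom o A' B') (H : FormalHom o D D') :
    ((F.tensor G).tensor H).comp (ofHom ((assoc B B' D').hom o)) =
      (ofHom ((assoc A A' D).hom o)).comp (F.tensor (G.tensor H)) := by
  rw [tensor, tensor, tensor, tensor, comp_whiskerRight, whiskerLeft_comp, comp_assoc,
    whiskerLeft_comp_assoc, ← comp_assoc _ (ofHom _), comp_assoc _ _ (ofHom _),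
    whiskerLeft_whiskerRight_comp_assoc, ← comp_assoc _ (ofHom _), whiskerRight_comp_assoc,
    comp_assoc, comp_assoc]

theorem tensor_comp_braid (F : FormalHom o A B) (G : FormalHom o A' B') :
    (F.tensor G).comp (ofHom ((braid B B').hom o)) =
      (ofHom ((braid A A').hom o)).comp (G.tensor F) := by
  rw [tensor, tensor, comp_assoc, whiskerLeft_comp_braid, ← comp_assoc, whiskerRight_comp_braid,
    comp_assoc, ← whisker_exchange]

end FormalHom

namespace TraceTerm

open FormalHom Rewiring

variable {S : TraceSignature.{w}} {C : Type u} [Category.{v} C] [MonoidalCategory C]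
  [SymmetricCategory C] [PartiallyTracedCategory C] {A B : ObjTerm S.Obj}

/-- The value of a term as a formal trace. Unlike `TraceTerm.peval` it is always defined. -/
noncomputable def formalValue (x : TraceValuation C S) :
    {A B : ObjTerm S.Obj} → TraceTerm S A B → FormalHom x.obj A B
  | _, _, .var m => ofHom (x.mor m)
  | _, _, .id A => ofHom (𝟙 (A.eval x.obj))
  | _, _, .comp f g => (f.formalValue x).comp (g.formalValue x)
  | _, _, .tensor f g => (f.formalValue x).tensor (g.formalValue x)
  | _, _, .assoc A B C => ofHom ((Rewiring.assoc A B C).hom x.obj)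
  | _, _, .assocInv A B C => ofHom ((Rewiring.assoc A B C).symm.hom x.obj)
  | _, _, .leftUnitor A => ofHom ((Rewiring.leftUnitor A).hom x.obj)
  | _, _, .leftUnitorInv A => ofHom ((Rewiring.leftUnitor A).symm.hom x.obj)
  | _, _, .rightUnitor A => ofHom ((Rewiring.rightUnitor A).hom x.obj)
  | _, _, .rightUnitorInv A => ofHom ((Rewiring.rightUnitor A).symm.hom x.obj)
  | _, _, .symm A B => ofHom ((Rewiring.braid A B).hom x.obj)
  | _, _, .trace f => FormalHom.trace _ (f.formalValue x)

theorem formalValue_of_mem_peval (x : TraceValuation C S) (t : TraceTerm S A B)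
    {f : A.eval x.obj ⟶ B.eval x.obj} (hf : f ∈ t.peval x) : t.formalValue x = ofHom f := by
  induction t with
  | comp s t ihs iht =>
    obtain ⟨a, ha, hf⟩ := Part.mem_bind_iff.1 hf
    obtain ⟨b, hb, rfl⟩ := (Part.mem_map_iff _).1 hf
    rw [formalValue, ihs ha, iht hb, ofHom_comp_ofHom]
  | tensor s t ihs iht =>
    obtain ⟨a, ha, hf⟩ := Part.mem_bind_iff.1 hf
    obtain ⟨b, hb, rfl⟩ := (Part.mem_map_iff _).1 hf
    rw [formalValue, ihs ha, iht hb, ofHom_tensor_ofHom]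
    rfl
  | trace t iht =>
    obtain ⟨a, ha, hf⟩ := Part.mem_bind_iff.1 hf
    rw [formalValue, iht ha]
    exact trace_ofHom hf
  | _ =>
    obtain rfl := Part.mem_some_iff.1 hf
    simp only [formalValue, hom_assoc, hom_assoc_symm, hom_leftUnitor, hom_leftUnitor_symm,
      hom_rightUnitor, hom_rightUnitor_symm, hom_braid]

end TraceTerm

/-! ### The category of terms -/

theorem TracedCategory.tr_comp_eq_comp_tr {C : Type u} [Category.{v} C] [MonoidalCategory C]
    [SymmetricCategory C] [TracedCategory C] {A A' B B' U U' : C} {f : A ⊗ U ⟶ B ⊗ U}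
    {g : A' ⊗ U' ⟶ B' ⊗ U'} {a : A ⟶ A'} {b : B ⟶ B'} (i : U ≅ U')
    (h : f ≫ (b ⊗ₘ i.hom) = (a ⊗ₘ i.hom) ≫ g) : tr f ≫ b = a ≫ tr g := by
  have hf : tr f ≫ b = tr (f ≫ (b ▷ U)) := by simpa using naturality f (𝟙 A) b
  have hg : a ≫ tr g = tr ((a ▷ U') ≫ g) := by simpa using naturality g a (𝟙 B')
  have conj : (a ▷ U') ≫ g = (A ◁ i.inv) ≫ (f ≫ (b ▷ U)) ≫ (B' ◁ i.hom) := by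
    rw [Category.assoc, ← MonoidalCategory.tensorHom_def, h, MonoidalCategory.tensorHom_def',
      Category.assoc, whiskerLeft_inv_hom_assoc]
  rw [hf, hg, conj, ← dinaturality, Category.assoc, whiskerLeft_hom_inv, Category.comp_id]

noncomputable section

/-- The relation of having the same formal value. -/
def TraceTerm.formalValueSetoid {S : TraceSignature.{w}} {C : Type u} [Category.{v} C]
    [MonoidalCategory C] [SymmetricCategory C] [PartiallyTracedCategory C]
    (x : TraceValuation C S) (A B : ObjTerm S.Obj) : Setoid (TraceTerm S A B) :=
  Setoid.ker fun t => t.formalValue x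

/-- The objects of the category of terms under the assignment `x`: its morphisms are the terms up
to equality of formal values. The parameter `L` serves only to fix the universe of the morphisms. -/
structure TermObj {S : TraceSignature.{w}} {C : Type u} [Category.{v} C]
    [MonoidalCategory C] (x : TraceValuation C S) (L : Type v') : Type (max w u') where
  as : ObjTerm S.Obj

namespace TermObj

open FormalHom Rewiring

variable {S : TraceSignature.{w}} {C : Type u} [Category.{v} C] [MonoidalCategory C]
  [SymmetricCategory C] [PartiallyTracedCategory C] {x : TraceValuation C S} {L : Type v'}

/-- The morphisms of the category of terms: terms up to equality of their formal values. -/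
structure Hom (X Y : TermObj.{w, u, v, u', v'} x L) : Type (max w v') where
  cls : Quotient (TraceTerm.formalValueSetoid x X.as Y.as)

/-- The morphism that a term represents. -/
def Hom.of {X Y : TermObj.{w, u, v, u', v'} x L} (t : TraceTerm S X.as Y.as) : Hom X Y :=
  ⟨Quotient.mk _ t⟩

theorem Hom.of_eq_of_iff {X Y : TermObj.{w, u, v, u', v'} x L} {s t : TraceTerm S X.as Y.as} :
    (Hom.of s : Hom X Y) = Hom.of t ↔ s.formalValue x = t.formalValue x := by
  rw [Hom.of, Hom.of, Hom.mk.injEq, Quotient.eq]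
  rfl

/-- Composition of morphisms of the category of terms. -/
def Hom.comp {X Y Z : TermObj.{w, u, v, u', v'} x L} (f : Hom X Y) (g : Hom Y Z) : Hom X Z :=
  ⟨Quotient.map₂ TraceTerm.comp (by
    intro _ _ hf _ _ hg
    exact congrArg₂ FormalHom.comp hf hg) f.cls g.cls⟩

instance : Category.{max w v'} (TermObj.{w, u, v, u', v'} x L) where
  Hom := Hom
  id X := Hom.of (.id X.as)
  comp := Hom.comp
  id_comp := by
    rintro X Y ⟨⟨f⟩⟩
    exact Hom.of_eq_of_iff.2 (FormalHom.id_comp _)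
  comp_id := by
    rintro X Y ⟨⟨f⟩⟩
    exact Hom.of_eq_of_iff.2 (FormalHom.comp_id _)
  assoc := by
    rintro W X Y Z ⟨⟨f⟩⟩ ⟨⟨g⟩⟩ ⟨⟨h⟩⟩
    exact Hom.of_eq_of_iff.2 (comp_assoc _ _ _)

/-- Tensor product of morphisms of the category of terms. -/
def Hom.tensor {X Y X' Y' : TermObj.{w, u, v, u', v'} x L} (f : X ⟶ Y) (g : X' ⟶ Y') :
    (⟨X.as.tensor X'.as⟩ : TermObj.{w, u, v, u', v'} x L) ⟶ ⟨Y.as.tensor Y'.as⟩ :=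
  ⟨Quotient.map₂ TraceTerm.tensor (by
    intro _ _ hf _ _ hg
    exact congrArg₂ FormalHom.tensor hf hg) (Hom.cls f) (Hom.cls g)⟩

/-- The isomorphism represented by two terms whose formal values are mutually inverse rewirings. -/
def isoOf {X Y : TermObj.{w, u, v, u', v'} x L} (s : TraceTerm S X.as Y.as)
    (t : TraceTerm S Y.as X.as) (e : Rewiring X.as Y.as)
    (hs : s.formalValue x = ofHom (e.hom x.obj))
    (ht : t.formalValue x = ofHom (e.symm.hom x.obj)) : X ≅ Y where
  hom := Hom.of s
  inv := Hom.of t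
  hom_inv_id := Hom.of_eq_of_iff.2 ((congrArg₂ FormalHom.comp hs ht).trans
    ((ofHom_comp_ofHom _ _).trans (congrArg ofHom (hom_comp_symm _ e))))
  inv_hom_id := Hom.of_eq_of_iff.2 ((congrArg₂ FormalHom.comp ht hs).trans
    ((ofHom_comp_ofHom _ _).trans (congrArg ofHom (hom_symm_comp _ e))))

instance : MonoidalCategoryStruct (TermObj.{w, u, v, u', v'} x L) where
  tensorObj X Y := ⟨X.as.tensor Y.as⟩
  tensorUnit := ⟨.unit⟩
  tensorHom := Hom.tensor
  whiskerLeft X _ _ f := Hom.tensor (𝟙 X) f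
  whiskerRight f X := Hom.tensor f (𝟙 X)
  associator X Y Z :=
    isoOf (.assoc X.as Y.as Z.as) (.assocInv X.as Y.as Z.as) (.assoc _ _ _) rfl rfl
  leftUnitor X := isoOf (.leftUnitor X.as) (.leftUnitorInv X.as) (.leftUnitor _) rfl rfl
  rightUnitor X := isoOf (.rightUnitor X.as) (.rightUnitorInv X.as) (.rightUnitor _) rfl rfl

instance : MonoidalCategory (TermObj.{w, u, v, u', v'} x L) := MonoidalCategory.ofTensorHom
  (id_tensorHom_id := fun X Y => Hom.of_eq_of_iff.2 ((tensor_id _ _).trans (whiskerRight_id _ _)))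
  (id_tensorHom := fun _ _ _ _ => rfl)
  (tensorHom_id := fun _ _ => rfl)
  (tensorHom_comp_tensorHom := by
    rintro _ _ _ _ _ _ ⟨⟨f⟩⟩ ⟨⟨f'⟩⟩ ⟨⟨g⟩⟩ ⟨⟨g'⟩⟩
    exact Hom.of_eq_of_iff.2 (tensor_comp _ _ _ _))
  (associator_naturality := by
    rintro _ _ _ _ _ _ ⟨⟨f⟩⟩ ⟨⟨g⟩⟩ ⟨⟨h⟩⟩
    exact Hom.of_eq_of_iff.2 (tensor_comp_assoc _ _ _))
  (leftUnitor_naturality := by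
    rintro _ _ ⟨⟨f⟩⟩
    exact Hom.of_eq_of_iff.2 ((congrArg (comp · _) (id_tensor _ _)).trans
      (whiskerLeft_comp_leftUnitor _)))
  (rightUnitor_naturality := by
    rintro _ _ ⟨⟨f⟩⟩
    exact Hom.of_eq_of_iff.2 ((congrArg (comp · _) (tensor_id _ _)).trans
      (whiskerRight_comp_rightUnitor _)))
  (pentagon := fun W X Y Z => Hom.of_eq_of_iff.2 (by
    simp only [TraceTerm.formalValue, ofHom_tensor_ofHom, ofHom_comp_ofHom, tens_hom_id,
      tens_id_hom, ← hom_trans]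
    exact congrArg _ (congrArg _ (ext (by rintro (((_ | _) | _) | _) <;> rfl)))))
  (triangle := fun X Y => Hom.of_eq_of_iff.2 (by
    simp only [TraceTerm.formalValue, ofHom_tensor_ofHom, ofHom_comp_ofHom, tens_hom_id,
      tens_id_hom, ← hom_trans]
    exact congrArg _ (congrArg _ (ext (by rintro ((_ | ⟨⟨⟩⟩) | _) <;> rfl)))))

instance : SymmetricCategory (TermObj.{w, u, v, u', v'} x L) where
  braiding X Y := isoOf (.symm X.as Y.as) (.symm Y.as X.as) (.braid _ _) rfl
    (congrArg _ (congrArg _ (ext (by rintro (_ | _) <;> rfl))))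
  braiding_naturality_right := by
    rintro X _ _ ⟨⟨f⟩⟩
    exact Hom.of_eq_of_iff.2 (tensor_comp_braid _ _)
  braiding_naturality_left := by
    rintro _ _ ⟨⟨f⟩⟩ X
    exact Hom.of_eq_of_iff.2 (tensor_comp_braid _ _)
  hexagon_forward X Y Z := Hom.of_eq_of_iff.2 (by
    simp only [TraceTerm.formalValue, ofHom_tensor_ofHom, ofHom_comp_ofHom, tens_hom_id,
      tens_id_hom, ← hom_trans]
    exact congrArg _ (congrArg _ (ext (by rintro ((_ | _) | _) <;> rfl))))
  hexagon_reverse X Y Z := Hom.of_eq_of_iff.2 (by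
    simp only [TraceTerm.formalValue, ofHom_tensor_ofHom, ofHom_comp_ofHom, tens_hom_id,
      tens_id_hom, ← hom_trans]
    exact congrArg _ (congrArg _ (ext (by rintro (_ | (_ | _)) <;> rfl))))
  symmetry X Y := (isoOf (.symm X.as Y.as) (.symm Y.as X.as) (.braid _ _) _ _).hom_inv_id

/-- Trace of morphisms of the category of terms. -/
def Hom.trace {X Y U : TermObj.{w, u, v, u', v'} x L} (f : X ⊗ U ⟶ Y ⊗ U) : X ⟶ Y :=
  ⟨Quotient.map TraceTerm.trace (by
    intro _ _ hf
    exact congrArg (FormalHom.trace _) hf) (Hom.cls f)⟩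

instance : TracedCategory (TermObj.{w, u, v, u', v'} x L) where
  tr := Hom.trace
  naturality := by
    rintro X Y U X' Y' ⟨⟨f⟩⟩ ⟨⟨g⟩⟩ ⟨⟨h⟩⟩
    refine Hom.of_eq_of_iff.2 ?_
    simp only [TraceTerm.formalValue, tensor_id]
    rw [trace_comp, comp_trace]
  dinaturality := by
    rintro X Y U U' ⟨⟨f⟩⟩ ⟨⟨g⟩⟩
    refine Hom.of_eq_of_iff.2 ?_
    simp only [TraceTerm.formalValue, id_tensor]
    exact trace_dinaturality _ _
  strength := by
    rintro X Y U X' Y' ⟨⟨f⟩⟩ ⟨⟨g⟩⟩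
    exact Hom.of_eq_of_iff.2 (tensor_trace _ _)
  vanishing_I := by
    rintro X Y ⟨⟨f⟩⟩
    exact Hom.of_eq_of_iff.2 (trace_unit_eq _).symm
  vanishing_II := by
    rintro X Y U V ⟨⟨f⟩⟩
    exact Hom.of_eq_of_iff.2 (trace_trace_eq _)
  yanking X := Hom.of_eq_of_iff.2 (trace_braid X.as)

variable (x L)

/-- The value of `A` under the assignment of every variable to itself is `A`. -/
def evalIso : (A : ObjTerm S.Obj) →
    (A.eval (fun X => (⟨.var X⟩ : TermObj.{w, u, v, u', v'} x L)) ≅ ⟨A⟩)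
  | .var _ => Iso.refl _
  | .unit => Iso.refl _
  | .tensor A B => evalIso A ⊗ᵢ evalIso B

/-- The assignment that sends every variable to itself. -/
def valuation : TraceValuation (TermObj.{w, u, v, u', v'} x L) S where
  obj X := ⟨.var X⟩
  mor m := (evalIso x L (S.dom m)).hom ≫ Hom.of (X := ⟨S.dom m⟩) (Y := ⟨S.cod m⟩) (.var m) ≫
    (evalIso x L (S.cod m)).inv

theorem eval_valuation_comp_evalIso {A B : ObjTerm S.Obj} (t : TraceTerm S A B) :
    t.eval (valuation.{w, u, v, u', v'} x L) ≫ (evalIso x L B).hom =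
      (evalIso x L A).hom ≫ (Hom.of t : (⟨A⟩ : TermObj.{w, u, v, u', v'} x L) ⟶ ⟨B⟩) := by
  let θ := evalIso.{w, u, v, u', v'} x L
  induction t with
  | var m => simp [TraceTerm.eval, valuation]
  | id A => exact (Category.id_comp _).trans (Category.comp_id (θ A).hom).symm
  | comp s t ihs iht => exact ((CommSq.mk ihs).horiz_comp ⟨iht⟩).w
  | tensor s t ihs iht =>
    exact (tensorHom_comp_tensorHom _ _ _ _).trans
      ((congrArg₂ (· ⊗ₘ ·) ihs iht).trans (tensorHom_comp_tensorHom _ _ _ _).symm)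
  | assoc A B D => exact (associator_naturality (θ A).hom (θ B).hom (θ D).hom).symm
  | assocInv A B D => exact (associator_inv_naturality (θ A).hom (θ B).hom (θ D).hom).symm
  | leftUnitor A =>
    exact (leftUnitor_naturality (θ A).hom).symm.trans (congrArg (· ≫ _) (id_tensorHom _ _).symm)
  | leftUnitorInv A =>
    exact (congrArg (_ ≫ ·) (id_tensorHom _ _)).trans (leftUnitor_inv_naturality (θ A).hom).symm
  | rightUnitor A =>
    exact (rightUnitor_naturality (θ A).hom).symm.trans (congrArg (· ≫ _) (tensorHom_id _ _).symm)
  | rightUnitorInv A =>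
    exact (congrArg (_ ≫ ·) (tensorHom_id _ _)).trans (rightUnitor_inv_naturality (θ A).hom).symm
  | symm A B => exact (BraidedCategory.braiding_naturality (θ A).hom (θ B).hom).symm
  | @trace A B U t iht => exact TracedCategory.tr_comp_eq_comp_tr (θ U) iht

end TermObj

end

theorem IsTracedLaw.formalValue_eq {S : TraceSignature.{w}} {C : Type u} [Category.{v} C]
    [MonoidalCategory C] [SymmetricCategory C] [PartiallyTracedCategory C] {A B : ObjTerm S.Obj}
    {s t : TraceTerm S A B} (h : IsTracedLaw.{w, max w u', max w v'} s t)
    (x : TraceValuation C S) : s.formalValue x = t.formalValue x := by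
  let θ := TermObj.evalIso.{w, u, v, u', v'} x PUnit
  have key : (θ A).hom ≫ TermObj.Hom.of s = (θ A).hom ≫ TermObj.Hom.of t := by
    rw [← TermObj.eval_valuation_comp_evalIso, ← TermObj.eval_valuation_comp_evalIso, h]
  exact TermObj.Hom.of_eq_of_iff.1 ((cancel_epi (θ A).hom).1 key)

theorem IsTracedLaw.holdsWhenDefined {S : TraceSignature.{w}} {A B : ObjTerm S.Obj}
    {s t : TraceTerm S A B} (h : IsTracedLaw.{w, max w u', max w v'} s t) :
    HoldsWhenDefined.{w, u, v} s t := by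
  intro C _ _ _ _ x f hf g hg
  apply FormalHom.ofHom_injective
  rw [← s.formalValue_of_mem_peval x hf, ← t.formalValue_of_mem_peval x hg, h.formalValue_eq x]

theorem mainTheorem3 (S : TraceSignature.{w}) (A B : ObjTerm S.Obj)
    (s t : TraceTerm S A B) :
    (IsTracedLaw.{w, max w u', max w v'} s t → HoldsWhenDefined.{w, u, v} s t) ∧
    (GraphicallyProvable s t → HoldsWhenDefined.{w, u, v} s t) :=
  ⟨fun h => h.holdsWhenDefined, fun h =>
    IsTracedLaw.holdsWhenDefined.{w, u, v, w, w} (isTracedLaw_of_graphicallyProvable h)⟩
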